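/- Let $c>0$ and let $\lambda\in C^1((0,\infty),[0,\infty))$ satisfy $\Lambda(t)=\int_0^t\lambda(s)\,ds<\infty$ for all $t>0$. Let $(X(t),Y(t))_{t\ge0}$ be the reflecting orthogonal planar random motion with speed $c$ and rate $\lambda$: a particle starts at the origin in a direction chosen uniformly among right, up, left, down, moves with constant speed $c$, and at each event of a non-homogeneous Poisson process with rate function $\lambda(t)$ it switches to one of the three directions different from the current one, each with probability $1/3$, independently of the Poisson process. Then there is a function $f(x,t)$, of class $C^1$ on $\{(x,t):|x|<ct\}$, such that for every $t>0$ and every Borel set $A\subseteq(-ct,ct)$ $$P\{X(t)\in A,\ Y(t)=0\}=\int_A f(x,t)\,dx ,$$ and $f$ satisfies the problem $$\begin{cases}\dfrac{\partial^2 f}{\partial t^2}+2\lambda(t)\dfrac{\partial f}{\partial t}+\dfrac23\Bigl(\dfrac43\lambda(t)^2+\lambda'(t)\Bigr)f=c^2\dfrac{\partial^2 f}{\partial x^2},& |x|<ct,\\[2mm] f(x,t)\ge 0,& |x|<ct,\\[1mm] \displaystyle\int_{-ct}^{ct}f(x,t)\,dx=\tfrac12\bigl(e^{-2\Lambda(t)/3}-e^{-\Lambda(t)}\bigr),&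 t>0,\end{cases}$$ where the differential equation holds in the sense of distributions on $\{|x|<ct\}$, and if moreover $\lambda\in C^2((0,\infty))$, then $f$ is of class $C^2$ on $\{|x|<ct\}$ and the equation also holds pointwise. Moreover $$f(x,t)=\frac{e^{-2\Lambda(t)/3}}{4}\,\bar p\Bigl(\frac x2,t\Bigr),\qquad |x|<ct,$$ where $\bar p(\cdot,t)$ is (a version of) the density of the absolutely continuous component of the law at time $t$ of a telegraph process with velocity $c/2$ and rate function $\lambda(t)/3$, that is, of $T(t)=\int_0^t V_0(-1)^{N(s)}\,ds$ with $V_0$ uniform on $\{c/2,-c/2\}$ and independent of the Poisson process $N$ with rate function $\lambda(t)/3$. -/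

import Mathlib

open MeasureTheory ProbabilityTheory Set
open scoped NNReal ENNReal

noncomputable section

/-- The integrated rate `Λ(t) = ∫₀ᵗ λ(s) ds`. -/
def cumRate (lam : ℝ → ℝ) (t : ℝ) : ℝ := ∫ s in (0 : ℝ)..t, lam s

/-- Rate functions: `λ ∈ C¹((0,∞),[0,∞))` with `Λ(t) < ∞` for all `t > 0`. -/
structure IsRate (lam : ℝ → ℝ) : Prop where
  contDiffOn : ContDiffOn ℝ 1 lam (Ioi 0)
  nonneg : ∀ t, 0 < t → 0 ≤ lam t
  integrableOn : ∀ t, 0 < t → IntegrableOn lam (Ioc 0 t)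

/-- `N` is a non-homogeneous Poisson process with rate function `lam`: a counting process started
at `0`, with independent increments, `N t - N s` being Poisson with mean `∫ₛᵗ λ`. -/
structure IsPoissonProcess {Ω : Type*} [MeasurableSpace Ω] (N : ℝ≥0 → Ω → ℕ) (lam : ℝ → ℝ)
    (P : Measure Ω) : Prop where
  measurable : ∀ t, Measurable (N t)
  zero : ∀ ω, N 0 ω = 0
  mono : ∀ ω, Monotone fun t => N t ω
  rightCont : ∀ ω t, ContinuousWithinAt (fun s => N s ω) (Ici t) t
  indepIncrements : HasIndepIncrements N P
  law : ∀ s t : ℝ≥0, s ≤ t →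
    HasLaw (fun ω => N t ω - N s ω)
      (poissonMeasure (∫ u in (s : ℝ)..(t : ℝ), lam u).toNNReal) P

/-- Transition probabilities of the direction: uniform over the three directions that differ
from the current one. -/
def reflectProb (i j : Fin 4) : ℝ := if i = j then 0 else 1 / 3

/-- The sequence of successive directions (labels `0,1,2,3` stand for right, up, left, down):
a Markov chain with uniform initial law and transition probabilities `reflectProb`. -/
structure IsReflectingChain {Ω : Type*} [MeasurableSpace Ω] (D : ℕ → Ω → Fin 4)
    (P : Measure Ω) : Prop where
  measurable : ∀ n, Measurable (D n)
  law : ∀ (n : ℕ) (k : Fin (n + 1) → Fin 4),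
    P {ω | ∀ i : Fin (n + 1), D i ω = k i} =
      ENNReal.ofReal (1 / 4 * ∏ i : Fin n, reflectProb (k i.castSucc) (k i.succ))

/-- First coordinates of the directions right, up, left, down. -/
def dirX : Fin 4 → ℝ := ![1, 0, -1, 0]

/-- Second coordinates of the directions right, up, left, down. -/
def dirY : Fin 4 → ℝ := ![0, 1, 0, -1]

/-- `(X, Y)` is a reflecting orthogonal planar random motion with speed `c` whose changes of
direction are paced by a Poisson process with rate `lam`: the direction at time `s` is
`D (N s)`, with `D` the direction chain and `N` an independent Poisson process. -/
def IsReflectingMotion {Ω : Type*} [MeasurableSpace Ω] (c : ℝ) (lam : ℝ → ℝ)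
    (X Y : ℝ → Ω → ℝ) (P : Measure Ω) : Prop :=
  ∃ (N : ℝ≥0 → Ω → ℕ) (D : ℕ → Ω → Fin 4),
    IsPoissonProcess N lam P ∧ IsReflectingChain D P ∧
    IndepFun (fun ω n => D n ω) (fun ω t => N t ω) P ∧
    (∀ t, 0 ≤ t → ∀ ω, X t ω = ∫ s in (0 : ℝ)..t, c * dirX (D (N s.toNNReal ω) ω)) ∧
    (∀ t, 0 ≤ t → ∀ ω, Y t ω = ∫ s in (0 : ℝ)..t, c * dirY (D (N s.toNNReal ω) ω))

/-- `T` is a (symmetric, one-dimensional) telegraph process with velocity `v` and rate function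
`mu`: `T(t) = ∫₀ᵗ V₀ (-1)^{N(s)} ds`, with `V₀` uniform on `{v, -v}` and independent of the
Poisson process `N`. -/
def IsTelegraphProcess {Ω : Type*} [MeasurableSpace Ω] (v : ℝ) (mu : ℝ → ℝ)
    (T : ℝ → Ω → ℝ) (P : Measure Ω) : Prop :=
  ∃ (N : ℝ≥0 → Ω → ℕ) (V₀ : Ω → ℝ),
    IsPoissonProcess N mu P ∧ Measurable V₀ ∧
    P {ω | V₀ ω = v} = 1 / 2 ∧ P {ω | V₀ ω = -v} = 1 / 2 ∧
    IndepFun V₀ (fun ω t => N t ω) P ∧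
    ∀ t, 0 ≤ t → ∀ ω, T t ω = ∫ s in (0 : ℝ)..t, V₀ ω * (-1) ^ N s.toNNReal ω

/-- `q` is a density of the absolutely continuous component (in the Lebesgue decomposition) of
the law of the real random variable `Z`. -/
def IsAbsContComponent {Ω : Type*} [MeasurableSpace Ω] (Z : Ω → ℝ) (P : Measure Ω)
    (q : ℝ → ℝ) : Prop :=
  Measurable q ∧ (∀ x, 0 ≤ q x) ∧ ∃ ν : Measure ℝ, ν ⟂ₘ volume ∧
    ∀ A, MeasurableSet A → P {ω | Z ω ∈ A} = ν A + ∫⁻ x in A, ENNReal.ofReal (q x)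

/-- The open set of the `(x, t)` with `|x| < c t`. -/
def lightCone (c : ℝ) : Set (ℝ × ℝ) := {p | |p.1| < c * p.2}

/-- The coefficient `(2/3) ((4/3) λ(t)² + λ'(t))`. -/
def zeroOrderCoeff (lam : ℝ → ℝ) (t : ℝ) : ℝ := 2 / 3 * (4 / 3 * lam t ^ 2 + deriv lam t)

/-- The equation `f_tt + 2λ f_t + (2/3)((4/3)λ² + λ') f = c² f_xx` on `|x| < ct` in the sense of
distributions: the formal adjoint of the operator is applied to the test functions. -/
def SolvesWeakly (c : ℝ) (lam : ℝ → ℝ) (f : ℝ → ℝ → ℝ) : Prop :=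
  ∀ φ : ℝ × ℝ → ℝ, ContDiff ℝ (⊤ : ℕ∞) φ → HasCompactSupport φ → tsupport φ ⊆ lightCone c →
    ∫ p : ℝ × ℝ, f p.1 p.2 *
      (iteratedDeriv 2 (fun s => φ (p.1, s)) p.2
        - deriv (fun s => 2 * lam s * φ (p.1, s)) p.2
        + zeroOrderCoeff lam p.2 * φ p
        - c ^ 2 * iteratedDeriv 2 (fun y => φ (y, p.2)) p.1) = 0

/-- The same equation, pointwise with classical derivatives. -/
def SolvesClassically (c : ℝ) (lam : ℝ → ℝ) (f : ℝ → ℝ → ℝ) : Prop :=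
  ContDiffOn ℝ 2 (fun p : ℝ × ℝ => f p.1 p.2) (lightCone c) ∧
  ∀ x t, |x| < c * t →
    iteratedDeriv 2 (fun s => f x s) t + 2 * lam t * deriv (fun s => f x s) t
      + zeroOrderCoeff lam t * f x t = c ^ 2 * iteratedDeriv 2 (fun y => f y t) x

/-- `f` solves the edge problem. For a rate that is only `C¹` the solution is in general only
`C¹`, and the equation holds in the sense of distributions; for a `C²` rate the solution is `C²`
and the equation holds pointwise as well. -/
structure SolvesEdgeProblem (c : ℝ) (lam : ℝ → ℝ) (f : ℝ → ℝ → ℝ) : Prop where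
  contDiffOn : ContDiffOn ℝ 1 (fun p : ℝ × ℝ => f p.1 p.2) (lightCone c)
  weak : SolvesWeakly c lam f
  classical : ContDiffOn ℝ 2 lam (Ioi 0) → SolvesClassically c lam f
  nonneg : ∀ x t, |x| < c * t → 0 ≤ f x t
  integrable : ∀ t, 0 < t → IntegrableOn (fun x => f x t) (Ioo (-(c * t)) (c * t))
  mass : ∀ t, 0 < t → ∫ x in Ioo (-(c * t)) (c * t), f x t =
    1 / 2 * (Real.exp (-(2 * cumRate lam t / 3)) - Real.exp (-cumRate lam t))

end

/-! Almost surely `Y(t) = 0` only if every direction used up to time `t` is horizontal. Indeed, if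
the vertical velocities used are not all equal, then `Y(t)` has no atom on the event of `n` jumps,
and if they are all equal to some `v ≠ 0`, then `Y(t) = v t ≠ 0`
(`IsPoissonProcess.measure_pathIntegral_eq_zero`). The chain never repeats a direction, so a
horizontal path alternates between right and left (`eq_altDirections`): for `n` jumps there remain
two sequences, each of probability `(1/4)(1/3)^n`. The weight of `n` jumps is homogeneous of degree
`n` in the rate, so the factors `1/3` turn `λ` into `λ/3` in the kernel, while the normalisation
`e^{-Λ}` is unchanged. A telegraph process with rate `λ/3` has the same kernel with normalisation
`e^{-Λ/3}` and initial weights `1/2`; the quotient gives the factor `e^{-2Λ/3}`, and halving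
velocity and position turns `1/2` into `1/4`.

The kernel is a function `D(a, b)` of the times `a`, `b` spent in the current and in the opposite
direction. Decomposing at the last jump gives `D(a, b) = λ(b) + ∫₀ᵃ λ(s + b) D(b, s) ds`
(`altDensity_eq`). Hence `∂D/∂a (a, b) = λ(a + b) D(b, a)`, and `D` is as smooth as `λ` for the
classes `C¹` and `C²`. Taken with the rate `λ/3`, in the variables `a = (ct + x)/(2c)`, `b = (ct -
x)/(2c)`, it gives the densities `f_r`, `f_l` of right- and left-movers on `y = 0`. Their sum `g`
and difference `d` satisfy `g_t + c d_x = -(2/3) λ g` and `d_t + c g_x = -(4/3) λ d`. Eliminating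
`d` gives the second-order equation: pointwise if everything is `C²`, and otherwise by writing `g`
times the adjoint operator applied to a test function as a divergence.

The link with the process is `IsPoissonProcess.jumpLaw_succ`, a recursion over the number of jumps
for the law of the position. It is obtained without conditioning on jump times: with the final
velocity frozen, `e^{Λ(s)} E[h(W(s) + z (T - s)); N(s) = n + 1]` has right derivative `λ e^Λ` times
the same expectation on `N(s) = n`. This is proved for `h(x) = e^{iξx}`, and characteristic
functions carry it over to measures. `altIntegral_succ` is the same recursion for the kernel. -/

/-! ### Kernels of the alternating motion -/

/-- Density of the jump times of an alternating motion, with respect to the total time `a` spent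
in the current direction and the total time `b` spent in the opposite one, after `n + 1` jumps. -/
noncomputable def altKernel (g : ℝ → ℝ≥0∞) : ℕ → ℝ → ℝ → ℝ≥0∞
  | 0, _, b => g b
  | n + 1, a, b => ∫⁻ s in Ioo 0 a, g (s + b) * altKernel g n b s

/-- The sum of `altKernel` over all numbers of jumps. -/
noncomputable def altDensity (g : ℝ → ℝ≥0∞) (a b : ℝ) : ℝ≥0∞ := ∑' n, altKernel g n a b

/-- The integral of a test function of the position against the kernel after `n + 1` jumps. -/
noncomputable def altIntegral (g : ℝ → ℝ≥0∞) (n : ℕ) (t : ℝ) (ψ : ℝ → ℝ≥0∞) : ℝ≥0∞ :=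
  ∫⁻ b in Ioo 0 t, ψ (t - 2 * b) * altKernel g n (t - b) b

theorem measurable_lintegral_Ioo {F : ℝ × ℝ → ℝ → ℝ≥0∞}
    (hF : Measurable fun q : (ℝ × ℝ) × ℝ => F q.1 q.2) :
    Measurable fun p : ℝ × ℝ => ∫⁻ s in Ioo 0 p.1, F p s := by
  have : (fun p : ℝ × ℝ => ∫⁻ s in Ioo 0 p.1, F p s) = fun p : ℝ × ℝ =>
      ∫⁻ s, {q : (ℝ × ℝ) × ℝ | 0 < q.2 ∧ q.2 < q.1.1}.indicator (fun q => F q.1 q.2) (p, s) := by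
    funext p
    rw [← lintegral_indicator measurableSet_Ioo]
    rfl
  rw [this]
  refine Measurable.lintegral_prod_right' (f := {q : (ℝ × ℝ) × ℝ | 0 < q.2 ∧ q.2 < q.1.1}.indicator
    (fun q => F q.1 q.2)) (hF.indicator ?_)
  exact (measurableSet_lt measurable_const measurable_snd).inter
    (measurableSet_lt measurable_snd measurable_fst.fst)

section Kernel

variable {g : ℝ → ℝ≥0∞}

theorem measurable_altKernel (hg : Measurable g) (n : ℕ) :
    Measurable fun p : ℝ × ℝ => altKernel g n p.1 p.2 := by
  induction n with
  | zero => exact hg.comp measurable_snd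
  | succ n ih =>
    refine measurable_lintegral_Ioo (F := fun p s => g (s + p.2) * altKernel g n p.2 s) ?_
    exact (hg.comp (measurable_snd.add measurable_fst.snd)).mul
      (ih.comp (measurable_fst.snd.prodMk measurable_snd))

theorem measurable_altDensity (hg : Measurable g) :
    Measurable fun p : ℝ × ℝ => altDensity g p.1 p.2 :=
  Measurable.tsum fun n => measurable_altKernel hg n

theorem altKernel_mono (n : ℕ) {a a' : ℝ} (h : a ≤ a') (b : ℝ) :
    altKernel g n a b ≤ altKernel g n a' b := by
  cases n with
  | zero => exact le_rfl
  | succ n => exact lintegral_mono_set (Ioo_subset_Ioo_right h)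

theorem altDensity_mono {a a' : ℝ} (h : a ≤ a') (b : ℝ) :
    altDensity g a b ≤ altDensity g a' b :=
  ENNReal.tsum_le_tsum fun n => altKernel_mono n h b

/-- The kernel of index `n` contains one value of `g` for each of its `n + 1` jumps. This
homogeneity later absorbs the transition probabilities `1/3` into the rate. -/
theorem altKernel_const_mul (hg : Measurable g) (c : ℝ≥0∞) (n : ℕ) (a b : ℝ) :
    altKernel (fun s => c * g s) n a b = c ^ (n + 1) * altKernel g n a b := by
  induction n generalizing a b with
  | zero => simp [altKernel]
  | succ n ih =>
    simp only [altKernel, ih]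
    rw [← lintegral_const_mul]
    · refine lintegral_congr fun s => ?_
      ring
    · exact (hg.comp (measurable_id.add_const b)).mul
        ((measurable_altKernel hg n).comp (measurable_const.prodMk measurable_id))

/-- The recursion at the last jump, summed over all numbers of jumps. Finiteness, continuity and
differentiability of the density are all read off from this equation. -/
theorem altDensity_eq (hg : Measurable g) (a b : ℝ) :
    altDensity g a b = g b + ∫⁻ s in Ioo 0 a, g (s + b) * altDensity g b s := by
  rw [altDensity, tsum_eq_zero_add' ENNReal.summable]
  congr 1
  simp only [altKernel, altDensity]
  rw [← lintegral_tsum]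
  · simp only [ENNReal.tsum_mul_left]
  · intro n
    exact ((hg.comp (measurable_id.add_const b)).mul
        ((measurable_altKernel hg n).comp (measurable_const.prodMk measurable_id))).aemeasurable

theorem lintegral_Ioo_reflect (F : ℝ → ℝ≥0∞) (w : ℝ) :
    ∫⁻ b in Ioo 0 w, F b = ∫⁻ b in Ioo 0 w, F (w - b) := by
  have h := (Measure.measurePreserving_sub_left (volume : Measure ℝ) w).setLIntegral_comp_preimage_emb
    (MeasurableEquiv.subLeft w).measurableEmbedding F (Ioo 0 w)
  rw [← h]
  congr 2
  simp

theorem lintegral_Ioo_shift (F : ℝ → ℝ≥0∞) (b t : ℝ) :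
    ∫⁻ s in Ioo 0 (t - b), F (s + b) = ∫⁻ w in Ioo b t, F w := by
  have h := (measurePreserving_add_right (volume : Measure ℝ) b).setLIntegral_comp_preimage_emb
    (MeasurableEquiv.addRight b).measurableEmbedding F (Ioo b t)
  rw [← h]
  congr 2
  simp

/-- Decomposition at the time `w` of the last jump. Positions are measured along the current
direction, so a position `x` just before the jump counts as `-x` after it, and `t - w` is then
added. -/
theorem altIntegral_succ (hg : Measurable g) (n : ℕ) (t : ℝ) {ψ : ℝ → ℝ≥0∞} (hψ : Measurable ψ) :
    altIntegral g (n + 1) t ψ =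
      ∫⁻ w in Ioo 0 t, g w * altIntegral g n w (fun x => ψ (t - w - x)) := by
  have hk := measurable_altKernel hg n
  let F : ℝ → ℝ → ℝ≥0∞ := fun b w => {p : ℝ × ℝ | 0 < p.1 ∧ p.1 < p.2 ∧ p.2 < t}.indicator
      (fun p => ψ (t - 2 * p.1) * (g p.2 * altKernel g n p.1 (p.2 - p.1))) (b, w)
  have hS : MeasurableSet {p : ℝ × ℝ | 0 < p.1 ∧ p.1 < p.2 ∧ p.2 < t} :=
    (measurableSet_lt measurable_const measurable_fst).inter
      ((measurableSet_lt measurable_fst measurable_snd).inter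
        (measurableSet_lt measurable_snd measurable_const))
  have hF : Measurable (Function.uncurry F) := by
    refine Measurable.indicator (f := fun p : ℝ × ℝ =>
      ψ (t - 2 * p.1) * (g p.2 * altKernel g n p.1 (p.2 - p.1))) ?_ hS
    exact (hψ.comp (by fun_prop)).mul ((hg.comp measurable_snd).mul
      (hk.comp (measurable_fst.prodMk (measurable_snd.sub measurable_fst))))
  have h1 : altIntegral g (n + 1) t ψ = ∫⁻ b, ∫⁻ w, F b w := by
    rw [altIntegral, ← lintegral_indicator measurableSet_Ioo]
    refine lintegral_congr fun b => ?_
    by_cases hb : b ∈ Ioo 0 t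
    · rw [indicator_of_mem hb]
      have e := lintegral_Ioo_shift (fun w => g w * altKernel g n b (w - b)) b t
      simp only [add_sub_cancel_right] at e
      simp only [altKernel]
      rw [e, ← lintegral_const_mul, ← lintegral_indicator measurableSet_Ioo]
      · refine lintegral_congr fun w => ?_
        simp only [F, indicator, mem_Ioo, mem_ofPred_eq, hb.1, true_and]
      · exact hg.mul (hk.comp (measurable_const.prodMk (measurable_id.sub_const b)))
    · rw [indicator_of_notMem hb]
      symm
      have h0 : ∀ w, F b w = 0 := fun w =>
        indicator_of_notMem (fun h => hb ⟨h.1, h.2.1.trans h.2.2⟩) _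
      simp only [h0, lintegral_zero]
  rw [h1, lintegral_lintegral_swap hF.aemeasurable, ← lintegral_indicator measurableSet_Ioo]
  refine lintegral_congr fun w => ?_
  by_cases hw : w ∈ Ioo 0 t
  -- The last jump exchanges the current and the opposite direction: the reflection `b ↦ w - b`
  -- makes the two parametrisations agree.
  · rw [indicator_of_mem hw, altIntegral, lintegral_Ioo_reflect, ← lintegral_const_mul,
      ← lintegral_indicator measurableSet_Ioo]
    · refine lintegral_congr fun b => ?_
      have e1 : t - w - (w - 2 * (w - b)) = t - 2 * b := by ring
      have e2 : w - (w - b) = b := by ring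
      simp only [F, indicator, mem_Ioo, mem_ofPred_eq, hw.2, and_true, e1, e2]
      split_ifs <;> ring
    · exact (hψ.comp (g := ψ) (f := fun b => t - w - (w - 2 * (w - b))) (by fun_prop)).mul
        (hk.comp (f := fun b => (w - (w - b), w - b)) (by fun_prop))
  · rw [indicator_of_notMem hw]
    have h0 : ∀ b, F b w = 0 := fun b =>
      indicator_of_notMem (fun h => hw ⟨h.1.trans h.2.1, h.2.2⟩) _
    simp only [h0, lintegral_zero]

end Kernel

/-! ### Rate functions and the total mass of the kernels -/

section Rate

/-- A rate function set to zero on the nonpositive half-line, with values in `ℝ≥0∞`. -/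
noncomputable def rateENN (lam : ℝ → ℝ) (t : ℝ) : ℝ≥0∞ :=
  ENNReal.ofReal ((Ioi (0 : ℝ)).indicator lam t)

variable {lam : ℝ → ℝ}

theorem rateENN_of_pos {t : ℝ} (ht : 0 < t) : rateENN lam t = ENNReal.ofReal (lam t) := by
  rw [rateENN, indicator_of_mem (mem_Ioi.2 ht)]

theorem IsRate.continuousOn (h : IsRate lam) : ContinuousOn lam (Ioi 0) :=
  h.contDiffOn.continuousOn

theorem IsRate.measurable_indicator (h : IsRate lam) :
    Measurable ((Ioi (0 : ℝ)).indicator lam) := by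
  classical
  have := h.continuousOn.measurable_piecewise (g := fun _ => (0 : ℝ)) continuousOn_const
    measurableSet_Ioi
  rwa [show (fun _ : ℝ => (0 : ℝ)) = 0 from rfl, piecewise_eq_indicator] at this

theorem IsRate.measurable_rateENN (h : IsRate lam) : Measurable (rateENN lam) :=
  h.measurable_indicator.ennreal_ofReal

theorem rateENN_ne_top (t : ℝ) : rateENN lam t ≠ ∞ := ENNReal.ofReal_ne_top

theorem IsRate.const_mul (h : IsRate lam) {k : ℝ} (hk : 0 ≤ k) :
    IsRate fun t => k * lam t where
  contDiffOn := contDiffOn_const.mul h.contDiffOn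
  nonneg t ht := mul_nonneg hk (h.nonneg t ht)
  integrableOn t ht := (h.integrableOn t ht).const_mul k

theorem IsRate.intervalIntegrable (h : IsRate lam) {s t : ℝ} (hs : 0 ≤ s) (ht : 0 ≤ t) :
    IntervalIntegrable lam volume s t := by
  have key : ∀ u, 0 ≤ u → IntervalIntegrable lam volume 0 u := by
    intro u hu
    rcases hu.eq_or_lt with rfl | hu'
    · exact IntervalIntegrable.refl
    · exact (intervalIntegrable_iff_integrableOn_Ioc_of_le hu).2 (h.integrableOn u hu')
  exact (key s hs).symm.trans (key t ht)

theorem IsRate.cumRate_sub (h : IsRate lam) {s t : ℝ} (hs : 0 ≤ s) (ht : 0 ≤ t) :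
    cumRate lam t - cumRate lam s = ∫ u in s..t, lam u :=
  intervalIntegral.integral_interval_sub_left (h.intervalIntegrable le_rfl ht)
    (h.intervalIntegrable le_rfl hs)

@[simp] theorem cumRate_zero : cumRate lam 0 = 0 := intervalIntegral.integral_same

theorem IsRate.cumRate_mono (h : IsRate lam) {s t : ℝ} (hs : 0 ≤ s) (hst : s ≤ t) :
    cumRate lam s ≤ cumRate lam t := by
  rw [← sub_nonneg, h.cumRate_sub hs (hs.trans hst)]
  refine intervalIntegral.integral_nonneg_of_ae_restrict hst ?_
  rw [← Measure.restrict_congr_set Ioc_ae_eq_Icc]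
  exact (ae_restrict_iff' measurableSet_Ioc).2
    (Filter.Eventually.of_forall fun u hu => h.nonneg u (hs.trans_lt hu.1))

theorem IsRate.cumRate_nonneg (h : IsRate lam) {t : ℝ} (ht : 0 ≤ t) : 0 ≤ cumRate lam t := by
  simpa using h.cumRate_mono le_rfl ht

theorem IsRate.hasDerivAt_cumRate (h : IsRate lam) {t : ℝ} (ht : 0 < t) :
    HasDerivAt (cumRate lam) (lam t) t :=
  intervalIntegral.integral_hasDerivAt_right (h.intervalIntegrable le_rfl ht.le)
    (h.continuousOn.stronglyMeasurableAtFilter isOpen_Ioi t ht)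
    (h.continuousOn.continuousAt (Ioi_mem_nhds ht))

theorem IsRate.continuousOn_cumRate (h : IsRate lam) (T : ℝ) (hT : 0 ≤ T) :
    ContinuousOn (cumRate lam) (Icc 0 T) := by
  have := intervalIntegral.continuousOn_primitive_interval (f := lam) (a := 0) (b := T)
    (μ := volume) ?_
  · rwa [uIcc_of_le hT] at this
  · rw [uIcc_of_le hT]
    exact (integrableOn_Icc_iff_integrableOn_Ioc).2
      ((intervalIntegrable_iff_integrableOn_Ioc_of_le hT).1 (h.intervalIntegrable le_rfl hT))

theorem IsRate.lintegral_rateENN (h : IsRate lam) (n : ℕ) {t : ℝ} (ht : 0 ≤ t) :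
    ∫⁻ w in Ioo 0 t, rateENN lam w *
        ENNReal.ofReal (cumRate lam w ^ n / n.factorial) =
      ENNReal.ofReal (cumRate lam t ^ (n + 1) / (n + 1).factorial) := by
  have hd : ∀ w ∈ Ioo 0 t, HasDerivAt
      (fun w => cumRate lam w ^ (n + 1) / ((n + 1).factorial : ℝ))
      (lam w * (cumRate lam w ^ n / n.factorial)) w := by
    intro w hw
    refine (((h.hasDerivAt_cumRate hw.1).pow (n + 1)).div_const
      ((n + 1).factorial : ℝ)).congr_deriv ?_
    rw [Nat.factorial_succ]
    push_cast
    field_simp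
  have hi : IntervalIntegrable (fun w => lam w * (cumRate lam w ^ n / n.factorial)) volume 0 t := by
    refine (h.intervalIntegrable le_rfl ht).mul_continuousOn ?_
    rw [uIcc_of_le ht]
    exact ((h.continuousOn_cumRate t ht).pow n).div_const _
  have hc : ContinuousOn (fun w => cumRate lam w ^ (n + 1) / ((n + 1).factorial : ℝ)) (Icc 0 t) :=
    ((h.continuousOn_cumRate t ht).pow (n + 1)).div_const _
  have e := intervalIntegral.integral_eq_sub_of_hasDerivAt_of_le ht hc hd hi
  simp only [cumRate_zero, ne_eq, Nat.add_eq_zero_iff, one_ne_zero, and_false, not_false_eq_true,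
    zero_pow, zero_div, sub_zero] at e
  rw [← e, intervalIntegral.integral_of_le ht, integral_Ioc_eq_integral_Ioo,
    ofReal_integral_eq_lintegral_ofReal]
  · refine setLIntegral_congr_fun measurableSet_Ioo fun w hw => ?_
    rw [rateENN_of_pos hw.1, ENNReal.ofReal_mul (h.nonneg w hw.1)]
  · exact ((intervalIntegrable_iff_integrableOn_Ioc_of_le ht).1 hi).mono_set Ioo_subset_Ioc_self
  · refine (ae_restrict_iff' measurableSet_Ioo).2 (Filter.Eventually.of_forall fun w hw => ?_)
    exact mul_nonneg (h.nonneg w hw.1)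
      (div_nonneg (pow_nonneg (h.cumRate_nonneg hw.1.le) n) (Nat.cast_nonneg _))

/-- With a constant test function the directions play no role, and the recursion at the last jump
becomes the one satisfied by the powers of `Λ`. -/
theorem IsRate.altIntegral_one (h : IsRate lam) (n : ℕ) {t : ℝ} (ht : 0 ≤ t) :
    altIntegral (rateENN lam) n t (fun _ => 1) =
      ENNReal.ofReal (cumRate lam t ^ (n + 1) / (n + 1).factorial) := by
  induction n generalizing t with
  | zero => simpa [altIntegral, altKernel] using h.lintegral_rateENN 0 ht
  | succ n ih =>
    rw [altIntegral_succ h.measurable_rateENN n t measurable_const,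
      ← h.lintegral_rateENN (n + 1) ht]
    refine setLIntegral_congr_fun measurableSet_Ioo fun w hw => ?_
    rw [ih hw.1.le]

theorem IsRate.lintegral_altDensity (h : IsRate lam) {t : ℝ} (ht : 0 ≤ t) :
    ∫⁻ b in Ioo 0 t, altDensity (rateENN lam) (t - b) b =
      ENNReal.ofReal (Real.exp (cumRate lam t) - 1) := by
  have hk := measurable_altKernel h.measurable_rateENN
  simp only [altDensity]
  have hm : ∀ n, Measurable fun b => altKernel (rateENN lam) n (t - b) b := fun n =>
    (hk n).comp (f := fun b => (t - b, b)) (by fun_prop)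
  rw [lintegral_tsum fun n => (hm n).aemeasurable]
  have e : ∀ n, ∫⁻ b in Ioo 0 t, altKernel (rateENN lam) n (t - b) b =
      ENNReal.ofReal (cumRate lam t ^ (n + 1) / (n + 1).factorial) := by
    intro n
    rw [← h.altIntegral_one n ht]
    simp [altIntegral]
  -- The exponential series without its constant term, since the kernel of index `n` describes `n +
  -- 1` jumps.
  have hs := (hasSum_nat_add_iff' 1).2 (NormedSpace.expSeries_div_hasSum_exp (cumRate lam t))
  rw [← Real.exp_eq_exp_ℝ] at hs
  simp only [e]
  rw [← ENNReal.ofReal_tsum_of_nonneg (fun n => ?_) hs.summable, hs.tsum_eq]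
  · simp
  · exact div_nonneg (pow_nonneg (h.cumRate_nonneg ht) _) (Nat.cast_nonneg _)

/-- The total mass is known only along lines where the two times have constant sum. Monotonicity in
the first argument allows replacing `b` by `b + w - s ≥ b`, which lies on such a line. -/
theorem IsRate.lintegral_altDensity_lt_top (h : IsRate lam) {b : ℝ} (hb : 0 ≤ b) {w : ℝ}
    (hw : 0 ≤ w) : ∫⁻ s in Ioo 0 w, altDensity (rateENN lam) b s < ∞ := by
  calc ∫⁻ s in Ioo 0 w, altDensity (rateENN lam) b s
      ≤ ∫⁻ s in Ioo 0 w, altDensity (rateENN lam) (b + w - s) s :=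
        setLIntegral_mono' measurableSet_Ioo fun s hs => altDensity_mono (by linarith [hs.2]) s
    _ ≤ ∫⁻ s in Ioo 0 (b + w), altDensity (rateENN lam) (b + w - s) s :=
        lintegral_mono_set (Ioo_subset_Ioo_right (by linarith))
    _ < ∞ := by
        rw [h.lintegral_altDensity (by positivity)]
        exact ENNReal.ofReal_lt_top

theorem IsRate.altDensity_lt_top (h : IsRate lam) {a b : ℝ} (ha : 0 ≤ a) (hb : 0 < b) :
    altDensity (rateENN lam) a b < ∞ := by
  rw [altDensity_eq h.measurable_rateENN]
  refine ENNReal.add_lt_top.2 ⟨ENNReal.ofReal_lt_top, ?_⟩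
  -- The rate may be unbounded near `0`, but it is evaluated only at `s + b` in the compact interval
  -- `[b, a + b]`.
  obtain ⟨K, hK⟩ := isCompact_Icc.exists_bound_of_continuousOn
    (h.continuousOn.mono (s := Ioi 0) (t := Icc b (a + b)) fun x hx => hb.trans_le hx.1)
  calc ∫⁻ s in Ioo 0 a, rateENN lam (s + b) * altDensity (rateENN lam) b s
      ≤ ∫⁻ s in Ioo 0 a, ENNReal.ofReal K * altDensity (rateENN lam) b s := by
        refine setLIntegral_mono' measurableSet_Ioo fun s hs => ?_
        gcongr
        rw [rateENN_of_pos (add_pos hs.1 hb)]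
        exact ENNReal.ofReal_le_ofReal ((le_abs_self _).trans
          (hK _ ⟨by linarith [hs.1], by linarith [hs.2]⟩))
    _ = ENNReal.ofReal K * ∫⁻ s in Ioo 0 a, altDensity (rateENN lam) b s :=
        lintegral_const_mul _ ((measurable_altDensity h.measurable_rateENN).comp
          (measurable_const.prodMk measurable_id))
    _ < ∞ := ENNReal.mul_lt_top ENNReal.ofReal_lt_top
        (h.lintegral_altDensity_lt_top hb.le ha)

end Rate

section

open Filter Topology Interval

/-! ### Parameter integrals with an integrable singularity at the origin -/

/-- Functions of `(b, s)` that, locally uniformly in `b > 0`, are dominated by a function of `s`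
integrable on each `(0, a]`. -/
def LocallyDominated (Φ : ℝ → ℝ → ℝ) : Prop :=
  ∀ b₀ > 0, ∀ a > 0, ∃ bound : ℝ → ℝ, IntegrableOn bound (Ioc 0 a) ∧
    ∀ᶠ b in 𝓝 b₀, ∀ s ∈ Ioc 0 a, ‖Φ b s‖ ≤ bound s

section LocallyDominated

variable {Φ Ψ : ℝ → ℝ → ℝ}

theorem LocallyDominated.congr (hΦ : LocallyDominated Φ)
    (h : ∀ b > 0, ∀ s > 0, Φ b s = Ψ b s) : LocallyDominated Ψ := by
  intro b₀ hb a ha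
  obtain ⟨f, hf, hf'⟩ := hΦ b₀ hb a ha
  refine ⟨f, hf, ?_⟩
  filter_upwards [hf', Ioi_mem_nhds hb] with b h1 h2 s hs
  rw [← h b h2 s hs.1]
  exact h1 s hs

theorem LocallyDominated.add (hΦ : LocallyDominated Φ) (hΨ : LocallyDominated Ψ) :
    LocallyDominated fun b s => Φ b s + Ψ b s := by
  intro b₀ hb a ha
  obtain ⟨f, hf, hf'⟩ := hΦ b₀ hb a ha
  obtain ⟨g, hg, hg'⟩ := hΨ b₀ hb a ha
  refine ⟨fun s => f s + g s, hf.add hg, ?_⟩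
  filter_upwards [hf', hg'] with b h1 h2 s hs
  exact (norm_add_le _ _).trans (add_le_add (h1 s hs) (h2 s hs))

theorem LocallyDominated.mul_left {ρ : ℝ → ℝ} (hρ : ContinuousOn ρ (Ioi 0))
    (hΦ : LocallyDominated Φ) : LocallyDominated fun b s => ρ (s + b) * Φ b s := by
  intro b₀ hb a ha
  obtain ⟨f, hf, hf'⟩ := hΦ b₀ hb a ha
  obtain ⟨K, hK⟩ := isCompact_Icc.exists_bound_of_continuousOn
    (hρ.mono (s := Ioi 0) (t := Icc (b₀ / 2) (a + 2 * b₀)) fun x hx =>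
      (half_pos hb).trans_le hx.1)
  refine ⟨fun s => K * f s, hf.const_mul K, ?_⟩
  filter_upwards [hf', Ioo_mem_nhds (half_lt_self hb) (by linarith : b₀ < 2 * b₀)]
    with b h1 h2 s hs
  rw [norm_mul]
  have h3 := hK (s + b) ⟨by linarith [h2.1, hs.1], by linarith [h2.2, hs.2]⟩
  exact mul_le_mul h3 (h1 s hs) (norm_nonneg _) ((norm_nonneg _).trans h3)

theorem LocallyDominated.intervalIntegrable (hΦ : LocallyDominated Φ) {b : ℝ} (hb : 0 < b)
    (hm : AEStronglyMeasurable (Φ b) (volume.restrict (Ioi 0))) {a : ℝ} (ha : 0 < a) :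
    IntervalIntegrable (Φ b) volume 0 a := by
  obtain ⟨f, hf, hf'⟩ := hΦ b hb a ha
  rw [intervalIntegrable_iff_integrableOn_Ioc_of_le ha.le]
  exact Integrable.mono' hf (hm.mono_measure (Measure.restrict_mono Ioc_subset_Ioi_self le_rfl))
    ((ae_restrict_iff' measurableSet_Ioc).2 (Eventually.of_forall hf'.self_of_nhds))

/-- Dominated convergence. Continuity is required only in the parameter, for fixed `s`, so this can
be used to prove joint continuity of the alternating density before it is known. -/
theorem LocallyDominated.continuousOn_primitive (hΦ : LocallyDominated Φ)
    (hm : ∀ b > 0, AEStronglyMeasurable (Φ b) (volume.restrict (Ioi 0)))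
    (hc : ∀ s > 0, ContinuousOn (fun b => Φ b s) (Ioi 0)) :
    ContinuousOn (fun p : ℝ × ℝ => ∫ s in (0 : ℝ)..p.1, Φ p.2 s) (Ioi 0 ×ˢ Ioi 0) := by
  rintro ⟨a₀, b₀⟩ ⟨ha, hb⟩
  simp only [mem_Ioi] at ha hb
  obtain ⟨f, hf, hf'⟩ := hΦ b₀ hb (a₀ + 1) (by linarith)
  classical
  -- Extension by zero makes the base point `0` interior to the interval `(-1, a₀ + 1)` and gives
  -- measurability for every real parameter.
  let F : ℝ → ℝ → ℝ := fun b => (Ioi (0 : ℝ)).indicator (if 0 < b then Φ b else 0)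
  have hI : Ι (-1) (a₀ + 1) = Ioc (-1) (a₀ + 1) := uIoc_of_le (by linarith)
  have key : ContinuousAt (fun p : ℝ × ℝ => ∫ s in (0 : ℝ)..p.2, F p.1 s) (b₀, a₀) := by
    refine intervalIntegral.continuousAt_parametric_primitive_of_dominated (F := F)
      ((Ioc 0 (a₀ + 1)).indicator f) (-1) (a₀ + 1) ?_ ?_ ?_ ?_ ⟨by norm_num, by linarith⟩
      ⟨by linarith, by linarith⟩ (by simp)
    · intro b
      refine AEStronglyMeasurable.restrict ?_
      refine (aestronglyMeasurable_indicator_iff measurableSet_Ioi).2 ?_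
      split_ifs with h
      · exact hm b h
      · exact aestronglyMeasurable_const
    · filter_upwards [hf', Ioi_mem_nhds hb] with b h1 h2
      rw [hI]
      refine (ae_restrict_iff' measurableSet_Ioc).2 (Eventually.of_forall fun s hs => ?_)
      by_cases h0 : 0 < s
      · simp only [F, if_pos (mem_Ioi.1 h2)]
        rw [indicator_of_mem (mem_Ioi.2 h0), indicator_of_mem (show s ∈ Ioc 0 (a₀ + 1) from ⟨h0, hs.2⟩)]
        exact h1 s ⟨h0, hs.2⟩
      · simp only [F]
        rw [indicator_of_notMem (by simpa using h0),
          indicator_of_notMem (fun h => h0 h.1), norm_zero]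
    · rw [intervalIntegrable_iff_integrableOn_Ioc_of_le (by linarith)]
      exact ((integrable_indicator_iff measurableSet_Ioc).2 hf).integrableOn
    · refine Eventually.of_forall fun s => ?_
      by_cases h0 : 0 < s
      · refine ((hc s h0).continuousAt (Ioi_mem_nhds hb)).congr ?_
        filter_upwards [Ioi_mem_nhds hb] with b h2
        simp only [F, if_pos (mem_Ioi.1 h2)]
        rw [indicator_of_mem (mem_Ioi.2 h0)]
      · have : (fun b => F b s) = fun _ => 0 := by
          funext b
          exact indicator_of_notMem (by simpa using h0) _
        rw [this]
        exact continuousAt_const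
  have key2 : ContinuousAt (fun p : ℝ × ℝ => ∫ s in (0 : ℝ)..p.1, F p.2 s) (a₀, b₀) :=
    ContinuousAt.comp (f := Prod.swap) (x := (a₀, b₀)) key continuous_swap.continuousAt
  refine (key2.congr ?_).continuousWithinAt
  filter_upwards [prod_mem_nhds (Ioi_mem_nhds ha) (Ioi_mem_nhds hb)] with p hp
  refine intervalIntegral.integral_congr_ae (Eventually.of_forall fun s hs => ?_)
  rw [uIoc_of_le (le_of_lt hp.1)] at hs
  simp only [F, if_pos (mem_Ioi.1 hp.2)]
  rw [indicator_of_mem (mem_Ioi.2 hs.1)]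

theorem continuousOn_section_snd
    (hc : ContinuousOn (fun p : ℝ × ℝ => Φ p.1 p.2) (Ioi 0 ×ˢ Ioi 0)) {b : ℝ} (hb : 0 < b) :
    ContinuousOn (Φ b) (Ioi 0) :=
  hc.comp (f := fun s => (b, s)) (by fun_prop) fun _ hs => ⟨hb, hs⟩

theorem continuousOn_section_fst
    (hc : ContinuousOn (fun p : ℝ × ℝ => Φ p.1 p.2) (Ioi 0 ×ˢ Ioi 0)) {s : ℝ} (hs : 0 < s) :
    ContinuousOn (fun b => Φ b s) (Ioi 0) :=
  hc.comp (f := fun b => (b, s)) (by fun_prop) fun _ hb => ⟨hb, hs⟩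

theorem LocallyDominated.continuousOn_primitive_of_continuousOn (hΦ : LocallyDominated Φ)
    (hc : ContinuousOn (fun p : ℝ × ℝ => Φ p.1 p.2) (Ioi 0 ×ˢ Ioi 0)) :
    ContinuousOn (fun p : ℝ × ℝ => ∫ s in (0 : ℝ)..p.1, Φ p.2 s) (Ioi 0 ×ˢ Ioi 0) :=
  hΦ.continuousOn_primitive
    (fun _ hb => (continuousOn_section_snd hc hb).aestronglyMeasurable measurableSet_Ioi)
    (fun _ hs => continuousOn_section_fst hc hs)

theorem LocallyDominated.hasDerivAt_primitive_fst (hΦ : LocallyDominated Φ)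
    (hc : ContinuousOn (fun p : ℝ × ℝ => Φ p.1 p.2) (Ioi 0 ×ˢ Ioi 0)) {a b : ℝ} (ha : 0 < a)
    (hb : 0 < b) : HasDerivAt (fun a => ∫ s in (0 : ℝ)..a, Φ b s) (Φ b a) a := by
  have h := continuousOn_section_snd hc hb
  exact intervalIntegral.integral_hasDerivAt_right
    (hΦ.intervalIntegrable hb (h.aestronglyMeasurable measurableSet_Ioi) ha)
    (h.stronglyMeasurableAtFilter isOpen_Ioi a ha) (h.continuousAt (Ioi_mem_nhds ha))

theorem LocallyDominated.hasDerivAt_primitive_snd (hΦ : LocallyDominated Φ)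
    (hc : ContinuousOn (fun p : ℝ × ℝ => Φ p.1 p.2) (Ioi 0 ×ˢ Ioi 0))
    (hΨ : LocallyDominated Ψ)
    (hd : ∀ b > 0, ∀ s > 0, HasDerivAt (fun b => Φ b s) (Ψ b s) b)
    (hc' : ContinuousOn (fun p : ℝ × ℝ => Ψ p.1 p.2) (Ioi 0 ×ˢ Ioi 0)) {a b : ℝ} (ha : 0 < a)
    (hb : 0 < b) :
    HasDerivAt (fun b => ∫ s in (0 : ℝ)..a, Φ b s) (∫ s in (0 : ℝ)..a, Ψ b s) b := by
  have hm : ∀ b > 0, AEStronglyMeasurable (Φ b) (volume.restrict (Ioi 0)) := fun _ hb =>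
    (continuousOn_section_snd hc hb).aestronglyMeasurable measurableSet_Ioi
  have hm' : ∀ b > 0, AEStronglyMeasurable (Ψ b) (volume.restrict (Ioi 0)) := fun _ hb =>
    (continuousOn_section_snd hc' hb).aestronglyMeasurable measurableSet_Ioi
  have hI : Ι 0 a = Ioc 0 a := uIoc_of_le ha.le
  have hsub : volume.restrict (Ι 0 a) ≤ volume.restrict (Ioi (0 : ℝ)) := by
    rw [hI]
    exact Measure.restrict_mono Ioc_subset_Ioi_self le_rfl
  obtain ⟨f, hf, hf'⟩ := hΨ b hb a ha
  refine (intervalIntegral.hasDerivAt_integral_of_dominated_loc_of_deriv_le (bound := f)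
    (hf'.and (Ioi_mem_nhds hb)) ?_ (hΦ.intervalIntegrable hb (hm b hb) ha)
    ((hm' b hb).mono_measure hsub) ?_
    ((intervalIntegrable_iff_integrableOn_Ioc_of_le ha.le).2 hf) ?_).2
  · filter_upwards [Ioi_mem_nhds hb] with b hb
    exact (hm b hb).mono_measure hsub
  · refine Eventually.of_forall fun s hs x hx => ?_
    rw [hI] at hs
    exact hx.1 s hs
  · refine Eventually.of_forall fun s hs x hx => ?_
    rw [hI] at hs
    exact hd x hx.2 s hs.1

theorem LocallyDominated.primitive_swap (hΦ : LocallyDominated Φ) :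
    LocallyDominated fun b s => ∫ r in (0 : ℝ)..s, Φ b r := by
  intro b₀ hb a ha
  obtain ⟨f, hf, hf'⟩ := hΦ b₀ hb a ha
  have hn : IntegrableOn (fun r => ‖f r‖) (Ioc 0 a) := hf.norm
  refine ⟨fun _ => ∫ r in Ioc 0 a, ‖f r‖, integrableOn_const (by simp), ?_⟩
  filter_upwards [hf'] with b h s hs
  rw [intervalIntegral.integral_of_le hs.1.le]
  calc ‖∫ r in Ioc 0 s, Φ b r‖ ≤ ∫ r in Ioc 0 s, ‖f r‖ := by
        refine norm_integral_le_of_norm_le (hn.mono_set (Ioc_subset_Ioc_right hs.2)) ?_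
        exact (ae_restrict_iff' measurableSet_Ioc).2 (Eventually.of_forall fun r hr =>
          (h r ⟨hr.1, hr.2.trans hs.2⟩).trans (le_abs_self _))
    _ ≤ ∫ r in Ioc 0 a, ‖f r‖ :=
        setIntegral_mono_set hn (Eventually.of_forall fun _ => norm_nonneg _)
          (Ioc_subset_Ioc_right hs.2).eventuallyLE

theorem locallyDominated_of_continuousOn_fst {ρ : ℝ → ℝ} (hρ : ContinuousOn ρ (Ioi 0)) :
    LocallyDominated fun b _ => ρ b := by
  intro b₀ hb a _
  refine ⟨fun _ => ‖ρ b₀‖ + 1, integrableOn_const (by simp), ?_⟩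
  have h := ((hρ.continuousAt (Ioi_mem_nhds hb)).norm).eventually
    (gt_mem_nhds (lt_add_one ‖ρ b₀‖))
  filter_upwards [h] with b h s _
  exact h.le

end LocallyDominated

/-! ### Differentiability from continuous partial derivatives -/

section Partial

/-- A function on the open quadrant with continuous partial derivatives. -/
theorem hasFDerivAt_of_partial {F F₁ F₂ : ℝ → ℝ → ℝ}
    (h₁ : ∀ a > 0, ∀ b > 0, HasDerivAt (fun a => F a b) (F₁ a b) a)
    (h₂ : ∀ a > 0, ∀ b > 0, HasDerivAt (fun b => F a b) (F₂ a b) b)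
    (c₁ : ContinuousOn (fun p : ℝ × ℝ => F₁ p.1 p.2) (Ioi 0 ×ˢ Ioi 0))
    (c₂ : ContinuousOn (fun p : ℝ × ℝ => F₂ p.1 p.2) (Ioi 0 ×ˢ Ioi 0))
    {p : ℝ × ℝ} (hp : p ∈ Ioi (0 : ℝ) ×ˢ Ioi (0 : ℝ)) :
    HasFDerivAt (fun p : ℝ × ℝ => F p.1 p.2)
      (F₁ p.1 p.2 • ContinuousLinearMap.fst ℝ ℝ ℝ + F₂ p.1 p.2 • ContinuousLinearMap.snd ℝ ℝ ℝ)
      p := by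
  have hn : Ioi (0 : ℝ) ×ˢ Ioi (0 : ℝ) ∈ 𝓝 p := (isOpen_Ioi.prod isOpen_Ioi).mem_nhds hp
  have := hasStrictFDerivAt_uncurry_coprod (𝕜 := ℝ) (u := p) (f := F)
    (f₁ := fun a b => F₁ a b • ContinuousLinearMap.id ℝ ℝ)
    (f₂ := fun a b => F₂ a b • ContinuousLinearMap.id ℝ ℝ) ?_ ?_ ?_ ?_
  · refine this.hasFDerivAt.congr_fderiv ?_
    ext <;> simp [Function.HasUncurry.uncurry]
  · filter_upwards [hn] with v hv
    refine (h₁ v.1 hv.1 v.2 hv.2).hasFDerivAt.congr_fderiv ?_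
    ext; simp [Function.HasUncurry.uncurry]
  · filter_upwards [hn] with v hv
    refine (h₂ v.1 hv.1 v.2 hv.2).hasFDerivAt.congr_fderiv ?_
    ext; simp [Function.HasUncurry.uncurry]
  · exact (c₁.continuousAt hn).smul continuousAt_const
  · exact (c₂.continuousAt hn).smul continuousAt_const

theorem contDiffOn_succ_of_partial {F F₁ F₂ : ℝ → ℝ → ℝ} {n : ℕ}
    (h₁ : ∀ a > 0, ∀ b > 0, HasDerivAt (fun a => F a b) (F₁ a b) a)
    (h₂ : ∀ a > 0, ∀ b > 0, HasDerivAt (fun b => F a b) (F₂ a b) b)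
    (c₁ : ContDiffOn ℝ n (fun p : ℝ × ℝ => F₁ p.1 p.2) (Ioi 0 ×ˢ Ioi 0))
    (c₂ : ContDiffOn ℝ n (fun p : ℝ × ℝ => F₂ p.1 p.2) (Ioi 0 ×ˢ Ioi 0)) :
    ContDiffOn ℝ (n + 1) (fun p : ℝ × ℝ => F p.1 p.2) (Ioi 0 ×ˢ Ioi 0) := by
  have hd := fun p hp =>
    hasFDerivAt_of_partial (p := p) h₁ h₂ c₁.continuousOn c₂.continuousOn hp
  rw [contDiffOn_succ_iff_fderiv_of_isOpen (isOpen_Ioi.prod isOpen_Ioi)]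
  refine ⟨fun p hp => (hd p hp).differentiableAt.differentiableWithinAt, by simp, ?_⟩
  exact ((c₁.smul contDiffOn_const).add (c₂.smul contDiffOn_const)).congr
    fun p hp => (hd p hp).fderiv

end Partial

/-! ### Regularity of the alternating density -/

/-- The real-valued version of `altDensity` for the rate function `lam`. -/
noncomputable def altDensityReal (lam : ℝ → ℝ) (a b : ℝ) : ℝ :=
  (altDensity (rateENN lam) a b).toReal

/-- The partial derivative of `altDensityReal` in the second variable. -/
noncomputable def altDensityDeriv (lam : ℝ → ℝ) (a b : ℝ) : ℝ :=
  deriv lam b + ∫ s in (0 : ℝ)..a,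
    (deriv lam (s + b) * altDensityReal lam b s + lam (s + b) ^ 2 * altDensityReal lam s b)

section Regularity

variable {lam : ℝ → ℝ}

theorem altDensityReal_nonneg (a b : ℝ) : 0 ≤ altDensityReal lam a b := ENNReal.toReal_nonneg

theorem IsRate.measurable_altDensityReal (h : IsRate lam) :
    Measurable fun p : ℝ × ℝ => altDensityReal lam p.1 p.2 :=
  (measurable_altDensity h.measurable_rateENN).ennreal_toReal

theorem IsRate.ofReal_altDensityReal (h : IsRate lam) {a b : ℝ} (ha : 0 ≤ a) (hb : 0 < b) :
    ENNReal.ofReal (altDensityReal lam a b) = altDensity (rateENN lam) a b :=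
  ENNReal.ofReal_toReal (h.altDensity_lt_top ha hb).ne

theorem IsRate.altDensityReal_eq (h : IsRate lam) {a b : ℝ} (ha : 0 ≤ a) (hb : 0 < b) :
    altDensityReal lam a b = lam b + ∫ s in (0 : ℝ)..a, lam (s + b) * altDensityReal lam b s := by
  have hfin := h.altDensity_lt_top ha hb
  have e := altDensity_eq h.measurable_rateENN a b
  rw [altDensityReal, e, ENNReal.toReal_add, rateENN_of_pos hb, ENNReal.toReal_ofReal (h.nonneg b hb),
    intervalIntegral.integral_of_le ha, integral_Ioc_eq_integral_Ioo,
    integral_eq_lintegral_of_nonneg_ae]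
  · congr 2
    refine setLIntegral_congr_fun measurableSet_Ioo fun s hs => ?_
    rw [ENNReal.ofReal_mul (h.nonneg _ (add_pos hs.1 hb)), rateENN_of_pos (add_pos hs.1 hb),
      h.ofReal_altDensityReal hb.le hs.1]
  · refine (ae_restrict_iff' measurableSet_Ioo).2 (Eventually.of_forall fun s hs => ?_)
    exact mul_nonneg (h.nonneg _ (add_pos hs.1 hb)) (altDensityReal_nonneg _ _)
  · refine AEStronglyMeasurable.mul ?_ ?_
    · refine ContinuousOn.aestronglyMeasurable ?_ measurableSet_Ioo
      exact h.continuousOn.comp (by fun_prop) fun s hs => add_pos hs.1 hb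
    · exact (h.measurable_altDensityReal.comp
        (measurable_const.prodMk measurable_id)).aestronglyMeasurable
  · exact rateENN_ne_top _
  · rw [e] at hfin
    exact (ENNReal.add_lt_top.1 hfin).2.ne

theorem IsRate.altDensityReal_mono (h : IsRate lam) {a a' b : ℝ} (ha : 0 ≤ a) (haa' : a ≤ a')
    (hb : 0 < b) : altDensityReal lam a b ≤ altDensityReal lam a' b :=
  ENNReal.toReal_mono (h.altDensity_lt_top (ha.trans haa') hb).ne (altDensity_mono haa' b)

theorem IsRate.locallyDominated_altDensityReal (h : IsRate lam) :
    LocallyDominated (altDensityReal lam) := by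
  intro b₀ hb a ha
  -- The density increases in its first argument, so its value at `2 b₀` dominates those at all `b <
  -- 2 b₀`.
  refine ⟨fun s => altDensityReal lam (2 * b₀) s, ?_, ?_⟩
  · rw [integrableOn_Ioc_iff_integrableOn_Ioo]
    refine integrable_toReal_of_lintegral_ne_top ?_ ?_
    · exact ((measurable_altDensity h.measurable_rateENN).comp
        (measurable_const.prodMk measurable_id)).aemeasurable
    · exact (h.lintegral_altDensity_lt_top (by positivity) ha.le).ne
  · filter_upwards [Ioo_mem_nhds hb (by linarith : b₀ < 2 * b₀)] with b hb s hs
    rw [Real.norm_of_nonneg (altDensityReal_nonneg _ _)]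
    exact h.altDensityReal_mono hb.1.le hb.2.le hs.1

theorem continuousOn_comp_add {ρ : ℝ → ℝ} (hρ : ContinuousOn ρ (Ioi 0)) :
    ContinuousOn (fun p : ℝ × ℝ => ρ (p.1 + p.2)) (Ioi 0 ×ˢ Ioi 0) :=
  hρ.comp (by fun_prop) fun _ hp => add_pos (mem_Ioi.1 hp.1) (mem_Ioi.1 hp.2)

theorem continuousOn_comp_add' {ρ : ℝ → ℝ} (hρ : ContinuousOn ρ (Ioi 0)) :
    ContinuousOn (fun p : ℝ × ℝ => ρ (p.2 + p.1)) (Ioi 0 ×ˢ Ioi 0) :=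
  hρ.comp (by fun_prop) fun _ hp => add_pos (mem_Ioi.1 hp.2) (mem_Ioi.1 hp.1)

theorem IsRate.locallyDominated_mul (h : IsRate lam) :
    LocallyDominated fun b s => lam (s + b) * altDensityReal lam b s :=
  h.locallyDominated_altDensityReal.mul_left h.continuousOn

theorem IsRate.aestronglyMeasurable_mul (h : IsRate lam) {b : ℝ} (hb : 0 < b) :
    AEStronglyMeasurable (fun s => lam (s + b) * altDensityReal lam b s)
      (volume.restrict (Ioi 0)) := by
  refine AEStronglyMeasurable.mul ?_ ?_
  · refine ContinuousOn.aestronglyMeasurable ?_ measurableSet_Ioi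
    exact h.continuousOn.comp (by fun_prop) fun s hs => add_pos (mem_Ioi.1 hs) hb
  · exact (h.measurable_altDensityReal.comp
      (measurable_const.prodMk measurable_id)).aestronglyMeasurable

/-- In the first variable the density is a primitive of an integrable function plus a constant; no
prior continuity is needed. -/
theorem IsRate.continuousOn_altDensityReal_fst (h : IsRate lam) {s : ℝ} (hs : 0 < s) :
    ContinuousOn (fun b => altDensityReal lam b s) (Ioi 0) := by
  have e : EqOn (fun b => altDensityReal lam b s)
      (fun b => lam s + ∫ r in (0 : ℝ)..b, lam (r + s) * altDensityReal lam s r) (Ioi 0) :=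
    fun b hb => h.altDensityReal_eq (le_of_lt hb) hs
  refine ContinuousOn.congr ?_ e
  intro b hb
  have hb' : (0 : ℝ) < b + 1 := by linarith [mem_Ioi.1 hb]
  have hi := h.locallyDominated_mul.intervalIntegrable hs (h.aestronglyMeasurable_mul hs) hb'
  have hc := intervalIntegral.continuousOn_primitive_interval' hi left_mem_uIcc
  rw [uIcc_of_le hb'.le] at hc
  exact (continuousAt_const.add (hc.continuousAt (Icc_mem_nhds (mem_Ioi.1 hb)
    (lt_add_one b)))).continuousWithinAt

/-- A bootstrap: inside the integral equation the parameter `b` is the first argument of the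
density, where continuity is already known. -/
theorem IsRate.continuousOn_altDensityReal (h : IsRate lam) :
    ContinuousOn (fun p : ℝ × ℝ => altDensityReal lam p.1 p.2) (Ioi 0 ×ˢ Ioi 0) := by
  have hp := h.locallyDominated_mul.continuousOn_primitive
    (fun b hb => h.aestronglyMeasurable_mul hb) fun s hs =>
      (h.continuousOn.comp (by fun_prop : ContinuousOn (fun b : ℝ => s + b) (Ioi 0))
        fun b hb => add_pos hs (mem_Ioi.1 hb)).mul (h.continuousOn_altDensityReal_fst hs)
  refine ContinuousOn.congr (f := fun p : ℝ × ℝ =>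
    lam p.2 + ∫ s in (0 : ℝ)..p.1, lam (s + p.2) * altDensityReal lam p.2 s) ?_
    fun p hp => h.altDensityReal_eq (le_of_lt hp.1) hp.2
  exact (h.continuousOn.comp continuousOn_snd fun p hp => hp.2).add hp

theorem continuousOn_quadrant_swap {F : ℝ → ℝ → ℝ}
    (hF : ContinuousOn (fun p : ℝ × ℝ => F p.1 p.2) (Ioi 0 ×ˢ Ioi 0)) :
    ContinuousOn (fun p : ℝ × ℝ => F p.2 p.1) (Ioi 0 ×ˢ Ioi 0) :=
  hF.comp (f := Prod.swap) continuous_swap.continuousOn fun _ hp => ⟨hp.2, hp.1⟩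

theorem IsRate.continuousOn_mul (h : IsRate lam) :
    ContinuousOn (fun p : ℝ × ℝ => lam (p.2 + p.1) * altDensityReal lam p.1 p.2)
      (Ioi 0 ×ˢ Ioi 0) :=
  (continuousOn_comp_add' h.continuousOn).mul h.continuousOn_altDensityReal

/-- The derivative in the first variable is the density again, with its arguments exchanged. This is
the exchange of right- and left-movers at a jump. -/
theorem IsRate.hasDerivAt_altDensityReal_fst (h : IsRate lam) {a b : ℝ} (ha : 0 < a)
    (hb : 0 < b) :
    HasDerivAt (fun a => altDensityReal lam a b) (lam (a + b) * altDensityReal lam b a) a := by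
  refine ((h.locallyDominated_mul.hasDerivAt_primitive_fst h.continuousOn_mul ha hb).const_add
    (lam b)).congr_of_eventuallyEq ?_
  filter_upwards [Ioi_mem_nhds ha] with x hx
  exact h.altDensityReal_eq (le_of_lt hx) hb

theorem IsRate.hasDerivAt (h : IsRate lam) {t : ℝ} (ht : 0 < t) :
    HasDerivAt lam (deriv lam t) t :=
  ((h.contDiffOn.differentiableOn one_ne_zero).differentiableAt (Ioi_mem_nhds ht)).hasDerivAt

theorem IsRate.continuousOn_deriv (h : IsRate lam) : ContinuousOn (deriv lam) (Ioi 0) :=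
  h.contDiffOn.continuousOn_deriv_of_isOpen isOpen_Ioi le_rfl

/-- Here the integration variable is the first argument; by the integral equation the function is
`λ(b)` plus a primitive of a dominated function. -/
theorem IsRate.locallyDominated_altDensityReal_swap (h : IsRate lam) :
    LocallyDominated fun b s => altDensityReal lam s b :=
  ((locallyDominated_of_continuousOn_fst h.continuousOn).add
    h.locallyDominated_mul.primitive_swap).congr fun _ hb _ hs =>
      (h.altDensityReal_eq (le_of_lt hs) hb).symm

theorem IsRate.locallyDominated_deriv (h : IsRate lam) : LocallyDominated fun b s =>
    deriv lam (s + b) * altDensityReal lam b s + lam (s + b) ^ 2 * altDensityReal lam s b :=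
  (h.locallyDominated_altDensityReal.mul_left h.continuousOn_deriv).add
    (h.locallyDominated_altDensityReal_swap.mul_left (h.continuousOn.pow 2))

theorem IsRate.continuousOn_deriv_mul (h : IsRate lam) :
    ContinuousOn (fun p : ℝ × ℝ => deriv lam (p.2 + p.1) * altDensityReal lam p.1 p.2
      + lam (p.2 + p.1) ^ 2 * altDensityReal lam p.2 p.1) (Ioi 0 ×ˢ Ioi 0) :=
  ((continuousOn_comp_add' h.continuousOn_deriv).mul h.continuousOn_altDensityReal).add
    (((continuousOn_comp_add' h.continuousOn).pow 2).mul
      (continuousOn_quadrant_swap h.continuousOn_altDensityReal))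

/-- Differentiation of the integral equation in `b` meets the density only through its first
argument, whose derivative is already explicit. So the argument is not circular, and one derivative
of `λ` suffices. -/
theorem IsRate.hasDerivAt_altDensityReal_snd (h : IsRate lam) {a b : ℝ} (ha : 0 < a)
    (hb : 0 < b) :
    HasDerivAt (fun b => altDensityReal lam a b) (altDensityDeriv lam a b) b := by
  have hd : ∀ b > 0, ∀ s > 0, HasDerivAt (fun b => lam (s + b) * altDensityReal lam b s)
      (deriv lam (s + b) * altDensityReal lam b s + lam (s + b) ^ 2 * altDensityReal lam s b)
      b := by
    intro b hb s hs
    refine (((h.hasDerivAt (add_pos hs hb)).comp_const_add s b).mul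
      (h.hasDerivAt_altDensityReal_fst hb hs)).congr_deriv ?_
    rw [add_comm b s]
    ring
  refine ((h.hasDerivAt hb).add (h.locallyDominated_mul.hasDerivAt_primitive_snd
    h.continuousOn_mul h.locallyDominated_deriv hd h.continuousOn_deriv_mul ha
    hb)).congr_of_eventuallyEq ?_
  filter_upwards [Ioi_mem_nhds hb] with x hx
  exact h.altDensityReal_eq ha.le hx

theorem IsRate.continuousOn_altDensityDeriv (h : IsRate lam) :
    ContinuousOn (fun p : ℝ × ℝ => altDensityDeriv lam p.1 p.2) (Ioi 0 ×ˢ Ioi 0) :=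
  (h.continuousOn_deriv.comp continuousOn_snd fun _ hp => hp.2).add
    (h.locallyDominated_deriv.continuousOn_primitive_of_continuousOn h.continuousOn_deriv_mul)

theorem IsRate.contDiffOn_altDensityReal (h : IsRate lam) :
    ContDiffOn ℝ 1 (fun p : ℝ × ℝ => altDensityReal lam p.1 p.2) (Ioi 0 ×ˢ Ioi 0) := by
  refine contDiffOn_succ_of_partial (n := 0)
    (F₁ := fun a b => lam (a + b) * altDensityReal lam b a) (F₂ := altDensityDeriv lam)
    (fun a ha b hb => h.hasDerivAt_altDensityReal_fst ha hb)
    (fun a ha b hb => h.hasDerivAt_altDensityReal_snd ha hb)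
    (contDiffOn_zero.2 ?_) (contDiffOn_zero.2 h.continuousOn_altDensityDeriv)
  exact (continuousOn_comp_add h.continuousOn).mul
    (continuousOn_quadrant_swap h.continuousOn_altDensityReal)

theorem IsRate.contDiffOn_deriv (h2 : ContDiffOn ℝ 2 lam (Ioi 0)) :
    ContDiffOn ℝ 1 (deriv lam) (Ioi 0) :=
  ((contDiffOn_succ_iff_deriv_of_isOpen (n := 1) isOpen_Ioi).1 h2).2.2

theorem IsRate.contDiffOn_altDensityDeriv (h : IsRate lam) (h2 : ContDiffOn ℝ 2 lam (Ioi 0)) :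
    ContDiffOn ℝ 1 (fun p : ℝ × ℝ => altDensityDeriv lam p.1 p.2) (Ioi 0 ×ˢ Ioi 0) := by
  have h1 := IsRate.contDiffOn_deriv h2
  have hd2 : ∀ t > 0, HasDerivAt (deriv lam) (deriv (deriv lam) t) t := fun t ht =>
    ((h1.differentiableOn one_ne_zero).differentiableAt (Ioi_mem_nhds ht)).hasDerivAt
  have c2 : ContinuousOn (deriv (deriv lam)) (Ioi 0) :=
    h1.continuousOn_deriv_of_isOpen isOpen_Ioi le_rfl
  -- The `b`-derivative of the integrand in `altDensityDeriv`. In the coefficient `3 λ' λ`, one unit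
  -- comes from the first argument of the density and two come from differentiating `λ²`.
  let Ψ : ℝ → ℝ → ℝ := fun b s => deriv (deriv lam) (s + b) * altDensityReal lam b s
    + 3 * deriv lam (s + b) * lam (s + b) * altDensityReal lam s b
    + lam (s + b) ^ 2 * altDensityDeriv lam s b
  have cm : ContinuousOn (fun t => 3 * deriv lam t * lam t) (Ioi 0) :=
    (continuousOn_const.mul h.continuousOn_deriv).mul h.continuousOn
  have hE : LocallyDominated fun b s => altDensityDeriv lam s b :=
    (locallyDominated_of_continuousOn_fst h.continuousOn_deriv).add
      h.locallyDominated_deriv.primitive_swap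
  have hΨ : LocallyDominated Ψ :=
    ((h.locallyDominated_altDensityReal.mul_left c2).add
      (h.locallyDominated_altDensityReal_swap.mul_left cm)).add
        (hE.mul_left (h.continuousOn.pow 2))
  have cΨ : ContinuousOn (fun p : ℝ × ℝ => Ψ p.1 p.2) (Ioi 0 ×ˢ Ioi 0) :=
    (((continuousOn_comp_add' c2).mul h.continuousOn_altDensityReal).add
      ((continuousOn_comp_add' cm).mul
        (continuousOn_quadrant_swap h.continuousOn_altDensityReal))).add
      (((continuousOn_comp_add' h.continuousOn).pow 2).mul
        (continuousOn_quadrant_swap h.continuousOn_altDensityDeriv))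
  have hd : ∀ b > 0, ∀ s > 0, HasDerivAt (fun b => deriv lam (s + b) * altDensityReal lam b s
      + lam (s + b) ^ 2 * altDensityReal lam s b) (Ψ b s) b := by
    intro b hb s hs
    refine ((((hd2 _ (add_pos hs hb)).comp_const_add s b).mul
      (h.hasDerivAt_altDensityReal_fst hb hs)).add
      ((((h.hasDerivAt (add_pos hs hb)).comp_const_add s b).pow 2).mul
      (h.hasDerivAt_altDensityReal_snd hs hb))).congr_deriv ?_
    simp only [Ψ, add_comm b s, Pi.pow_apply]
    ring
  refine contDiffOn_succ_of_partial (n := 0)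
    (F₁ := fun a b => deriv lam (a + b) * altDensityReal lam b a
      + lam (a + b) ^ 2 * altDensityReal lam a b)
    (F₂ := fun a b => deriv (deriv lam) b + ∫ s in (0 : ℝ)..a, Ψ b s)
    (fun a ha b hb => ?_) (fun a ha b hb => ?_) (contDiffOn_zero.2 ?_) (contDiffOn_zero.2 ?_)
  · exact (h.locallyDominated_deriv.hasDerivAt_primitive_fst h.continuousOn_deriv_mul ha
      hb).const_add _
  · exact (hd2 b hb).add (h.locallyDominated_deriv.hasDerivAt_primitive_snd
      h.continuousOn_deriv_mul hΨ hd cΨ ha hb)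
  · exact continuousOn_quadrant_swap (F := fun b a => deriv lam (a + b) * altDensityReal lam b a
      + lam (a + b) ^ 2 * altDensityReal lam a b) h.continuousOn_deriv_mul
  · exact (c2.comp continuousOn_snd fun _ hp => hp.2).add
      (hΨ.continuousOn_primitive_of_continuousOn cΨ)

theorem IsRate.contDiffOn_two_altDensityReal (h : IsRate lam)
    (h2 : ContDiffOn ℝ 2 lam (Ioi 0)) :
    ContDiffOn ℝ 2 (fun p : ℝ × ℝ => altDensityReal lam p.1 p.2) (Ioi 0 ×ˢ Ioi 0) := by
  refine contDiffOn_succ_of_partial (n := 1)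
    (F₁ := fun a b => lam (a + b) * altDensityReal lam b a) (F₂ := altDensityDeriv lam)
    (fun a ha b hb => h.hasDerivAt_altDensityReal_fst ha hb)
    (fun a ha b hb => h.hasDerivAt_altDensityReal_snd ha hb) ?_
    (h.contDiffOn_altDensityDeriv h2)
  refine ContDiffOn.mul ?_ ?_
  · exact h.contDiffOn.comp (contDiff_fst.add contDiff_snd).contDiffOn
      fun _ hp => add_pos (mem_Ioi.1 hp.1) (mem_Ioi.1 hp.2)
  · exact h.contDiffOn_altDensityReal.comp (f := Prod.swap)
      (contDiff_snd.prodMk contDiff_fst).contDiffOn fun _ hp => ⟨hp.2, hp.1⟩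

end Regularity

/-! ### Space and time derivatives, and integration by parts -/

/-- The partial derivative in time of a function of `(x, t)`. -/
noncomputable def timeDeriv (f : ℝ × ℝ → ℝ) (p : ℝ × ℝ) : ℝ := fderiv ℝ f p (0, 1)

/-- The partial derivative in space of a function of `(x, t)`. -/
noncomputable def spaceDeriv (f : ℝ × ℝ → ℝ) (p : ℝ × ℝ) : ℝ := fderiv ℝ f p (1, 0)

section Calculus

variable {f g : ℝ × ℝ → ℝ}

theorem DifferentiableAt.hasDerivAt_timeDeriv {x t : ℝ} (h : DifferentiableAt ℝ f (x, t)) :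
    HasDerivAt (fun s => f (x, s)) (timeDeriv f (x, t)) t :=
  h.hasFDerivAt.comp_hasDerivAt t ((hasDerivAt_const t x).prodMk (hasDerivAt_id t))

theorem DifferentiableAt.hasDerivAt_spaceDeriv {x t : ℝ} (h : DifferentiableAt ℝ f (x, t)) :
    HasDerivAt (fun y => f (y, t)) (spaceDeriv f (x, t)) x :=
  h.hasFDerivAt.comp_hasDerivAt x ((hasDerivAt_id x).prodMk (hasDerivAt_const x t))

theorem contDiffAt_fderiv_apply {n m : WithTop ℕ∞} {p : ℝ × ℝ} (hf : ContDiffAt ℝ n f p)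
    (hmn : m + 1 ≤ n) (v : ℝ × ℝ) : ContDiffAt ℝ m (fun q => fderiv ℝ f q v) p :=
  (hf.fderiv_right hmn).clm_apply contDiffAt_const

theorem timeDeriv_spaceDeriv {p : ℝ × ℝ} (hf : ContDiffAt ℝ 2 f p) :
    timeDeriv (spaceDeriv f) p = spaceDeriv (timeDeriv f) p := by
  have hd : DifferentiableAt ℝ (fderiv ℝ f) p :=
    (hf.fderiv_right (m := 1) le_rfl).differentiableAt one_ne_zero
  have hs : IsSymmSndFDerivAt ℝ f p := hf.isSymmSndFDerivAt (by simp)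
  have e : ∀ v w : ℝ × ℝ, fderiv ℝ (fun q => fderiv ℝ f q v) p w =
      fderiv ℝ (fderiv ℝ f) p w v := by
    intro v w
    rw [fderiv_clm_apply hd (differentiableAt_const v)]
    simp
  exact (e _ _).trans ((hs.eq _ _).trans (e _ _).symm)

theorem iteratedDeriv_two_time {x t : ℝ} (hf : ContDiffAt ℝ 2 f (x, t)) :
    iteratedDeriv 2 (fun s => f (x, s)) t = timeDeriv (timeDeriv f) (x, t) := by
  have hev : ∀ᶠ s in 𝓝 t, ContDiffAt ℝ 2 f (x, s) :=
    (Continuous.prodMk_right x).continuousAt.eventually (hf.eventually (by simp))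
  rw [iteratedDeriv_succ, iteratedDeriv_one]
  have e : deriv (fun s => f (x, s)) =ᶠ[𝓝 t] fun s => timeDeriv f (x, s) := by
    filter_upwards [hev] with s hs
    exact (hs.differentiableAt two_ne_zero).hasDerivAt_timeDeriv.deriv
  rw [e.deriv_eq]
  exact DifferentiableAt.hasDerivAt_timeDeriv
    ((contDiffAt_fderiv_apply hf (m := 1) le_rfl (0, 1)).differentiableAt one_ne_zero) |>.deriv

theorem iteratedDeriv_two_space {x t : ℝ} (hf : ContDiffAt ℝ 2 f (x, t)) :
    iteratedDeriv 2 (fun y => f (y, t)) x = spaceDeriv (spaceDeriv f) (x, t) := by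
  have hev : ∀ᶠ y in 𝓝 x, ContDiffAt ℝ 2 f (y, t) :=
    (Continuous.prodMk_left t).continuousAt.eventually (hf.eventually (by simp))
  rw [iteratedDeriv_succ, iteratedDeriv_one]
  have e : deriv (fun y => f (y, t)) =ᶠ[𝓝 x] fun y => spaceDeriv f (y, t) := by
    filter_upwards [hev] with y hy
    exact (hy.differentiableAt two_ne_zero).hasDerivAt_spaceDeriv.deriv
  rw [e.deriv_eq]
  exact DifferentiableAt.hasDerivAt_spaceDeriv
    ((contDiffAt_fderiv_apply hf (m := 1) le_rfl (1, 0)).differentiableAt one_ne_zero) |>.deriv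

/-- A point outside `O` is off the closed support of `g`, so the product vanishes near it. Functions
that are regular only on the cone can thus be integrated by parts over the whole plane. -/
theorem ContDiffOn.contDiff_mul_of_tsupport_subset {n : WithTop ℕ∞} {O : Set (ℝ × ℝ)}
    (hO : IsOpen O) (hf : ContDiffOn ℝ n f O) (hg : ContDiff ℝ n g) (hs : tsupport g ⊆ O) :
    ContDiff ℝ n fun p => f p * g p := by
  rw [contDiff_iff_contDiffAt]
  intro p
  by_cases hp : p ∈ O
  · exact (hf.contDiffAt (hO.mem_nhds hp)).mul hg.contDiffAt
  · have e : (fun p => f p * g p) =ᶠ[𝓝 p] fun _ => 0 := by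
      filter_upwards [notMem_tsupport_iff_eventuallyEq.1 fun h => hp (hs h)] with q hq
      simp [hq]
    exact contDiffAt_const.congr_of_eventuallyEq e

theorem integral_fderiv_apply_eq_zero (hf : ContDiff ℝ 1 f) (hs : HasCompactSupport f)
    (v : ℝ × ℝ) : ∫ p, fderiv ℝ f p v = 0 := by
  have hc : Continuous fun p => fderiv ℝ f p v :=
    (hf.continuous_fderiv one_ne_zero).clm_apply continuous_const
  have := integral_smul_fderiv_eq_neg_fderiv_smul_of_integrable (μ := volume) (𝕜 := ℝ)
    (f := fun _ : ℝ × ℝ => (1 : ℝ)) (g := f) (v := v) (by simp)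
    (by simpa using hc.integrable_of_hasCompactSupport (hs.fderiv_apply ℝ v))
    (by simpa using hf.continuous.integrable_of_hasCompactSupport hs)
    (fun _ _ => differentiableAt_const _) (fun _ _ => hf.differentiable one_ne_zero _)
  simpa using this

end Calculus

/-! ### From the first-order system to the second-order equation -/

/-- The first-order system satisfied by `g = f_r + f_l` and `d = f_r - f_l`, with `f_r` and `f_l`
the densities of the particles moving to the right and to the left. -/
structure SolvesFirstOrderSystem (c : ℝ) (lam : ℝ → ℝ) (g d : ℝ × ℝ → ℝ) : Prop where
  contDiffOn_fst : ContDiffOn ℝ 1 g (lightCone c)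
  contDiffOn_snd : ContDiffOn ℝ 1 d (lightCone c)
  sum_eq : ∀ p ∈ lightCone c, timeDeriv g p + c * spaceDeriv d p = -(2 / 3 * lam p.2 * g p)
  diff_eq : ∀ p ∈ lightCone c, timeDeriv d p + c * spaceDeriv g p = -(4 / 3 * lam p.2 * d p)

theorem isOpen_lightCone (c : ℝ) : IsOpen (lightCone c) :=
  isOpen_lt (continuous_abs.comp continuous_fst) (continuous_const.mul continuous_snd)

theorem pos_of_mem_lightCone {c : ℝ} (hc : 0 < c) {p : ℝ × ℝ} (hp : p ∈ lightCone c) :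
    0 < p.2 := by
  have : 0 < c * p.2 := (abs_nonneg p.1).trans_lt hp
  exact pos_of_mul_pos_right this hc.le

section System

variable {c : ℝ} {lam : ℝ → ℝ} {g d : ℝ × ℝ → ℝ}

/-- Modulo the first-order system, `g` times the adjoint operator applied to `φ` is the divergence
of a compactly supported `C¹` field. No second derivative of `g`, `d` or `λ` is involved. -/
theorem SolvesFirstOrderSystem.weak (hc : 0 < c) (hlam : IsRate lam)
    (h : SolvesFirstOrderSystem c lam g d) : SolvesWeakly c lam fun x t => g (x, t) := by
  intro φ hφ hφs hφc
  have hO := isOpen_lightCone c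
  have h2 : ∀ p, ContDiffAt ℝ 2 φ p := fun p => (contDiff_infty.1 hφ 2).contDiffAt
  have hφ1 : ContDiff ℝ 1 φ := contDiff_infty.1 hφ 1
  have ht : ContDiff ℝ 1 (timeDeriv φ) :=
    contDiff_iff_contDiffAt.2 fun p => contDiffAt_fderiv_apply (h2 p) le_rfl _
  have hx : ContDiff ℝ 1 (spaceDeriv φ) :=
    contDiff_iff_contDiffAt.2 fun p => contDiffAt_fderiv_apply (h2 p) le_rfl _
  have hts : tsupport (timeDeriv φ) ⊆ tsupport φ := tsupport_fderiv_apply_subset ℝ (0, 1)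
  have hxs : tsupport (spaceDeriv φ) ⊆ tsupport φ := tsupport_fderiv_apply_subset ℝ (1, 0)
  have hl : ContDiffOn ℝ 1 (fun p : ℝ × ℝ => lam p.2) (lightCone c) :=
    hlam.contDiffOn.comp contDiff_snd.contDiffOn fun p hp => pos_of_mem_lightCone hc hp
  -- The field is found by integrating by parts twice: the terms with `d` bring in the first-order
  -- system, and those with `4/3` compensate for the damping of `d`.
  let U : ℝ × ℝ → ℝ := fun p => g p * timeDeriv φ p - c * (d p * spaceDeriv φ p)
    - 4 / 3 * (lam p.2 * g p * φ p)
  let V : ℝ × ℝ → ℝ := fun p => c * (d p * timeDeriv φ p) - c ^ 2 * (g p * spaceDeriv φ p)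
    - 4 / 3 * c * (lam p.2 * d p * φ p)
  have hU : ContDiff ℝ 1 U :=
    ((h.contDiffOn_fst.contDiff_mul_of_tsupport_subset hO ht (hts.trans hφc)).sub
      (contDiff_const.mul (h.contDiffOn_snd.contDiff_mul_of_tsupport_subset hO hx
        (hxs.trans hφc)))).sub (contDiff_const.mul
          ((hl.mul h.contDiffOn_fst).contDiff_mul_of_tsupport_subset hO hφ1 hφc))
  have hV : ContDiff ℝ 1 V :=
    ((contDiff_const.mul (h.contDiffOn_snd.contDiff_mul_of_tsupport_subset hO ht
      (hts.trans hφc))).sub (contDiff_const.mul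
        (h.contDiffOn_fst.contDiff_mul_of_tsupport_subset hO hx (hxs.trans hφc)))).sub
          (contDiff_const.mul
            ((hl.mul h.contDiffOn_snd).contDiff_mul_of_tsupport_subset hO hφ1 hφc))
  have z0 : ∀ p ∉ tsupport φ, φ p = 0 := fun p hp => image_eq_zero_of_notMem_tsupport hp
  have zt : ∀ p ∉ tsupport φ, timeDeriv φ p = 0 := fun p hp =>
    image_eq_zero_of_notMem_tsupport fun h => hp (hts h)
  have zx : ∀ p ∉ tsupport φ, spaceDeriv φ p = 0 := fun p hp =>
    image_eq_zero_of_notMem_tsupport fun h => hp (hxs h)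
  have zU : ∀ p ∉ tsupport φ, U p = 0 := fun p hp => by simp [U, z0 p hp, zt p hp, zx p hp]
  have zV : ∀ p ∉ tsupport φ, V p = 0 := fun p hp => by simp [V, z0 p hp, zt p hp, zx p hp]
  have sU : HasCompactSupport U := HasCompactSupport.intro hφs (fun p hp => zU p hp)
  have sV : HasCompactSupport V := HasCompactSupport.intro hφs (fun p hp => zV p hp)
  have key : ∀ p : ℝ × ℝ, g (p.1, p.2) *
      (iteratedDeriv 2 (fun s => φ (p.1, s)) p.2
        - deriv (fun s => 2 * lam s * φ (p.1, s)) p.2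
        + zeroOrderCoeff lam p.2 * φ p
        - c ^ 2 * iteratedDeriv 2 (fun y => φ (y, p.2)) p.1) =
      fderiv ℝ U p (0, 1) + fderiv ℝ V p (1, 0) := by
    intro p
    rw [iteratedDeriv_two_time (h2 _), iteratedDeriv_two_space (h2 _)]
    by_cases hp : p ∈ tsupport φ
    · have hpO := hφc hp
      have hp2 := pos_of_mem_lightCone hc hpO
      have dg : HasFDerivAt g (fderiv ℝ g p) p :=
        ((h.contDiffOn_fst.contDiffAt (hO.mem_nhds hpO)).differentiableAt one_ne_zero).hasFDerivAt
      have dd : HasFDerivAt d (fderiv ℝ d p) p :=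
        ((h.contDiffOn_snd.contDiffAt (hO.mem_nhds hpO)).differentiableAt one_ne_zero).hasFDerivAt
      have dφ := (hφ1.differentiable one_ne_zero p).hasFDerivAt
      have dt := (ht.differentiable one_ne_zero p).hasFDerivAt
      have dx := (hx.differentiable one_ne_zero p).hasFDerivAt
      have dl : HasFDerivAt (fun p : ℝ × ℝ => lam p.2)
          (deriv lam p.2 • ContinuousLinearMap.snd ℝ ℝ ℝ) p :=
        (hlam.hasDerivAt hp2).comp_hasFDerivAt p hasFDerivAt_snd
      have eU := (((dg.mul dt).sub ((dd.mul dx).const_mul c)).sub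
        (((dl.mul dg).mul dφ).const_mul (4 / 3))).fderiv
      have eV := ((((dd.mul dt).const_mul c).sub ((dg.mul dx).const_mul (c ^ 2))).sub
        (((dl.mul dd).mul dφ).const_mul (4 / 3 * c))).fderiv
      have eU' : fderiv ℝ U p = _ := eU
      have eV' : fderiv ℝ V p = _ := eV
      have e2 : deriv (fun s => 2 * lam s * φ (p.1, s)) p.2 =
          2 * deriv lam p.2 * φ p + 2 * lam p.2 * timeDeriv φ p :=
        (((hlam.hasDerivAt hp2).const_mul 2).mul
          (hφ1.differentiable one_ne_zero (p.1, p.2)).hasDerivAt_timeDeriv).deriv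
      have e3 : spaceDeriv (timeDeriv φ) p = timeDeriv (spaceDeriv φ) p :=
        (timeDeriv_spaceDeriv (h2 p)).symm
      have s1 := h.sum_eq p hpO
      have s2 := h.diff_eq p hpO
      rw [e2, eU', eV']
      simp only [timeDeriv, spaceDeriv, zeroOrderCoeff, add_apply,
        sub_apply, smul_apply, smul_eq_mul,
        ContinuousLinearMap.coe_snd', Prod.mk.eta, Pi.mul_apply] at s1 s2 e3 ⊢
      -- The second derivatives of `φ` multiplied by `d` cancel by the symmetry `e3`.
      linear_combination -(fderiv ℝ φ p (0, 1)) * s1 + c * fderiv ℝ φ p (1, 0) * s2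
        + 4 / 3 * lam p.2 * φ p * s1 - c * d p * e3
    · have hn : (tsupport φ)ᶜ ∈ 𝓝 p := (isClosed_tsupport φ).isOpen_compl.mem_nhds hp
      have eU : fderiv ℝ U p = 0 := by
        have : U =ᶠ[𝓝 p] fun _ => 0 := by filter_upwards [hn] with q hq using zU q hq
        rw [this.fderiv_eq]; simp
      have eV : fderiv ℝ V p = 0 := by
        have : V =ᶠ[𝓝 p] fun _ => 0 := by filter_upwards [hn] with q hq using zV q hq
        rw [this.fderiv_eq]; simp
      have et : timeDeriv (timeDeriv φ) p = 0 := by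
        have : timeDeriv φ =ᶠ[𝓝 p] fun _ => 0 := by filter_upwards [hn] with q hq using zt q hq
        rw [timeDeriv, this.fderiv_eq]; simp
      have ex : spaceDeriv (spaceDeriv φ) p = 0 := by
        have : spaceDeriv φ =ᶠ[𝓝 p] fun _ => 0 := by filter_upwards [hn] with q hq using zx q hq
        rw [spaceDeriv, this.fderiv_eq]; simp
      have e2 : deriv (fun s => 2 * lam s * φ (p.1, s)) p.2 = 0 := by
        have : (fun s => 2 * lam s * φ (p.1, s)) =ᶠ[𝓝 p.2] fun _ => 0 := by
          have hn' := (Continuous.prodMk_right p.1).continuousAt.preimage_mem_nhds (x := p.2) hn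
          filter_upwards [hn'] with s hs
          simp [z0 _ hs]
        rw [this.deriv_eq]; simp
      rw [e2, eU, eV, z0 p hp, et, ex]
      simp
  simp only [key]
  have iU : Integrable fun p => fderiv ℝ U p (0, 1) :=
    ((hU.continuous_fderiv one_ne_zero).clm_apply
      continuous_const).integrable_of_hasCompactSupport (sU.fderiv_apply ℝ _)
  have iV : Integrable fun p => fderiv ℝ V p (1, 0) :=
    ((hV.continuous_fderiv one_ne_zero).clm_apply
      continuous_const).integrable_of_hasCompactSupport (sV.fderiv_apply ℝ _)
  rw [integral_add iU iV, integral_fderiv_apply_eq_zero hU sU, integral_fderiv_apply_eq_zero hV sV,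
    add_zero]

/-- The time derivative of the first equation minus `c` times the space derivative of the second
removes the second derivatives of `d`; the remaining `d_x` is expressed through `g` by the first
equation. -/
theorem SolvesFirstOrderSystem.classical (hc : 0 < c) (hlam : IsRate lam)
    (h : SolvesFirstOrderSystem c lam g d) (hg : ContDiffOn ℝ 2 g (lightCone c))
    (hd : ContDiffOn ℝ 2 d (lightCone c)) :
    SolvesClassically c lam fun x t => g (x, t) := by
  refine ⟨hg, fun x t hxt => ?_⟩
  have hn : lightCone c ∈ 𝓝 (x, t) := (isOpen_lightCone c).mem_nhds hxt
  have ht : 0 < t := pos_of_mem_lightCone hc (p := (x, t)) hxt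
  have g2 := hg.contDiffAt hn
  have d2 := hd.contDiffAt hn
  have gd := g2.differentiableAt two_ne_zero
  have dd := d2.differentiableAt two_ne_zero
  have dgt : DifferentiableAt ℝ (timeDeriv g) (x, t) :=
    (contDiffAt_fderiv_apply g2 (m := 1) le_rfl (0, 1)).differentiableAt one_ne_zero
  have dgx : DifferentiableAt ℝ (spaceDeriv g) (x, t) :=
    (contDiffAt_fderiv_apply g2 (m := 1) le_rfl (1, 0)).differentiableAt one_ne_zero
  have ddt : DifferentiableAt ℝ (timeDeriv d) (x, t) :=
    (contDiffAt_fderiv_apply d2 (m := 1) le_rfl (0, 1)).differentiableAt one_ne_zero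
  have ddx : DifferentiableAt ℝ (spaceDeriv d) (x, t) :=
    (contDiffAt_fderiv_apply d2 (m := 1) le_rfl (1, 0)).differentiableAt one_ne_zero
  rw [iteratedDeriv_two_time g2, iteratedDeriv_two_space g2, gd.hasDerivAt_timeDeriv.deriv]
  have e1 : timeDeriv (timeDeriv g) (x, t) + c * timeDeriv (spaceDeriv d) (x, t) =
      -(2 / 3 * (deriv lam t * g (x, t) + lam t * timeDeriv g (x, t))) := by
    refine (dgt.hasDerivAt_timeDeriv.add (ddx.hasDerivAt_timeDeriv.const_mul c)).unique ?_
    refine HasDerivAt.congr_of_eventuallyEq (f := fun s => -(2 / 3 * (lam s * g (x, s))))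
      ((((hlam.hasDerivAt ht).mul gd.hasDerivAt_timeDeriv).const_mul (2 / 3)).neg) ?_
    filter_upwards [(Continuous.prodMk_right x).continuousAt.preimage_mem_nhds hn] with s hs
    have := h.sum_eq (x, s) hs
    simp only [Pi.add_apply] at *
    linarith
  have e2 : spaceDeriv (timeDeriv d) (x, t) + c * spaceDeriv (spaceDeriv g) (x, t) =
      -(4 / 3 * (lam t * spaceDeriv d (x, t))) := by
    refine (ddt.hasDerivAt_spaceDeriv.add (dgx.hasDerivAt_spaceDeriv.const_mul c)).unique ?_
    refine HasDerivAt.congr_of_eventuallyEq (f := fun y => -(4 / 3 * (lam t * d (y, t))))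
      (((dd.hasDerivAt_spaceDeriv.const_mul (lam t)).const_mul (4 / 3)).neg) ?_
    filter_upwards [(Continuous.prodMk_left t).continuousAt.preimage_mem_nhds hn] with y hy
    have := h.diff_eq (y, t) hy
    simp only [Pi.add_apply] at *
    linarith
  have e3 := timeDeriv_spaceDeriv d2
  have e4 := h.sum_eq (x, t) hxt
  simp only at e4
  rw [zeroOrderCoeff]
  linear_combination e1 - c * e2 - c * e3 + 4 / 3 * lam t * e4

end System

/-! ### The densities on the line `y = 0` -/

/-- The sum (`ε = 1`) or the difference (`ε = -1`) of the densities of the particles that move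
to the right and to the left along the line `y = 0`. -/
noncomputable def edgeComponent (c ε : ℝ) (lam : ℝ → ℝ) (p : ℝ × ℝ) : ℝ :=
  Real.exp (-cumRate lam p.2) / (8 * c) *
    (altDensityReal (fun t => lam t / 3) ((c * p.2 + p.1) / (2 * c)) ((c * p.2 - p.1) / (2 * c))
      + ε * altDensityReal (fun t => lam t / 3) ((c * p.2 - p.1) / (2 * c))
          ((c * p.2 + p.1) / (2 * c)))

section Edge

variable {c : ℝ} {lam : ℝ → ℝ}

theorem IsRate.div_three (h : IsRate lam) : IsRate fun t => lam t / 3 := by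
  simpa only [div_eq_inv_mul] using h.const_mul (k := 3⁻¹) (by norm_num)

theorem mem_quadrant_of_mem_lightCone (hc : 0 < c) {p : ℝ × ℝ} (hp : p ∈ lightCone c) :
    0 < (c * p.2 + p.1) / (2 * c) ∧ 0 < (c * p.2 - p.1) / (2 * c) := by
  have h := abs_lt.1 (show |p.1| < c * p.2 from hp)
  exact ⟨div_pos (by linarith [h.1]) (by linarith), div_pos (by linarith [h.2]) (by linarith)⟩

/-- `Λ` is one degree smoother than `λ`, so the factor `e^{-Λ}` never limits the regularity of the
densities. -/
theorem IsRate.contDiffOn_cumRate (h : IsRate lam) : ContDiffOn ℝ 2 (cumRate lam) (Ioi 0) := by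
  refine (contDiffOn_succ_iff_deriv_of_isOpen (n := 1) isOpen_Ioi).2 ⟨fun t ht =>
    (h.hasDerivAt_cumRate ht).differentiableAt.differentiableWithinAt, by simp, ?_⟩
  exact h.contDiffOn.congr fun t ht => (h.hasDerivAt_cumRate ht).deriv

theorem contDiffOn_edgeComponent (hc : 0 < c) (ε : ℝ) (hlam : IsRate lam) {n : WithTop ℕ∞}
    (hn : n ≤ 2) (hd : ContDiffOn ℝ n (fun p : ℝ × ℝ =>
      altDensityReal (fun t => lam t / 3) p.1 p.2) (Ioi 0 ×ˢ Ioi 0)) :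
    ContDiffOn ℝ n (edgeComponent c ε lam) (lightCone c) := by
  have e1 : ContDiffOn ℝ n (fun p : ℝ × ℝ => Real.exp (-cumRate lam p.2) / (8 * c))
      (lightCone c) :=
    (Real.contDiff_exp.comp_contDiffOn (((hlam.contDiffOn_cumRate.of_le hn).comp
      contDiff_snd.contDiffOn fun p hp => pos_of_mem_lightCone hc hp).neg)).div_const _
  have e2 : ContDiffOn ℝ n (fun p : ℝ × ℝ => altDensityReal (fun t => lam t / 3)
      ((c * p.2 + p.1) / (2 * c)) ((c * p.2 - p.1) / (2 * c))) (lightCone c) :=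
    hd.comp (f := fun p : ℝ × ℝ => ((c * p.2 + p.1) / (2 * c), (c * p.2 - p.1) / (2 * c)))
      (by fun_prop) fun p hp => mem_quadrant_of_mem_lightCone hc hp
  have e3 : ContDiffOn ℝ n (fun p : ℝ × ℝ => altDensityReal (fun t => lam t / 3)
      ((c * p.2 - p.1) / (2 * c)) ((c * p.2 + p.1) / (2 * c))) (lightCone c) :=
    hd.comp (f := fun p : ℝ × ℝ => ((c * p.2 - p.1) / (2 * c), (c * p.2 + p.1) / (2 * c)))
      (by fun_prop) fun p hp => (mem_quadrant_of_mem_lightCone hc hp).symm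
  exact e1.mul (e2.add (contDiffOn_const.mul e3))

/-- Chain rule: `a` and `b` both have time derivative `1/2`, and their space derivatives are
`1/(2c)` and `-1/(2c)`. -/
theorem hasFDerivAt_edgeComponent (hc : 0 < c) (ε : ℝ) (hlam : IsRate lam) {p : ℝ × ℝ}
    (hp : p ∈ lightCone c) {a b : ℝ} (ha : a = (c * p.2 + p.1) / (2 * c))
    (hb : b = (c * p.2 - p.1) / (2 * c)) :
    timeDeriv (edgeComponent c ε lam) p = Real.exp (-cumRate lam p.2) / (8 * c) *
        ((lam p.2 / 3 * altDensityReal (fun t => lam t / 3) b a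
          + altDensityDeriv (fun t => lam t / 3) a b) / 2
        + ε * ((lam p.2 / 3 * altDensityReal (fun t => lam t / 3) a b
          + altDensityDeriv (fun t => lam t / 3) b a) / 2)
        - lam p.2 * (altDensityReal (fun t => lam t / 3) a b
          + ε * altDensityReal (fun t => lam t / 3) b a)) ∧
    spaceDeriv (edgeComponent c ε lam) p = Real.exp (-cumRate lam p.2) / (8 * c) *
        ((lam p.2 / 3 * altDensityReal (fun t => lam t / 3) b a
          - altDensityDeriv (fun t => lam t / 3) a b) / (2 * c)
        + ε * ((altDensityDeriv (fun t => lam t / 3) b a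
          - lam p.2 / 3 * altDensityReal (fun t => lam t / 3) a b) / (2 * c))) := by
  have hμ := hlam.div_three
  have ht := pos_of_mem_lightCone hc hp
  obtain ⟨ha0, hb0⟩ := mem_quadrant_of_mem_lightCone hc hp
  have hab : a + b = p.2 := by rw [ha, hb]; field_simp; ring
  have hD : ∀ q ∈ Ioi (0 : ℝ) ×ˢ Ioi (0 : ℝ), HasFDerivAt
      (fun p : ℝ × ℝ => altDensityReal (fun t => lam t / 3) p.1 p.2) _ q := fun q hq =>
    hasFDerivAt_of_partial (fun a ha b hb => hμ.hasDerivAt_altDensityReal_fst ha hb)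
      (fun a ha b hb => hμ.hasDerivAt_altDensityReal_snd ha hb)
      ((continuousOn_comp_add hμ.continuousOn).mul
        (continuousOn_quadrant_swap hμ.continuousOn_altDensityReal))
      hμ.continuousOn_altDensityDeriv hq
  have dr : HasFDerivAt (fun p : ℝ × ℝ => (c * p.2 + p.1) / (2 * c))
      ((2 * c)⁻¹ • (c • ContinuousLinearMap.snd ℝ ℝ ℝ + ContinuousLinearMap.fst ℝ ℝ ℝ)) p := by
    simp only [div_eq_mul_inv]
    exact ((hasFDerivAt_snd.const_mul c).add hasFDerivAt_fst).mul_const _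
  have dl : HasFDerivAt (fun p : ℝ × ℝ => (c * p.2 - p.1) / (2 * c))
      ((2 * c)⁻¹ • (c • ContinuousLinearMap.snd ℝ ℝ ℝ - ContinuousLinearMap.fst ℝ ℝ ℝ)) p := by
    simp only [div_eq_mul_inv]
    exact ((hasFDerivAt_snd.const_mul c).sub hasFDerivAt_fst).mul_const _
  have d1 := (hD (a, b) ⟨ha ▸ ha0, hb ▸ hb0⟩)
  have d2 := (hD (b, a) ⟨hb ▸ hb0, ha ▸ ha0⟩)
  rw [ha, hb] at d1 d2
  have d1' := HasFDerivAt.comp p d1 (dr.prodMk dl)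
  have d2' := HasFDerivAt.comp p d2 (dl.prodMk dr)
  rw [← ha, ← hb] at d1' d2'
  have dE : HasFDerivAt (fun p : ℝ × ℝ => Real.exp (-cumRate lam p.2) * (8 * c)⁻¹)
      ((8 * c)⁻¹ • (Real.exp (-cumRate lam p.2) •
        -(lam p.2 • ContinuousLinearMap.snd ℝ ℝ ℝ))) p := by
    have := (hlam.hasDerivAt_cumRate ht).comp_hasFDerivAt p (hasFDerivAt_snd (𝕜 := ℝ))
    exact (this.neg.exp).mul_const _
  have d := dE.mul (d1'.add (d2'.const_mul ε))
  have d' : fderiv ℝ (edgeComponent c ε lam) p = _ := d.fderiv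
  rw [timeDeriv, spaceDeriv, d']
  simp only [add_apply, smul_apply, neg_apply, ContinuousLinearMap.comp_apply,
    ContinuousLinearMap.prod_apply, sub_apply, smul_eq_mul, ContinuousLinearMap.coe_snd',
    ContinuousLinearMap.coe_fst', Pi.add_apply, Function.comp_apply, ← ha, ← hb, hab,
    add_comm b a]
  constructor <;> field_simp <;> ring

/-- Along the characteristics the terms in `altDensityDeriv` cancel. Only derivatives in the first
argument remain, and these give the exchange terms with rate `λ/3`. -/
theorem solvesFirstOrderSystem_edgeComponent (hc : 0 < c) (hlam : IsRate lam) :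
    SolvesFirstOrderSystem c lam (edgeComponent c 1 lam) (edgeComponent c (-1) lam) where
  contDiffOn_fst := contDiffOn_edgeComponent hc 1 hlam one_le_two
    hlam.div_three.contDiffOn_altDensityReal
  contDiffOn_snd := contDiffOn_edgeComponent hc (-1) hlam one_le_two
    hlam.div_three.contDiffOn_altDensityReal
  sum_eq p hp := by
    rw [(hasFDerivAt_edgeComponent hc 1 hlam hp rfl rfl).1,
      (hasFDerivAt_edgeComponent hc (-1) hlam hp rfl rfl).2, edgeComponent]
    field_simp
    ring
  diff_eq p hp := by
    rw [(hasFDerivAt_edgeComponent hc (-1) hlam hp rfl rfl).1,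
      (hasFDerivAt_edgeComponent hc 1 hlam hp rfl rfl).2, edgeComponent]
    field_simp
    ring

theorem edgeComponent_nonneg (hc : 0 < c) (p : ℝ × ℝ) : 0 ≤ edgeComponent c 1 lam p := by
  refine mul_nonneg (div_nonneg (Real.exp_pos _).le (by linarith)) ?_
  rw [one_mul]
  exact add_nonneg (altDensityReal_nonneg _ _) (altDensityReal_nonneg _ _)

end Edge

/-! ### Measurability for right-continuous paths -/

/-- The integral over `[0, t]` of a function `y` of the number of jumps. -/
noncomputable def pathIntegral {Ω : Type*} (N : ℝ≥0 → Ω → ℕ) (y : ℕ → ℝ) (t : ℝ) (ω : Ω) : ℝ :=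
  ∫ s in (0 : ℝ)..t, y (N s.toNNReal ω)

/-- The first point of the grid of mesh `2⁻ᵏ` to the right of `r`, truncated at `s`. -/
noncomputable def gridPoint (s : ℝ≥0) (k n : ℕ) : ℝ≥0 := min (n / 2 ^ k) s

section RightContinuous

theorem tendsto_gridPoint_nhdsGE {r s : ℝ≥0} (hrs : r ≤ s) :
    Tendsto (fun k : ℕ => gridPoint s k (⌊r * 2 ^ k⌋₊ + 1)) atTop (𝓝[≥] r) := by
  have hpos : ∀ k : ℕ, (0 : ℝ≥0) < 2 ^ k := fun k => by positivity
  have hle : ∀ k : ℕ, r ≤ ((⌊r * 2 ^ k⌋₊ + 1 : ℕ) : ℝ≥0) / 2 ^ k := by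
    intro k
    rw [le_div_iff₀ (hpos k)]
    push_cast
    exact (Nat.lt_floor_add_one _).le
  refine tendsto_nhdsWithin_iff.2 ⟨?_, Eventually.of_forall fun k => le_min (hle k) hrs⟩
  refine tendsto_of_tendsto_of_tendsto_of_le_of_le (g := fun _ => r)
    (h := fun k : ℕ => r + (1 / 2) ^ k) tendsto_const_nhds ?_
    (fun k => le_min (hle k) hrs) fun k => (min_le_left _ _).trans ?_
  · simpa using (tendsto_const_nhds (x := r)).add (NNReal.tendsto_pow_atTop_nhds_zero_of_lt_one
      (r := 1 / 2) (by rw [← NNReal.coe_lt_coe]; norm_num))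
  · rw [div_le_iff₀ (hpos k)]
    push_cast
    rw [add_mul, ← mul_pow]
    have := Nat.floor_le (zero_le : 0 ≤ r * 2 ^ k)
    simpa using this

variable {Ω : Type*} {N : ℝ≥0 → Ω → ℕ}

theorem tendsto_gridPoint_of_rightCont
    (hr : ∀ ω t, ContinuousWithinAt (fun s => N s ω) (Ici t) t) {r s : ℝ≥0} (hrs : r ≤ s)
    (ω : Ω) : Tendsto (fun k : ℕ => N (gridPoint s k (⌊r * 2 ^ k⌋₊ + 1)) ω) atTop (𝓝 (N r ω)) :=
  (hr ω r).tendsto.comp (tendsto_gridPoint_nhdsGE hrs)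

variable [MeasurableSpace Ω]

theorem measurable_uncurry_min_of_rightCont
    (hr : ∀ ω t, ContinuousWithinAt (fun s => N s ω) (Ici t) t) (t : ℝ≥0)
    (hm : ∀ s ≤ t, Measurable (N s)) :
    Measurable fun p : ℝ × Ω => N (min p.1.toNNReal t) p.2 := by
  refine measurable_of_tendsto_metrizable (f := fun (k : ℕ) (p : ℝ × Ω) =>
    N (gridPoint t k (⌊min p.1.toNNReal t * 2 ^ k⌋₊ + 1)) p.2) (fun k => ?_)
    (tendsto_pi_nhds.2 fun p => tendsto_gridPoint_of_rightCont hr (min_le_right _ _) p.2)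
  have h1 : Measurable fun q : ℕ × Ω => N (gridPoint t k (q.1 + 1)) q.2 :=
    measurable_from_prod_countable_right fun n =>
      hm (gridPoint t k (n + 1)) (min_le_right _ _)
  have h3 : Measurable fun p : ℝ × Ω => min p.1.toNNReal t * 2 ^ k :=
    ((measurable_real_toNNReal.comp measurable_fst).min measurable_const).mul_const _
  have h2 : Measurable fun p : ℝ × Ω => (⌊min p.1.toNNReal t * 2 ^ k⌋₊, p.2) :=
    (h3.nat_floor).prodMk measurable_snd
  exact h1.comp (f := fun p : ℝ × Ω => (⌊min p.1.toNNReal t * 2 ^ k⌋₊, p.2)) h2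

/-- Only the variables up to time `t` have to be measurable, so the `σ`-algebra may be that of the
past of the process or the one generated by its path. -/
theorem measurable_pathIntegral
    (hr : ∀ ω t, ContinuousWithinAt (fun s => N s ω) (Ici t) t) (y : ℕ → ℝ) {t : ℝ} (ht : 0 ≤ t)
    (hm : ∀ s ≤ t.toNNReal, Measurable (N s)) : Measurable (pathIntegral N y t) := by
  have h := measurable_uncurry_min_of_rightCont hr t.toNNReal hm
  have e : pathIntegral N y t = fun ω => ∫ s in Ioc 0 t, y (N (min s.toNNReal t.toNNReal) ω) := by
    funext ω
    rw [pathIntegral, intervalIntegral.integral_of_le ht]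
    refine setIntegral_congr_fun measurableSet_Ioc fun s hs => ?_
    rw [min_eq_left (Real.toNNReal_le_toNNReal hs.2)]
  rw [e]
  have h' : Measurable fun p : ℝ × Ω => y (N (min p.1.toNNReal t.toNNReal) p.2) :=
    (measurable_from_top (f := y)).comp h
  exact (h'.stronglyMeasurable.integral_prod_left'
    (μ := volume.restrict (Ioc (0 : ℝ) t))).measurable

end RightContinuous

/-! ### Independence of the past and future increments -/

section Poisson

variable {Ω : Type*} {N : ℝ≥0 → Ω → ℕ}

/-- The `σ`-algebra generated by the process at the points of the dyadic grids of `[0, s]`. -/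
noncomputable abbrev gridSigma (N : ℝ≥0 → Ω → ℕ) (s : ℝ≥0) (k : ℕ) : MeasurableSpace Ω :=
  ⨆ i : ℕ, MeasurableSpace.comap (N (gridPoint s k i)) ⊤

theorem measurable_iSup_gridSigma
    (hr : ∀ ω t, ContinuousWithinAt (fun s => N s ω) (Ici t) t) {r s : ℝ≥0} (hrs : r ≤ s) :
    Measurable[⨆ k, gridSigma N s k] (N r) := by
  refine @measurable_of_tendsto_metrizable Ω ℕ (⨆ k, gridSigma N s k) _ _ _ _
    (fun k => N (gridPoint s k (⌊r * 2 ^ k⌋₊ + 1))) (N r) (fun k => ?_)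
    (tendsto_pi_nhds.2 fun ω => tendsto_gridPoint_of_rightCont hr hrs ω)
  refine Measurable.mono (comap_measurable _) ?_ le_rfl
  exact (le_iSup (fun i => MeasurableSpace.comap (N (gridPoint s k i)) ⊤) _).trans
    (le_iSup (gridSigma N s) k)

variable [MeasurableSpace Ω] {P : Measure Ω} {lam : ℝ → ℝ}

/-- Since the process starts at `0`, its values at the points `u i`, `i ≤ n`, are sums of the first
`n` increments. -/
theorem IsPoissonProcess.indep_comap_seq (hN : IsPoissonProcess N lam P) {u : ℕ → ℝ≥0}
    (hu : Monotone u) (h0 : u 0 = 0) (n : ℕ) :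
    Indep (⨆ i : Finset.range (n + 1), MeasurableSpace.comap (N (u i)) ⊤)
      (MeasurableSpace.comap (fun ω => N (u (n + 1)) ω - N (u n) ω) ⊤) P := by
  have hi := hN.indepIncrements.nat hu
  have hm : ∀ i, Measurable fun ω => N (u (i + 1)) ω - N (u i) ω := fun i =>
    (hN.measurable _).sub (hN.measurable _)
  have h1 := hi.indepFun_finset (Finset.range n) {n} (by simp) hm
  have h2 : IndepFun (fun ω (i : Finset.range n) => N (u (i + 1)) ω - N (u i) ω)
      (fun ω => N (u (n + 1)) ω - N (u n) ω) P :=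
    h1.comp (φ := id) (ψ := fun f : ((({n} : Finset ℕ)) → ℕ) => f ⟨n, by simp⟩)
      measurable_id (measurable_pi_apply _)
  rw [IndepFun_iff_Indep] at h2
  refine indep_of_indep_of_le_left h2 (iSup_le fun i => ?_)
  have hsum : ∀ j, j ≤ n → Measurable[MeasurableSpace.comap
      (fun ω (i : Finset.range n) => N (u (i + 1)) ω - N (u i) ω) inferInstance] (N (u j)) := by
    intro j
    induction j with
    | zero =>
      intro _
      have : N (u 0) = fun _ => 0 := by
        funext ω
        rw [h0, hN.zero]
      rw [this]
      exact measurable_const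
    | succ j ih =>
      intro hj
      have e : N (u (j + 1)) = fun ω => N (u j) ω + (N (u (j + 1)) ω - N (u j) ω) := by
        funext ω
        have := hN.mono ω (hu (Nat.le_succ j))
        simp only [Nat.succ_eq_add_one] at this
        omega
      rw [e]
      have h3 := comap_measurable (m := MeasurableSpace.pi)
        (fun ω (i : Finset.range n) => N (u (i + 1)) ω - N (u i) ω)
      refine (ih (by omega)).add ?_
      exact (measurable_pi_apply (⟨j, Finset.mem_range.2 hj⟩ : Finset.range n)).comp h3
  exact (hsum i (by have := Finset.mem_range.1 i.2; omega)).comap_le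

variable [IsProbabilityMeasure P]

/-- The dyadic grids are nested, so their `σ`-algebras increase, and independence from each of them
passes to the supremum. -/
theorem IsPoissonProcess.indep_iSup_gridSigma (hN : IsPoissonProcess N lam P) {s t : ℝ≥0}
    (hst : s ≤ t) :
    Indep (⨆ k, gridSigma N s k) (MeasurableSpace.comap (fun ω => N t ω - N s ω) ⊤) P := by
  refine indep_iSup_of_monotone (fun k => ?_)
    (fun k => iSup_le fun i => (hN.measurable _).comap_le)
    ((hN.measurable _).sub (hN.measurable _)).comap_le ?_
  · obtain ⟨n, hn⟩ := exists_nat_ge (s * 2 ^ k)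
    have hpos : (0 : ℝ≥0) < 2 ^ k := by positivity
    have hgs : ∀ i, n ≤ i → gridPoint s k i = s := by
      intro i hi
      refine min_eq_right ?_
      rw [le_div_iff₀ hpos]
      exact hn.trans (by exact_mod_cast hi)
    -- The grid of `[0, s]` followed by `t`; `n` is so large that the grid has reached `s`, which
    -- makes the increment after `n` equal to `N t - N s`.
    let u : ℕ → ℝ≥0 := fun i => if i ≤ n then gridPoint s k i else t
    have hu : Monotone u := by
      intro i j hij
      simp only [u]
      split_ifs with h1 h2
      · refine min_le_min_right _ ?_
        gcongr
      · exact (min_le_right _ _).trans hst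
      · omega
      · exact le_rfl
    have h := hN.indep_comap_seq hu (by simp [u, gridPoint]) n
    have e1 : u (n + 1) = t := by simp [u]
    have e2 : u n = s := by simp [u, hgs]
    rw [e1, e2] at h
    refine indep_of_indep_of_le_left h (iSup_le fun i => ?_)
    have e3 : gridPoint s k i = u (min i n) := by
      rcases le_total i n with h | h
      · simp [u, h]
      · simp [u, h, hgs]
    rw [e3]
    exact le_iSup (fun i : Finset.range (n + 1) => MeasurableSpace.comap (N (u i)) ⊤)
      ⟨min i n, by simp⟩
  · refine monotone_nat_of_le_succ fun k => iSup_le fun i => ?_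
    have e : gridPoint s k i = gridPoint s (k + 1) (2 * i) := by
      simp only [gridPoint]
      congr 1
      push_cast
      rw [pow_succ', mul_div_mul_left _ _ two_ne_zero]
    rw [e]
    exact le_iSup (fun i => MeasurableSpace.comap (N (gridPoint s (k + 1) i)) ⊤) (2 * i)

theorem IsPoissonProcess.indepFun_past (hN : IsPoissonProcess N lam P) {s t : ℝ≥0}
    (hst : s ≤ t) (y : ℕ → ℝ) :
    IndepFun (fun ω => (pathIntegral N y s ω, N s ω)) (fun ω => N t ω - N s ω) P := by
  rw [IndepFun_iff_Indep]
  refine indep_of_indep_of_le_left (hN.indep_iSup_gridSigma hst) ?_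
  refine Measurable.comap_le (m₁ := ⨆ k, gridSigma N s k) ?_
  refine Measurable.prodMk ?_ (measurable_iSup_gridSigma hN.rightCont le_rfl)
  refine @measurable_pathIntegral Ω N (⨆ k, gridSigma N s k) hN.rightCont y s s.2 fun r hr => ?_
  exact measurable_iSup_gridSigma hN.rightCont (by simpa using hr)

end Poisson

/-! ### Pathwise bounds -/

section PathIntegral

variable {Ω : Type*} {N : ℝ≥0 → Ω → ℕ} {y : ℕ → ℝ} {C : ℝ}

theorem intervalIntegrable_path (hm : ∀ ω, Monotone fun t => N t ω) (hy : ∀ n, |y n| ≤ C) (ω : Ω)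
    (s t : ℝ) : IntervalIntegrable (fun r => y (N r.toNNReal ω)) volume s t := by
  have hN : Measurable fun r : ℝ => N r.toNNReal ω :=
    ((hm ω).comp (fun _ _ h => Real.toNNReal_mono h)).measurable
  have h : Measurable fun r : ℝ => y (N r.toNNReal ω) := (measurable_from_top (f := y)).comp hN
  refine (intervalIntegrable_const (c := C)).mono_fun h.aestronglyMeasurable
    (Eventually.of_forall fun r => ?_)
  exact (hy _).trans (le_abs_self C)

theorem pathIntegral_sub (hm : ∀ ω, Monotone fun t => N t ω) (hy : ∀ n, |y n| ≤ C) (ω : Ω)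
    (s t : ℝ) : pathIntegral N y t ω - pathIntegral N y s ω = ∫ r in s..t, y (N r.toNNReal ω) :=
  intervalIntegral.integral_interval_sub_left (intervalIntegrable_path hm hy ω _ _)
    (intervalIntegrable_path hm hy ω _ _)

theorem abs_pathIntegral_sub_le (hm : ∀ ω, Monotone fun t => N t ω) (hy : ∀ n, |y n| ≤ C) (ω : Ω)
    (s t : ℝ) : |pathIntegral N y t ω - pathIntegral N y s ω| ≤ C * |t - s| := by
  rw [pathIntegral_sub hm hy]
  exact intervalIntegral.norm_integral_le_of_norm_le_const
    (f := fun r => y (N r.toNNReal ω)) fun r _ => hy (N r.toNNReal ω)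

theorem pathIntegral_sub_of_eq (hm : ∀ ω, Monotone fun t => N t ω) (hy : ∀ n, |y n| ≤ C) {ω : Ω}
    {s t : ℝ} (hst : s ≤ t) {n : ℕ} (hs : N s.toNNReal ω = n) (ht : N t.toNNReal ω = n) :
    pathIntegral N y t ω - pathIntegral N y s ω = y n * (t - s) := by
  have e : ∫ r in s..t, y (N r.toNNReal ω) = ∫ _ in s..t, y n := by
    refine intervalIntegral.integral_congr fun r hr => ?_
    rw [uIcc_of_le hst] at hr
    have h1 := hm ω (Real.toNNReal_le_toNNReal hr.1)
    have h2 := hm ω (Real.toNNReal_le_toNNReal hr.2)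
    simp only at h1 h2 ⊢
    congr 1
    omega
  rw [pathIntegral_sub hm hy, e, intervalIntegral.integral_const, smul_eq_mul, mul_comm]

theorem continuous_pathIntegral (hm : ∀ ω, Monotone fun t => N t ω) (hy : ∀ n, |y n| ≤ C) (ω : Ω) :
    Continuous fun t => pathIntegral N y t ω :=
  intervalIntegral.continuous_primitive (fun _ _ => intervalIntegrable_path hm hy ω _ _) 0

end PathIntegral

/-! ### Probabilities of none, one or several jumps -/

section Increments

variable {Ω : Type*} [MeasurableSpace Ω] {P : Measure Ω} {N : ℝ≥0 → Ω → ℕ} {lam : ℝ → ℝ}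

theorem IsPoissonProcess.real_sub_mem (hN : IsPoissonProcess N lam P) (hlam : IsRate lam)
    {s t : ℝ} (hs : 0 ≤ s) (hst : s ≤ t) (B : Set ℕ) :
    P.real {ω | N t.toNNReal ω - N s.toNNReal ω ∈ B} =
      (poissonMeasure (cumRate lam t - cumRate lam s).toNNReal).real B := by
  have hl := hN.law s.toNNReal t.toNNReal (Real.toNNReal_le_toNNReal hst)
  rw [Real.coe_toNNReal _ hs, Real.coe_toNNReal _ (hs.trans hst),
    ← hlam.cumRate_sub hs (hs.trans hst)] at hl
  rw [measureReal_def, measureReal_def, ← hl.map_eq,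
    Measure.map_apply_of_aemeasurable hl.aemeasurable (MeasurableSet.of_discrete)]
  rfl

theorem IsPoissonProcess.real_sub_eq (hN : IsPoissonProcess N lam P) (hlam : IsRate lam)
    {s t : ℝ} (hs : 0 ≤ s) (hst : s ≤ t) (k : ℕ) :
    P.real {ω | N t.toNNReal ω - N s.toNNReal ω = k} =
      Real.exp (-(cumRate lam t - cumRate lam s)) * (cumRate lam t - cumRate lam s) ^ k
        / k.factorial := by
  have h := hN.real_sub_mem hlam hs hst {k}
  rw [poissonMeasure_real_singleton,
    Real.coe_toNNReal _ (sub_nonneg.2 (hlam.cumRate_mono hs hst))] at h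
  exact h

theorem IsPoissonProcess.real_one_le_sub (hN : IsPoissonProcess N lam P) (hlam : IsRate lam)
    {s t : ℝ} (hs : 0 ≤ s) (hst : s ≤ t) :
    P.real {ω | 1 ≤ N t.toNNReal ω - N s.toNNReal ω} ≤ cumRate lam t - cumRate lam s := by
  have hδ := sub_nonneg.2 (hlam.cumRate_mono hs hst)
  have h := hN.real_sub_mem hlam hs hst {0}ᶜ
  rw [probReal_compl_eq_one_sub MeasurableSet.of_discrete, poissonMeasure_real_singleton,
    Real.coe_toNNReal _ hδ] at h
  have e : {ω | 1 ≤ N t.toNNReal ω - N s.toNNReal ω} =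
      {ω | N t.toNNReal ω - N s.toNNReal ω ∈ ({0}ᶜ : Set ℕ)} := by
    ext ω
    simp only [mem_ofPred_eq, mem_compl_iff, mem_singleton_iff]
    omega
  rw [e, h]
  have := Real.one_sub_le_exp_neg (cumRate lam t - cumRate lam s)
  simp only [pow_zero, mul_one, Nat.factorial_zero, Nat.cast_one, div_one]
  linarith

theorem IsPoissonProcess.real_two_le_sub (hN : IsPoissonProcess N lam P) (hlam : IsRate lam)
    {s t : ℝ} (hs : 0 ≤ s) (hst : s ≤ t) :
    P.real {ω | 2 ≤ N t.toNNReal ω - N s.toNNReal ω} ≤ (cumRate lam t - cumRate lam s) ^ 2 := by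
  have hδ := sub_nonneg.2 (hlam.cumRate_mono hs hst)
  have h := hN.real_sub_mem hlam hs hst ({0} ∪ {1})ᶜ
  rw [probReal_compl_eq_one_sub MeasurableSet.of_discrete,
    measureReal_union (by simp) MeasurableSet.of_discrete, poissonMeasure_real_singleton,
    poissonMeasure_real_singleton, Real.coe_toNNReal _ hδ] at h
  have e : {ω | 2 ≤ N t.toNNReal ω - N s.toNNReal ω} =
      {ω | N t.toNNReal ω - N s.toNNReal ω ∈ (({0} ∪ {1})ᶜ : Set ℕ)} := by
    ext ω
    simp only [mem_ofPred_eq, mem_compl_iff, mem_union, mem_singleton_iff]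
    omega
  rw [e, h]
  have := Real.one_sub_le_exp_neg (cumRate lam t - cumRate lam s)
  simp only [pow_zero, mul_one, Nat.factorial_zero, Nat.cast_one, div_one, pow_one,
    Nat.factorial_one]
  nlinarith

end Increments

/-! ### Expectations with a frozen final velocity -/

/-- The expectation of `g (W s + z (T - s))` on the event that there are `n` jumps up to time `s`,
with `W` the integral of `y` along the path. -/
noncomputable def jumpExpectation {Ω : Type*} [MeasurableSpace Ω] (P : Measure Ω)
    (N : ℝ≥0 → Ω → ℕ) (y : ℕ → ℝ) (g : ℝ → ℂ) (z T : ℝ) (n : ℕ) (s : ℝ) : ℂ :=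
  ∫ ω, (if N s.toNNReal ω = n then g (pathIntegral N y s ω + z * (T - s)) else 0) ∂P

section Expectation

variable {Ω : Type*} [MeasurableSpace Ω] {P : Measure Ω}
  {N : ℝ≥0 → Ω → ℕ} {lam : ℝ → ℝ} {y : ℕ → ℝ} {C K : ℝ} {g : ℝ → ℂ}

theorem IsPoissonProcess.measurable_pathIntegral (hN : IsPoissonProcess N lam P) (y : ℕ → ℝ)
    {t : ℝ} (ht : 0 ≤ t) : Measurable (pathIntegral N y t) :=
  _root_.measurable_pathIntegral hN.rightCont y ht fun s _ => hN.measurable s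

theorem measurable_ite_eq_nat {m : Ω → ℕ} (hm : Measurable m) (n : ℕ) {F : Ω → ℂ}
    (hF : Measurable F) : Measurable fun ω => if m ω = n then F ω else 0 :=
  Measurable.ite (hm (MeasurableSet.singleton n)) hF measurable_const

variable [IsProbabilityMeasure P]

theorem IsPoissonProcess.integrable_ite (hN : IsPoissonProcess N lam P) (hg : Continuous g)
    (hg1 : ∀ x, ‖g x‖ ≤ 1) {s : ℝ} (hs : 0 ≤ s) (w : ℝ) (n : ℕ) :
    Integrable (fun ω => if N s.toNNReal ω = n then g (pathIntegral N y s ω + w) else 0) P := by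
  refine Integrable.of_bound (C := 1) (measurable_ite_eq_nat (hN.measurable _) n
    (hg.measurable.comp ((hN.measurable_pathIntegral y hs).add_const w))).aestronglyMeasurable
    (Eventually.of_forall fun ω => ?_)
  split_ifs
  · exact hg1 _
  · simp

theorem IsPoissonProcess.integral_ite_mul (hN : IsPoissonProcess N lam P) (hg : Continuous g)
    {s t : ℝ} (hs : 0 ≤ s) (hst : s ≤ t) (w : ℝ) (n k : ℕ) :
    ∫ ω, (if N s.toNNReal ω = n then g (pathIntegral N y s ω + w) else 0) *
        (if N t.toNNReal ω - N s.toNNReal ω = k then 1 else 0) ∂P =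
      (∫ ω, (if N s.toNNReal ω = n then g (pathIntegral N y s ω + w) else 0) ∂P) *
        (P.real {ω | N t.toNNReal ω - N s.toNNReal ω = k} : ℂ) := by
  have hi := hN.indepFun_past (Real.toNNReal_le_toNNReal hst) y
  rw [Real.coe_toNNReal _ hs] at hi
  have hm1 : Measurable fun q : ℝ × ℕ => if q.2 = n then g (q.1 + w) else 0 :=
    measurable_ite_eq_nat measurable_snd n
      (hg.measurable.comp (measurable_fst.add_const w))
  have hm2 : Measurable fun j : ℕ => if j = k then (1 : ℂ) else 0 := measurable_from_top
  have h := hi.comp hm1 hm2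
  have hmΔ : Measurable fun ω => N t.toNNReal ω - N s.toNNReal ω :=
    (hN.measurable _).sub (hN.measurable _)
  have e := h.integral_fun_mul_eq_mul_integral
    (hm1.comp ((hN.measurable_pathIntegral y hs).prodMk (hN.measurable _))).aestronglyMeasurable
    (hm2.comp hmΔ).aestronglyMeasurable
  simp only [Function.comp_apply] at e
  rw [e]
  congr 1
  have e2 : (fun ω => if N t.toNNReal ω - N s.toNNReal ω = k then (1 : ℂ) else 0) =
      {ω | N t.toNNReal ω - N s.toNNReal ω = k}.indicator fun _ => 1 := by
    funext ω
    simp [indicator]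
  rw [e2, integral_indicator_const _ (show MeasurableSet {ω | N t.toNNReal ω - N s.toNNReal ω = k} from
    hmΔ (MeasurableSet.singleton k))]
  simp

/-- Without a jump in `(s, t]` the argument of `g` moves by at most `(C + |z|)(t - s)`; a jump has
probability at most `Λ(t) - Λ(s)` and costs at most `2`. This is used for continuity. -/
theorem IsPoissonProcess.norm_jumpExpectation_sub_le (hN : IsPoissonProcess N lam P)
    (hlam : IsRate lam) (hy : ∀ n, |y n| ≤ C) (hg : Continuous g) (hg1 : ∀ x, ‖g x‖ ≤ 1)
    (hK : ∀ x x', ‖g x - g x'‖ ≤ K * |x - x'|) (z T : ℝ) (n : ℕ) {s t : ℝ} (hs : 0 ≤ s)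
    (hst : s ≤ t) :
    ‖jumpExpectation P N y g z T n t - jumpExpectation P N y g z T n s‖ ≤
      K * (C + |z|) * (t - s) + 2 * (cumRate lam t - cumRate lam s) := by
  have hK0 : 0 ≤ K := by
    have := hK 1 0
    simp only [sub_zero, abs_one, mul_one] at this
    exact (norm_nonneg _).trans this
  have hC0 : 0 ≤ C := (abs_nonneg _).trans (hy 0)
  have hset : MeasurableSet {ω | 1 ≤ N t.toNNReal ω - N s.toNNReal ω} :=
    ((hN.measurable _).sub (hN.measurable _)) (measurableSet_Ici (a := 1))
  rw [jumpExpectation, jumpExpectation, ← integral_sub (hN.integrable_ite hg hg1 (hs.trans hst) _ _)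
    (hN.integrable_ite hg hg1 hs _ _)]
  have hb : Integrable (fun ω => K * (C + |z|) * (t - s) +
      {ω | 1 ≤ N t.toNNReal ω - N s.toNNReal ω}.indicator (fun _ => (2 : ℝ)) ω) P :=
    (integrable_const _).add ((integrable_const _).indicator hset)
  refine (norm_integral_le_of_norm_le hb (Eventually.of_forall fun ω => ?_)).trans ?_
  · have hle := hN.mono ω (Real.toNNReal_le_toNNReal hst)
    simp only at hle
    have hclose : ‖g (pathIntegral N y t ω + z * (T - t)) - g (pathIntegral N y s ω + z * (T - s))‖
        ≤ K * (C + |z|) * (t - s) := by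
      refine (hK _ _).trans ?_
      rw [mul_assoc]
      refine mul_le_mul_of_nonneg_left ?_ hK0
      have e : pathIntegral N y t ω + z * (T - t) - (pathIntegral N y s ω + z * (T - s)) =
        (pathIntegral N y t ω - pathIntegral N y s ω) - z * (t - s) := by ring
      rw [e]
      refine (abs_sub _ _).trans ?_
      have h1 := abs_pathIntegral_sub_le hN.mono hy ω s t
      rw [abs_of_nonneg (sub_nonneg.2 hst)] at h1
      rw [abs_mul, abs_of_nonneg (sub_nonneg.2 hst), add_mul]
      gcongr
    have hpos : 0 ≤ K * (C + |z|) * (t - s) := by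
      have := sub_nonneg.2 hst
      positivity
    by_cases hΔ : 1 ≤ N t.toNNReal ω - N s.toNNReal ω
    · rw [indicator_of_mem (show ω ∈ {ω | 1 ≤ N t.toNNReal ω - N s.toNNReal ω} from hΔ)]
      have h1 : ∀ (q : Prop) [Decidable q] (x : ℝ), ‖if q then g x else 0‖ ≤ 1 := by
        intro q _ x
        split_ifs
        · exact hg1 x
        · simp
      refine (norm_sub_le _ _).trans ?_
      linarith [h1 (N t.toNNReal ω = n) (pathIntegral N y t ω + z * (T - t)),
        h1 (N s.toNNReal ω = n) (pathIntegral N y s ω + z * (T - s))]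
    · rw [indicator_of_notMem (show ω ∉ {ω | 1 ≤ N t.toNNReal ω - N s.toNNReal ω} from hΔ),
        add_zero]
      have e : N t.toNNReal ω = N s.toNNReal ω := by omega
      rw [e]
      split_ifs
      · exact hclose
      · simpa using hpos
  · rw [integral_add (integrable_const _) ((integrable_const _).indicator hset),
      integral_indicator_const _ hset]
    have := hN.real_one_le_sub hlam hs hst
    simp only [integral_const, probReal_univ, smul_eq_mul, one_mul]
    linarith

/-- First-order expansion in `t - s`. On `N(t) = n + 1` there were `n + 1` jumps already at time
`s`, or `n` and one more since, or fewer; independence of the increment from the past evaluates the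
first two contributions. -/
theorem IsPoissonProcess.norm_jumpExpectation_succ_sub_le (hN : IsPoissonProcess N lam P)
    (hlam : IsRate lam) (hy : ∀ n, |y n| ≤ C) (hg : Continuous g) (hg1 : ∀ x, ‖g x‖ ≤ 1)
    (hK : ∀ x x', ‖g x - g x'‖ ≤ K * |x - x'|) (T : ℝ) (n : ℕ) {s t : ℝ} (hs : 0 ≤ s)
    (hst : s ≤ t) :
    ‖jumpExpectation P N y g (y (n + 1)) T (n + 1) t
        - jumpExpectation P N y g (y (n + 1)) T (n + 1) s *
          (Real.exp (-(cumRate lam t - cumRate lam s)) : ℝ)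
        - jumpExpectation P N y g (y (n + 1)) T n s *
          (Real.exp (-(cumRate lam t - cumRate lam s)) * (cumRate lam t - cumRate lam s) : ℝ)‖ ≤
      2 * K * C * (t - s) * (cumRate lam t - cumRate lam s)
        + (cumRate lam t - cumRate lam s) ^ 2 := by
  have hK0 : 0 ≤ K := by
    have := hK 1 0
    simp only [sub_zero, abs_one, mul_one] at this
    exact (norm_nonneg _).trans this
  have hC0 : 0 ≤ C := (abs_nonneg _).trans (hy 0)
  have hδ := sub_nonneg.2 (hlam.cumRate_mono hs hst)
  have hts := sub_nonneg.2 hst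
  have hmΔ : Measurable fun ω => N t.toNNReal ω - N s.toNNReal ω :=
    (hN.measurable _).sub (hN.measurable _)
  have hset1 : MeasurableSet {ω | 1 ≤ N t.toNNReal ω - N s.toNNReal ω} :=
    hmΔ (measurableSet_Ici (a := 1))
  have hset2 : MeasurableSet {ω | 2 ≤ N t.toNNReal ω - N s.toNNReal ω} :=
    hmΔ (measurableSet_Ici (a := 2))
  set z := y (n + 1) with hz
  have p0 := hN.real_sub_eq hlam hs hst 0
  have p1 := hN.real_sub_eq hlam hs hst 1
  simp only [pow_zero, mul_one, Nat.factorial_zero, Nat.cast_one, div_one, pow_one,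
    Nat.factorial_one] at p0 p1
  have i0 := hN.integral_ite_mul (y := y) hg hs hst (z * (T - s)) (n + 1) 0
  have i1 := hN.integral_ite_mul (y := y) hg hs hst (z * (T - s)) n 1
  rw [p0] at i0
  rw [p1] at i1
  rw [jumpExpectation, jumpExpectation, jumpExpectation, ← i0, ← i1]
  have hind : ∀ m k, Integrable (fun ω => (if N s.toNNReal ω = m then
      g (pathIntegral N y s ω + z * (T - s)) else 0) *
        (if N t.toNNReal ω - N s.toNNReal ω = k then (1 : ℂ) else 0)) P := by
    intro m k
    refine (hN.integrable_ite hg hg1 hs _ _).mul_bdd (c := 1)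
      (measurable_ite_eq_nat hmΔ k measurable_const).aestronglyMeasurable
      (Eventually.of_forall fun ω => ?_)
    split_ifs <;> simp
  have i2 := hN.integrable_ite (y := y) hg hg1 (hs.trans hst) (z * (T - t)) (n + 1)
  rw [← integral_sub i2 (hind _ _), ← integral_sub (by exact i2.sub (hind _ _)) (hind _ _)]
  have hb : Integrable (fun ω => {ω | 1 ≤ N t.toNNReal ω - N s.toNNReal ω}.indicator
      (fun _ => 2 * K * C * (t - s)) ω + {ω | 2 ≤ N t.toNNReal ω - N s.toNNReal ω}.indicator
      (fun _ => (1 : ℝ)) ω) P :=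
    ((integrable_const _).indicator hset1).add ((integrable_const _).indicator hset2)
  refine (norm_integral_le_of_norm_le hb (Eventually.of_forall fun ω => ?_)).trans ?_
  · have hle := hN.mono ω (Real.toNNReal_le_toNNReal hst)
    simp only at hle
    have hpos : 0 ≤ 2 * K * C * (t - s) := by positivity
    have hclose : ‖g (pathIntegral N y t ω + z * (T - t)) - g (pathIntegral N y s ω + z * (T - s))‖
        ≤ 2 * K * C * (t - s) := by
      refine (hK _ _).trans ?_
      rw [mul_comm 2 K, mul_assoc, mul_assoc]
      refine mul_le_mul_of_nonneg_left ?_ hK0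
      have e : pathIntegral N y t ω + z * (T - t) - (pathIntegral N y s ω + z * (T - s)) =
        (pathIntegral N y t ω - pathIntegral N y s ω) - z * (t - s) := by ring
      rw [e]
      refine (abs_sub _ _).trans ?_
      have h1 := abs_pathIntegral_sub_le hN.mono hy ω s t
      rw [abs_of_nonneg hts] at h1
      rw [abs_mul, abs_of_nonneg hts]
      have h2 : |z| * (t - s) ≤ C * (t - s) := mul_le_mul_of_nonneg_right (hy _) hts
      linarith
    -- No jump: the integrand vanishes, because `z` is the velocity after `n + 1` jumps and `W(s) +
    -- z (T - s)` stays constant. One jump: the positions differ by `O(t - s)`. Two or more: the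
    -- trivial bound `1`.
    rcases Nat.lt_or_ge (N t.toNNReal ω - N s.toNNReal ω) 2 with h2 | h2
    · rw [indicator_of_notMem (show ω ∉ {ω | 2 ≤ N t.toNNReal ω - N s.toNNReal ω} from
        not_le.2 h2), add_zero]
      rcases Nat.lt_or_ge (N t.toNNReal ω - N s.toNNReal ω) 1 with h1 | h1
      · rw [indicator_of_notMem (show ω ∉ {ω | 1 ≤ N t.toNNReal ω - N s.toNNReal ω} from
          not_le.2 h1)]
        have e : N t.toNNReal ω = N s.toNNReal ω := by omega
        rw [e]
        by_cases h : N s.toNNReal ω = n + 1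
        · have h3 := pathIntegral_sub_of_eq hN.mono hy hst h (e.trans h)
          have h4 : pathIntegral N y t ω + z * (T - t) = pathIntegral N y s ω + z * (T - s) := by
            rw [hz]
            linarith
          simp [h, h4]
        · simp [h]
      · rw [indicator_of_mem (show ω ∈ {ω | 1 ≤ N t.toNNReal ω - N s.toNNReal ω} from h1)]
        have e : N t.toNNReal ω - N s.toNNReal ω = 1 := by omega
        rw [e]
        by_cases h : N s.toNNReal ω = n
        · have h3 : N t.toNNReal ω = n + 1 := by omega
          simpa [h, h3] using hclose
        · have h3 : N t.toNNReal ω ≠ n + 1 := by omega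
          simpa [h, h3] using hpos
    · have h1 : 1 ≤ N t.toNNReal ω - N s.toNNReal ω := by omega
      rw [indicator_of_mem (show ω ∈ {ω | 1 ≤ N t.toNNReal ω - N s.toNNReal ω} from h1),
        indicator_of_mem (show ω ∈ {ω | 2 ≤ N t.toNNReal ω - N s.toNNReal ω} from h2)]
      have e0 : N t.toNNReal ω - N s.toNNReal ω ≠ 0 := by omega
      have e1 : N t.toNNReal ω - N s.toNNReal ω ≠ 1 := by omega
      rw [if_neg e0, if_neg e1, mul_zero, mul_zero, sub_zero, sub_zero]
      split_ifs
      · linarith [hg1 (pathIntegral N y t ω + z * (T - t))]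
      · rw [norm_zero]
        linarith
  · rw [integral_add ((integrable_const _).indicator hset1)
      ((integrable_const _).indicator hset2), integral_indicator_const _ hset1,
      integral_indicator_const _ hset2]
    have q1 := hN.real_one_le_sub hlam hs hst
    have q2 := hN.real_two_le_sub hlam hs hst
    simp only [smul_eq_mul, mul_one]
    refine add_le_add ?_ q2
    rw [mul_comm]
    exact mul_le_mul_of_nonneg_left q1 (by positivity)

end Expectation

/-! ### The integral equation over the number of jumps -/

section IntegralEquation

variable {Ω : Type*} [MeasurableSpace Ω] {P : Measure Ω} [IsProbabilityMeasure P]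
  {N : ℝ≥0 → Ω → ℕ} {lam : ℝ → ℝ} {y : ℕ → ℝ} {C K : ℝ} {g : ℝ → ℂ}

theorem IsPoissonProcess.continuousOn_jumpExpectation (hN : IsPoissonProcess N lam P)
    (hlam : IsRate lam) (hy : ∀ n, |y n| ≤ C) (hg : Continuous g) (hg1 : ∀ x, ‖g x‖ ≤ 1)
    (hK : ∀ x x', ‖g x - g x'‖ ≤ K * |x - x'|) (z : ℝ) {T : ℝ} (hT : 0 ≤ T) (n : ℕ) :
    ContinuousOn (jumpExpectation P N y g z T n) (Icc 0 T) := by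
  have hb : ∀ s ∈ Icc 0 T, ∀ t ∈ Icc 0 T,
      ‖jumpExpectation P N y g z T n t - jumpExpectation P N y g z T n s‖ ≤
      K * (C + |z|) * |t - s| + 2 * |cumRate lam t - cumRate lam s| := by
    intro s hs t ht
    rcases le_total s t with h | h
    · rw [abs_of_nonneg (sub_nonneg.2 h), abs_of_nonneg (sub_nonneg.2 (hlam.cumRate_mono hs.1 h))]
      exact hN.norm_jumpExpectation_sub_le hlam hy hg hg1 hK z T n hs.1 h
    · rw [abs_sub_comm, abs_sub_comm (cumRate lam t), norm_sub_rev,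
        abs_of_nonneg (sub_nonneg.2 h), abs_of_nonneg (sub_nonneg.2 (hlam.cumRate_mono ht.1 h))]
      exact hN.norm_jumpExpectation_sub_le hlam hy hg hg1 hK z T n ht.1 h
  intro s hs
  rw [ContinuousWithinAt, tendsto_iff_norm_sub_tendsto_zero]
  have hc : Tendsto (fun t => K * (C + |z|) * |t - s| + 2 * |cumRate lam t - cumRate lam s|)
      (𝓝[Icc 0 T] s) (𝓝 0) := by
    have : ContinuousWithinAt (fun t => K * (C + |z|) * |t - s|
        + 2 * |cumRate lam t - cumRate lam s|) (Icc 0 T) s :=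
      (continuousWithinAt_const.mul (continuousWithinAt_id.sub continuousWithinAt_const).abs).add
        (continuousWithinAt_const.mul
          ((hlam.continuousOn_cumRate T hT s hs).sub continuousWithinAt_const).abs)
    simpa [ContinuousWithinAt] using this
  refine squeeze_zero' (Eventually.of_forall fun _ => norm_nonneg _) ?_ hc
  filter_upwards [self_mem_nhdsWithin] with t ht using hb s hs t ht

/-- The factor `e^Λ` cancels the loss from `N = n + 1`, so only the gain from `N = n` contributes.
The expansion starts from the earlier time, so the derivative is one-sided. -/
theorem IsPoissonProcess.hasDerivWithinAt_exp_mul_jumpExpectation (hN : IsPoissonProcess N lam P)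
    (hlam : IsRate lam) (hy : ∀ n, |y n| ≤ C) (hg : Continuous g) (hg1 : ∀ x, ‖g x‖ ≤ 1)
    (hK : ∀ x x', ‖g x - g x'‖ ≤ K * |x - x'|) (T : ℝ) (n : ℕ) {s : ℝ} (hs : 0 < s)
    (hsT : s < T) :
    HasDerivWithinAt
      (fun t => (Real.exp (cumRate lam t) : ℂ) * jumpExpectation P N y g (y (n + 1)) T (n + 1) t)
      ((lam s * Real.exp (cumRate lam s) : ℝ) * jumpExpectation P N y g (y (n + 1)) T n s)
      (Ioi s) s := by
  set J₁ := jumpExpectation P N y g (y (n + 1)) T (n + 1)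
  set J₀ := jumpExpectation P N y g (y (n + 1)) T n
  let Λ := cumRate lam
  -- `A` is the principal part of the increment and `R` the remainder, bounded by a function `ρ`
  -- with zero value and zero derivative at `s`.
  let A : ℝ → ℂ := fun t => (Real.exp (Λ s) * (Λ t - Λ s) : ℝ) * J₀ s
  let R : ℝ → ℂ := fun t => Real.exp (Λ t) * J₁ t - Real.exp (Λ s) * J₁ s - A t
  have hΛ := hlam.hasDerivAt_cumRate hs
  have hA : HasDerivWithinAt A ((lam s * Real.exp (Λ s) : ℝ) * J₀ s) (Ioi s) s := by
    have := (((hΛ.sub_const (Λ s)).const_mul (Real.exp (Λ s))).ofReal_comp.mul_const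
      (J₀ s)).hasDerivWithinAt (s := Ioi s)
    rwa [mul_comm (Real.exp (Λ s)) (lam s)] at this
  let ρ : ℝ → ℝ := fun t =>
    Real.exp (Λ T) * (2 * K * C * (t - s) * (Λ t - Λ s) + (Λ t - Λ s) ^ 2)
  have hρ : HasDerivAt ρ 0 s := by
    have h1 := (((hasDerivAt_id s).sub_const s).const_mul (2 * K * C)).mul (hΛ.sub_const (Λ s))
    have h2 := (hΛ.sub_const (Λ s)).pow 2
    refine ((h1.add h2).const_mul (Real.exp (Λ T))).congr_deriv ?_
    simp [Λ]
  have hRρ : ∀ᶠ t in 𝓝[>] s, ‖R t‖ ≤ 1 * ‖ρ t - ρ s - (t - s) • (0 : ℝ)‖ := by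
    filter_upwards [Ioo_mem_nhdsGT hsT] with t ht
    have h := hN.norm_jumpExpectation_succ_sub_le hlam hy hg hg1 hK T n hs.le ht.1.le
    have e : R t = Real.exp (Λ t) * (J₁ t - J₁ s * (Real.exp (-(Λ t - Λ s)) : ℝ)
        - J₀ s * (Real.exp (-(Λ t - Λ s)) * (Λ t - Λ s) : ℝ)) := by
      have e1 : Real.exp (Λ s) = Real.exp (Λ t) * Real.exp (-(Λ t - Λ s)) := by
        rw [← Real.exp_add]
        congr 1
        ring
      simp only [R, A]
      rw [e1]
      push_cast
      ring
    have hmono : Real.exp (Λ t) ≤ Real.exp (Λ T) :=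
      Real.exp_le_exp.2 (hlam.cumRate_mono (hs.trans ht.1).le ht.2.le)
    have e2 : ρ s = 0 := by simp [ρ]
    rw [e, norm_mul, Complex.norm_of_nonneg (Real.exp_pos _).le, one_mul, e2, sub_zero, smul_zero,
      sub_zero]
    refine le_trans ?_ (le_abs_self _)
    exact mul_le_mul hmono h (norm_nonneg _) (Real.exp_pos _).le
  have hR : HasDerivWithinAt R 0 (Ioi s) s := by
    rw [hasDerivWithinAt_iff_isLittleO]
    have hR0 : R s = 0 := by simp [R, A]
    simp only [hR0, sub_zero, smul_zero]
    refine (Asymptotics.IsBigO.of_bound 1 hRρ).trans_isLittleO ?_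
    exact hasDerivWithinAt_iff_isLittleO.1 hρ.hasDerivWithinAt
  have := ((hR.add hA).const_add (Real.exp (Λ s) * J₁ s))
  rw [zero_add] at this
  refine this.congr (fun t _ => ?_) ?_ <;> simp only [R, Λ, Pi.add_apply] <;> ring

/-- Continuity and an integrable right derivative suffice for the fundamental theorem of calculus.
At the endpoint `T` the frozen displacement is zero. -/
theorem IsPoissonProcess.exp_mul_jumpExpectation_succ (hN : IsPoissonProcess N lam P)
    (hlam : IsRate lam) (hy : ∀ n, |y n| ≤ C) (hg : Continuous g) (hg1 : ∀ x, ‖g x‖ ≤ 1)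
    (hK : ∀ x x', ‖g x - g x'‖ ≤ K * |x - x'|) {T : ℝ} (hT : 0 < T) (n : ℕ) :
    (Real.exp (cumRate lam T) : ℂ) * jumpExpectation P N y g (y (n + 1)) T (n + 1) T =
      ∫ s in (0 : ℝ)..T, (lam s * Real.exp (cumRate lam s) : ℝ) *
        jumpExpectation P N y g (y (n + 1)) T n s := by
  have hΛ : ContinuousOn (fun t => (Real.exp (cumRate lam t) : ℂ)) (Icc 0 T) :=
    Complex.continuous_ofReal.comp_continuousOn
      (Real.continuous_exp.comp_continuousOn (hlam.continuousOn_cumRate T hT.le))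
  have hi : IntervalIntegrable (fun s => (lam s * Real.exp (cumRate lam s) : ℝ) *
      jumpExpectation P N y g (y (n + 1)) T n s) volume 0 T := by
    have h0 := hlam.intervalIntegrable le_rfl hT.le
    have h1 : IntervalIntegrable (fun s => (lam s : ℂ)) volume 0 T :=
      ⟨Integrable.ofReal h0.1, Integrable.ofReal h0.2⟩
    have h2 : ContinuousOn (fun s => (Real.exp (cumRate lam s) : ℂ) *
        jumpExpectation P N y g (y (n + 1)) T n s) (uIcc 0 T) := by
      rw [uIcc_of_le hT.le]
      exact hΛ.mul (hN.continuousOn_jumpExpectation hlam hy hg hg1 hK _ hT.le n)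
    refine (h1.mul_continuousOn h2).congr fun s _ => ?_
    push_cast
    ring
  have h := intervalIntegral.integral_eq_sub_of_hasDeriv_right_of_le hT.le
    (hΛ.mul (hN.continuousOn_jumpExpectation hlam hy hg hg1 hK (y (n + 1)) hT.le (n + 1)))
    (fun s hs => hN.hasDerivWithinAt_exp_mul_jumpExpectation hlam hy hg hg1 hK T n hs.1 hs.2) hi
  rw [h]
  -- The boundary term at `0` vanishes, because the process starts at `0 ≠ n + 1`.
  simp [jumpExpectation, hN.zero]

end IntegralEquation

/-! ### Recursion for the law of the position -/

section LawRecursion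

variable {Ω : Type*} [MeasurableSpace Ω] {P : Measure Ω} {N : ℝ≥0 → Ω → ℕ} {lam : ℝ → ℝ}
  {y : ℕ → ℝ} {C : ℝ}

theorem norm_exp_mul_I_sub_le (ξ x x' : ℝ) :
    ‖Complex.exp (ξ * x * Complex.I) - Complex.exp (ξ * x' * Complex.I)‖ ≤ |ξ| * |x - x'| := by
  have e : Complex.exp (ξ * x * Complex.I) - Complex.exp (ξ * x' * Complex.I) =
      Complex.exp ((ξ * x' : ℝ) * Complex.I) *
        (Complex.exp (Complex.I * (ξ * (x - x') : ℝ)) - 1) := by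
    rw [mul_sub, ← Complex.exp_add, mul_one]
    push_cast
    congr 2
    ring
  rw [e, norm_mul, Complex.norm_exp_ofReal_mul_I, one_mul, ← abs_mul]
  exact Real.norm_exp_I_mul_ofReal_sub_one_le

theorem IsPoissonProcess.measurable_uncurry (hN : IsPoissonProcess N lam P) :
    Measurable fun p : ℝ × Ω => N p.1.toNNReal p.2 := by
  refine measurable_of_tendsto_metrizable (f := fun (k : ℕ) (p : ℝ × Ω) =>
    N (min p.1.toNNReal k) p.2) (fun k => measurable_uncurry_min_of_rightCont hN.rightCont k
      fun s _ => hN.measurable s) (tendsto_pi_nhds.2 fun p => ?_)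
  obtain ⟨m, hm⟩ := exists_nat_ge p.1.toNNReal
  refine tendsto_const_nhds.congr' ?_
  filter_upwards [eventually_ge_atTop m] with k hk
  rw [min_eq_left (hm.trans (by exact_mod_cast hk))]

theorem IsPoissonProcess.measurable_pathIntegral_uncurry (hN : IsPoissonProcess N lam P)
    (hy : ∀ n, |y n| ≤ C) : Measurable fun p : ℝ × Ω => pathIntegral N y p.1 p.2 := by
  refine measurable_uncurry_of_continuous_of_measurable (u := fun t ω => pathIntegral N y t ω)
    (fun ω => continuous_pathIntegral hN.mono hy ω) fun t => ?_
  rcases le_total 0 t with ht | ht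
  · exact hN.measurable_pathIntegral y ht
  · have e : (fun ω => pathIntegral N y t ω) = fun _ => ∫ _ in (0 : ℝ)..t, y 0 := by
      funext ω
      refine intervalIntegral.integral_congr fun r hr => ?_
      rw [uIcc_of_ge ht] at hr
      rw [Real.toNNReal_of_nonpos hr.2, hN.zero]
    rw [e]
    exact measurable_const

theorem measurable_rateENN_of_continuousOn {ρ : ℝ → ℝ} (hρ : ContinuousOn ρ (Ioi 0)) :
    Measurable (rateENN ρ) := by
  classical
  have := hρ.measurable_piecewise (g := fun _ => (0 : ℝ)) continuousOn_const measurableSet_Ioi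
  rw [show (fun _ : ℝ => (0 : ℝ)) = 0 from rfl, piecewise_eq_indicator] at this
  exact this.ennreal_ofReal

theorem IsRate.continuousOn_mul_exp (h : IsRate lam) :
    ContinuousOn (fun s => lam s * Real.exp (cumRate lam s)) (Ioi 0) :=
  h.continuousOn.mul (Real.continuous_exp.comp_continuousOn h.contDiffOn_cumRate.continuousOn)

/-- The law of the position at time `t` on the event of `n` jumps, times `exp Λ(t)`. -/
noncomputable def jumpLaw (P : Measure Ω) (N : ℝ≥0 → Ω → ℕ) (lam : ℝ → ℝ) (y : ℕ → ℝ) (n : ℕ)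
    (t : ℝ) (A : Set ℝ) : ℝ≥0∞ :=
  ENNReal.ofReal (Real.exp (cumRate lam t)) *
    P {ω | pathIntegral N y t ω ∈ A ∧ N t.toNNReal ω = n}

variable [IsProbabilityMeasure P]

theorem IsPoissonProcess.jumpLaw_zero (hN : IsPoissonProcess N lam P) (hlam : IsRate lam)
    (hy : ∀ n, |y n| ≤ C) {t : ℝ} (ht : 0 ≤ t) (A : Set ℝ) :
    jumpLaw P N lam y 0 t A = A.indicator (fun _ => 1) (y 0 * t) := by
  have hp : P {ω | N t.toNNReal ω = 0} = ENNReal.ofReal (Real.exp (-cumRate lam t)) := by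
    have h := hN.real_sub_eq hlam le_rfl ht 0
    simp only [Real.toNNReal_zero, hN.zero, cumRate_zero, Nat.sub_zero, sub_zero, pow_zero, mul_one,
      Nat.factorial_zero, Nat.cast_one, div_one] at h
    rw [← h, measureReal_def, ENNReal.ofReal_toReal (measure_ne_top _ _)]
  have hW : ∀ ω, N t.toNNReal ω = 0 → pathIntegral N y t ω = y 0 * t := by
    intro ω hω
    have h := pathIntegral_sub_of_eq hN.mono hy ht (n := 0) (ω := ω) (by simp [hN.zero]) hω
    simpa [pathIntegral] using h
  by_cases hA : y 0 * t ∈ A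
  · have e : {ω | pathIntegral N y t ω ∈ A ∧ N t.toNNReal ω = 0} = {ω | N t.toNNReal ω = 0} := by
      ext ω
      exact ⟨fun h => h.2, fun h => ⟨by rw [hW ω h]; exact hA, h⟩⟩
    rw [jumpLaw, e, hp, indicator_of_mem hA, ← ENNReal.ofReal_mul (Real.exp_pos _).le,
      ← Real.exp_add]
    simp
  · have e : {ω | pathIntegral N y t ω ∈ A ∧ N t.toNNReal ω = 0} = ∅ := by
      ext ω
      simp only [mem_ofPred_eq, mem_empty_iff_false, iff_false, not_and]
      exact fun h1 h2 => hA (by rwa [← hW ω h2])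
    rw [jumpLaw, e, indicator_of_notMem hA, measure_empty, mul_zero]

/-- Both sides are finite measures in `A`: an image of `P` on `N(T) = n + 1`, and an image of `λ e^Λ
ds ⊗ P` on `N(s) = n`. Their characteristic functions agree by the integral equation for `g(x) =
e^{iξx}`. -/
theorem IsPoissonProcess.jumpLaw_succ (hN : IsPoissonProcess N lam P) (hlam : IsRate lam)
    (hy : ∀ n, |y n| ≤ C) (n : ℕ) {T : ℝ} (hT : 0 < T) {A : Set ℝ} (hA : MeasurableSet A) :
    jumpLaw P N lam y (n + 1) T A = ∫⁻ s in Ioo 0 T,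
      rateENN lam s * jumpLaw P N lam y n s {x | x + y (n + 1) * (T - s) ∈ A} := by
  set z := y (n + 1) with hz
  let κ : ℝ → ℝ≥0∞ := rateENN fun s => lam s * Real.exp (cumRate lam s)
  have hκ : Measurable κ := measurable_rateENN_of_continuousOn hlam.continuousOn_mul_exp
  have hκ' : ∀ s ∈ Ioo 0 T, κ s = rateENN lam s * ENNReal.ofReal (Real.exp (cumRate lam s)) := by
    intro s hs
    simp only [κ]
    rw [rateENN_of_pos hs.1, rateENN_of_pos hs.1, ENNReal.ofReal_mul (hlam.nonneg s hs.1)]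
  let ρ : Measure ℝ := (volume.restrict (Ioo 0 T)).withDensity κ
  have hρ : IsFiniteMeasure ρ := by
    refine isFiniteMeasure_withDensity ?_
    have hle : ∫⁻ s in Ioo 0 T, κ s ≤ ∫⁻ s in Ioo 0 T,
        ENNReal.ofReal (Real.exp (cumRate lam T)) * rateENN lam s := by
      refine setLIntegral_mono' measurableSet_Ioo fun s hs => ?_
      rw [hκ' s hs, mul_comm]
      gcongr
      exact hlam.cumRate_mono hs.1.le hs.2.le
    refine (hle.trans_lt ?_).ne
    rw [lintegral_const_mul _ hlam.measurable_rateENN]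
    have h0 := hlam.lintegral_rateENN 0 hT.le
    simp only [pow_zero, Nat.factorial_zero, Nat.cast_one, div_one, ENNReal.ofReal_one,
      mul_one] at h0
    rw [h0]
    exact ENNReal.mul_lt_top ENNReal.ofReal_lt_top ENNReal.ofReal_lt_top
  have hmN := hN.measurable_uncurry
  have hmW := hN.measurable_pathIntegral_uncurry hy
  let E : Set (ℝ × Ω) := {p | N p.1.toNNReal p.2 = n}
  have hE : MeasurableSet E := hmN (MeasurableSet.singleton n)
  let Z : ℝ × Ω → ℝ := fun p => pathIntegral N y p.1 p.2 + z * (T - p.1)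
  have hZ : Measurable Z := hmW.add (measurable_const.mul (measurable_const.sub measurable_fst))
  have hWT := hN.measurable_pathIntegral y hT.le
  let E₁ : Set Ω := {ω | N T.toNNReal ω = n + 1}
  have hE₁ : MeasurableSet E₁ := hN.measurable _ (MeasurableSet.singleton (n + 1))
  let ν₁ : Measure ℝ := ENNReal.ofReal (Real.exp (cumRate lam T)) •
    (P.restrict E₁).map (pathIntegral N y T)
  let ν₂ : Measure ℝ := ((ρ.prod P).restrict E).map Z
  have : IsFiniteMeasure ν₁ := Measure.smul_finite _ ENNReal.ofReal_ne_top
  have hν : ν₁ = ν₂ := by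
    refine Measure.ext_of_charFun (funext fun ξ => ?_)
    let g : ℝ → ℂ := fun x => Complex.exp (ξ * x * Complex.I)
    have hg : Continuous g := by fun_prop
    have hg1 : ∀ x, ‖g x‖ ≤ 1 := by
      intro x
      simp only [g]
      rw [← Complex.ofReal_mul, Complex.norm_exp_ofReal_mul_I]
    have hgK : ∀ x x', ‖g x - g x'‖ ≤ |ξ| * |x - x'| := norm_exp_mul_I_sub_le ξ
    have hrec := hN.exp_mul_jumpExpectation_succ hlam hy hg hg1 hgK hT n
    rw [← hz] at hrec
    have h1 : charFun ν₁ ξ = (Real.exp (cumRate lam T) : ℂ) *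
        jumpExpectation P N y g z T (n + 1) T := by
      rw [charFun_apply_real, integral_smul_measure, integral_map hWT.aemeasurable
        hg.aestronglyMeasurable, ENNReal.toReal_ofReal (Real.exp_pos _).le,
        ← integral_indicator hE₁, jumpExpectation, Complex.real_smul]
      congr 1
      refine integral_congr_ae (Eventually.of_forall fun ω => ?_)
      simp only [indicator, E₁, mem_ofPred_eq, sub_self, mul_zero, add_zero]
    have h2 : charFun ν₂ ξ = ∫ s in (0 : ℝ)..T, (lam s * Real.exp (cumRate lam s) : ℝ) *
        jumpExpectation P N y g z T n s := by
      have hgZ : Integrable (E.indicator fun p => g (Z p)) (ρ.prod P) := by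
        refine Integrable.of_bound (C := 1) ((hg.measurable.comp hZ).indicator
          hE).aestronglyMeasurable (Eventually.of_forall fun p => ?_)
        exact (norm_indicator_le_norm_self _ _).trans (hg1 _)
      rw [charFun_apply_real, integral_map hZ.aemeasurable hg.aestronglyMeasurable,
        ← integral_indicator hE, integral_prod _ hgZ,
        integral_withDensity_eq_integral_toReal_smul hκ
          (Eventually.of_forall fun s => ENNReal.ofReal_lt_top),
        intervalIntegral.integral_of_le hT.le, integral_Ioc_eq_integral_Ioo]
      refine setIntegral_congr_fun measurableSet_Ioo fun s hs => ?_
      have e : (κ s).toReal = lam s * Real.exp (cumRate lam s) := by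
        simp only [κ]
        rw [rateENN_of_pos hs.1, ENNReal.toReal_ofReal
          (mul_nonneg (hlam.nonneg s hs.1) (Real.exp_pos _).le)]
      simp only [e, Complex.real_smul]
      congr 1
      refine integral_congr_ae (Eventually.of_forall fun ω => ?_)
      simp only [indicator, E, mem_ofPred_eq, g, Z]
    rw [h1, h2, hrec]
  have hA1 : ν₁ A = jumpLaw P N lam y (n + 1) T A := by
    simp only [ν₁, Measure.smul_apply, smul_eq_mul, jumpLaw]
    rw [Measure.map_apply hWT hA, Measure.restrict_apply (hWT hA)]
    rfl
  rw [← hA1, hν]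
  simp only [ν₂]
  rw [Measure.map_apply hZ hA, Measure.restrict_apply (hZ hA),
    Measure.prod_apply ((hZ hA).inter hE), lintegral_withDensity_eq_lintegral_mul _ hκ
      (measurable_measure_prodMk_left ((hZ hA).inter hE))]
  refine setLIntegral_congr_fun measurableSet_Ioo fun s hs => ?_
  simp only [Pi.mul_apply, jumpLaw]
  rw [hκ' s hs, mul_assoc]
  rfl

end LawRecursion

/-! ### The law of the alternating motion, and absence of atoms -/

section AlternatingLaw

variable {Ω : Type*} {N : ℝ≥0 → Ω → ℕ} {lam : ℝ → ℝ} {y : ℕ → ℝ} {C : ℝ}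

theorem pathIntegral_eq_of_forall_eq (hm : ∀ ω, Monotone fun t => N t ω) {t : ℝ} (ht : 0 ≤ t)
    {ω : Ω} {n : ℕ} (hω : N t.toNNReal ω = n) {v : ℝ} (hv : ∀ i ≤ n, y i = v) :
    pathIntegral N y t ω = v * t := by
  have e : pathIntegral N y t ω = ∫ _ in (0 : ℝ)..t, v := by
    refine intervalIntegral.integral_congr fun r hr => ?_
    rw [uIcc_of_le ht] at hr
    have h := hm ω (Real.toNNReal_le_toNNReal hr.2)
    exact hv _ (h.trans_eq hω)
  rw [e, intervalIntegral.integral_const, smul_eq_mul, sub_zero, mul_comm]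

variable [MeasurableSpace Ω] {P : Measure Ω}

theorem measure_eq_exp_mul_jumpLaw (n : ℕ) (t : ℝ) (A : Set ℝ) :
    P {ω | pathIntegral N y t ω ∈ A ∧ N t.toNNReal ω = n} =
      ENNReal.ofReal (Real.exp (-cumRate lam t)) * jumpLaw P N lam y n t A := by
  rw [jumpLaw, ← mul_assoc, ← ENNReal.ofReal_mul (Real.exp_pos _).le, ← Real.exp_add]
  simp

variable [IsProbabilityMeasure P]

theorem abs_neg_one_pow_le (n : ℕ) : |((-1 : ℝ)) ^ n| ≤ 1 := by simp

/-- Law and kernel obey the same recursion at the last jump. The sign appears because the kernel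
measures positions along the current direction, which after `n + 1` jumps is `(-1)^(n+1)` times the
initial one. -/
theorem IsPoissonProcess.jumpLaw_alternating (hN : IsPoissonProcess N lam P) (hlam : IsRate lam)
    (n : ℕ) {t : ℝ} (ht : 0 < t) {A : Set ℝ} (hA : MeasurableSet A) :
    jumpLaw P N lam (fun n => (-1) ^ n) (n + 1) t A =
      altIntegral (rateENN lam) n t fun x => A.indicator (fun _ => 1) ((-1) ^ (n + 1) * x) := by
  induction n generalizing t A with
  | zero =>
    rw [hN.jumpLaw_succ hlam abs_neg_one_pow_le 0 ht hA, altIntegral]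
    refine setLIntegral_congr_fun measurableSet_Ioo fun s hs => ?_
    rw [hN.jumpLaw_zero hlam abs_neg_one_pow_le hs.1.le, mul_comm]
    simp only [altKernel, indicator, mem_ofPred_eq]
    congr 3
    ring
  | succ n ih =>
    have hψ : Measurable fun x : ℝ => A.indicator (fun _ => (1 : ℝ≥0∞)) ((-1) ^ (n + 1 + 1) * x) :=
      (measurable_const.indicator hA).comp (measurable_const.mul measurable_id)
    rw [hN.jumpLaw_succ hlam abs_neg_one_pow_le (n + 1) ht hA,
      altIntegral_succ hlam.measurable_rateENN n t hψ]
    refine setLIntegral_congr_fun measurableSet_Ioo fun s hs => ?_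
    rw [ih hs.1 (by exact (measurable_id.add_const _) hA)]
    congr 2
    funext x
    simp only [indicator, mem_ofPred_eq]
    congr 2
    ring

theorem IsPoissonProcess.jumpLaw_singleton (hN : IsPoissonProcess N lam P) (hlam : IsRate lam)
    (hy : ∀ n, |y n| ≤ C) {n : ℕ} (hn : ∃ i ≤ n, y i ≠ y 0) {t : ℝ} (ht : 0 < t) (x : ℝ) :
    jumpLaw P N lam y n t {x} = 0 := by
  induction n generalizing t x with
  | zero =>
    obtain ⟨i, hi, h⟩ := hn
    obtain rfl : i = 0 := by omega
    exact absurd rfl h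
  | succ n ih =>
    rw [hN.jumpLaw_succ hlam hy n ht (MeasurableSet.singleton x)]
    have e : ∀ s, {x' | x' + y (n + 1) * (t - s) ∈ ({x} : Set ℝ)} =
        {x - y (n + 1) * (t - s)} := by
      intro s
      ext x'
      simp only [mem_ofPred_eq, mem_singleton_iff]
      exact eq_sub_iff_add_eq.symm
    simp only [e]
    -- Either the velocities differ already before the last jump and the induction hypothesis
    -- applies, or only the last velocity differs.
    by_cases h : ∃ i ≤ n, y i ≠ y 0
    · rw [setLIntegral_congr_fun (g := fun _ => 0) measurableSet_Ioo fun s hs => ?_]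
      · simp
      · simp only
        rw [ih h hs.1, mul_zero]
    · push Not at h
      obtain ⟨i, hi, hi'⟩ := hn
      obtain rfl : i = n + 1 := by
        by_contra hne
        exact hi' (h i (by omega))
      -- With constant velocity up to the last jump at `s`, the position there is `y 0 * s`; a
      -- single value of `s` leads to `x`.
      have hne : ∀ᵐ s ∂(volume.restrict (Ioo 0 t)), s ≠ (x - y (n + 1) * t) / (y 0 - y (n + 1)) :=
        ae_restrict_of_ae (Measure.ae_ne volume _)
      rw [lintegral_congr_ae (g := fun _ => 0) ?_]
      · simp
      · filter_upwards [hne, ae_restrict_mem measurableSet_Ioo] with s hs hs'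
        have hemp : {ω | pathIntegral N y s ω ∈ ({x - y (n + 1) * (t - s)} : Set ℝ) ∧
            N s.toNNReal ω = n} = ∅ := by
          ext ω
          simp only [mem_ofPred_eq, mem_singleton_iff, mem_empty_iff_false, iff_false, not_and]
          intro h1 h2
          rw [pathIntegral_eq_of_forall_eq hN.mono hs'.1.le h2 h] at h1
          refine hs ?_
          rw [eq_div_iff (sub_ne_zero.2 (Ne.symm hi'))]
          linarith
        rw [jumpLaw, hemp, measure_empty, mul_zero, mul_zero]

theorem IsPoissonProcess.measure_pathIntegral_eq_zero (hN : IsPoissonProcess N lam P)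
    (hlam : IsRate lam) (hy : ∀ n, |y n| ≤ C) {n : ℕ} (hn : ∃ i ≤ n, y i ≠ 0) {t : ℝ}
    (ht : 0 < t) : P {ω | pathIntegral N y t ω = 0 ∧ N t.toNNReal ω = n} = 0 := by
  by_cases h : ∃ i ≤ n, y i ≠ y 0
  · have e := measure_eq_exp_mul_jumpLaw (P := P) (N := N) (lam := lam) (y := y) n t {0}
    rw [hN.jumpLaw_singleton hlam hy h ht, mul_zero] at e
    exact e
  · push Not at h
    obtain ⟨i, hi, hi'⟩ := hn
    rw [h i hi] at hi'
    have e : {ω | pathIntegral N y t ω = 0 ∧ N t.toNNReal ω = n} = ∅ := by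
      ext ω
      simp only [mem_ofPred_eq, mem_empty_iff_false, iff_false, not_and]
      intro h1 h2
      rw [pathIntegral_eq_of_forall_eq hN.mono ht.le h2 h] at h1
      exact (mul_ne_zero hi' ht.ne') h1
    rw [e, measure_empty]

theorem altIntegral_add {g : ℝ → ℝ≥0∞} (hg : Measurable g) (n : ℕ) (t : ℝ) {ψ ψ' : ℝ → ℝ≥0∞}
    (hψ : Measurable ψ) :
    altIntegral g n t (fun x => ψ x + ψ' x) = altIntegral g n t ψ + altIntegral g n t ψ' := by
  simp only [altIntegral, add_mul]
  refine lintegral_add_left ?_ _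
  exact (hψ.comp (by fun_prop)).mul ((measurable_altKernel hg n).comp
    (f := fun b => (t - b, b)) (by fun_prop))

/-- The symmetrized indicator function of the dilated set. -/
noncomputable def symmIndicator (v : ℝ) (A : Set ℝ) (x : ℝ) : ℝ≥0∞ :=
  A.indicator (fun _ => 1) (v * x) + A.indicator (fun _ => 1) (-v * x)

theorem measurable_indicator_mul (v : ℝ) {A : Set ℝ} (hA : MeasurableSet A) :
    Measurable fun x : ℝ => A.indicator (fun _ => (1 : ℝ≥0∞)) (v * x) :=
  (measurable_const.indicator hA).comp (measurable_const.mul measurable_id)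

theorem measurable_symmIndicator (v : ℝ) {A : Set ℝ} (hA : MeasurableSet A) :
    Measurable (symmIndicator v A) :=
  (measurable_indicator_mul v hA).add (measurable_indicator_mul (-v) hA)

theorem IsPoissonProcess.measure_mul_alternating (hN : IsPoissonProcess N lam P)
    (hlam : IsRate lam) (v : ℝ) (n : ℕ) {t : ℝ} (ht : 0 < t) {A : Set ℝ} (hA : MeasurableSet A) :
    P {ω | v * pathIntegral N (fun n => (-1) ^ n) t ω ∈ A ∧ N t.toNNReal ω = n + 1} =
      ENNReal.ofReal (Real.exp (-cumRate lam t)) * altIntegral (rateENN lam) n t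
        fun x => A.indicator (fun _ => 1) ((-1) ^ (n + 1) * v * x) := by
  have hA' : MeasurableSet {x | v * x ∈ A} := (measurable_const.mul measurable_id) hA
  have h := measure_eq_exp_mul_jumpLaw (P := P) (N := N) (lam := lam) (y := fun n => (-1) ^ n)
    (n + 1) t {x | v * x ∈ A}
  rw [hN.jumpLaw_alternating hlam n ht hA'] at h
  refine h.trans ?_
  congr 2
  funext x
  simp only [indicator, mem_ofPred_eq]
  congr 2
  ring

/-- Adding the two initial directions symmetrizes the test function and so removes the dependence on
the parity of the number of jumps. -/
theorem IsPoissonProcess.measure_mul_alternating_add (hN : IsPoissonProcess N lam P)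
    (hlam : IsRate lam) (v : ℝ) (n : ℕ) {t : ℝ} (ht : 0 < t) {A : Set ℝ} (hA : MeasurableSet A) :
    P {ω | v * pathIntegral N (fun n => (-1) ^ n) t ω ∈ A ∧ N t.toNNReal ω = n + 1} +
      P {ω | -v * pathIntegral N (fun n => (-1) ^ n) t ω ∈ A ∧ N t.toNNReal ω = n + 1} =
      ENNReal.ofReal (Real.exp (-cumRate lam t)) *
        altIntegral (rateENN lam) n t (symmIndicator v A) := by
  rw [hN.measure_mul_alternating hlam v n ht hA, hN.measure_mul_alternating hlam (-v) n ht hA,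
    ← mul_add, ← altIntegral_add hlam.measurable_rateENN n t (measurable_indicator_mul _ hA)]
  congr 2
  funext x
  rcases neg_one_pow_eq_or ℝ (n + 1) with h | h
  · simp [h, symmIndicator]
  · simp [h, symmIndicator, add_comm]

theorem IsPoissonProcess.measure_mul_alternating_zero (hN : IsPoissonProcess N lam P)
    (hlam : IsRate lam) (v : ℝ) {t : ℝ} (ht : 0 < t) (A : Set ℝ) :
    P {ω | v * pathIntegral N (fun n => (-1) ^ n) t ω ∈ A ∧ N t.toNNReal ω = 0} =
      ENNReal.ofReal (Real.exp (-cumRate lam t)) * A.indicator (fun _ => 1) (v * t) := by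
  have h := measure_eq_exp_mul_jumpLaw (P := P) (N := N) (lam := lam) (y := fun n => (-1) ^ n)
    0 t {x | v * x ∈ A}
  rw [hN.jumpLaw_zero hlam abs_neg_one_pow_le ht.le, pow_zero, one_mul] at h
  exact h

theorem tsum_altIntegral {g : ℝ → ℝ≥0∞} (hg : Measurable g) (t : ℝ) {ψ : ℝ → ℝ≥0∞}
    (hψ : Measurable ψ) :
    ∑' n, altIntegral g n t ψ = ∫⁻ b in Ioo 0 t, ψ (t - 2 * b) * altDensity g (t - b) b := by
  simp only [altIntegral, altDensity, ← ENNReal.tsum_mul_left]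
  refine (lintegral_tsum fun n => ?_).symm
  exact ((hψ.comp (f := fun b => t - 2 * b) (by fun_prop)).mul ((measurable_altKernel hg n).comp
    (f := fun b => (t - b, b)) (by fun_prop))).aemeasurable

/-- The change of variables from the time `b` spent in the opposite direction to the position; it is
the source of the factors `1/(2v)` in the densities. -/
theorem lintegral_Ioo_affine (F : ℝ → ℝ≥0∞) {v t : ℝ} (hv : 0 < v) :
    ∫⁻ b in Ioo 0 t, F (v * (t - 2 * b)) =
      ENNReal.ofReal (1 / (2 * v)) * ∫⁻ x in Ioo (-(v * t)) (v * t), F x := by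
  have h := lintegral_image_eq_lintegral_abs_deriv_mul (s := Ioo 0 t)
    (f := fun b => v * (t - 2 * b)) (f' := fun _ => -(2 * v)) measurableSet_Ioo
    (fun b _ => by
      have := (((hasDerivAt_id b).const_mul 2).const_sub t).const_mul v
      exact (this.congr_deriv (by simp; ring)).hasDerivWithinAt)
    (fun a _ b _ hab => by
      have := mul_left_cancel₀ hv.ne' hab
      linarith) F
  have himg : (fun b => v * (t - 2 * b)) '' Ioo 0 t = Ioo (-(v * t)) (v * t) := by
    ext x
    simp only [mem_image, mem_Ioo]
    constructor
    · rintro ⟨b, ⟨h1, h2⟩, rfl⟩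
      constructor <;> nlinarith
    · rintro ⟨h1, h2⟩
      refine ⟨(v * t - x) / (2 * v), ⟨div_pos (by linarith) (by linarith), ?_⟩, ?_⟩
      · rw [div_lt_iff₀ (by linarith)]
        linarith
      · field_simp
        ring
  rw [himg] at h
  rw [h, abs_neg, abs_of_pos (by linarith : 0 < 2 * v), lintegral_const_mul' _ _
    ENNReal.ofReal_ne_top, ← mul_assoc, ← ENNReal.ofReal_mul (by positivity)]
  have : 1 / (2 * v) * (2 * v) = 1 := by field_simp
  rw [this, ENNReal.ofReal_one, one_mul]

end AlternatingLaw

/-! ### The telegraph density -/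

/-- The density of the absolutely continuous component of the law at time `t` of a telegraph
process with velocity `v` and rate function `mu`. -/
noncomputable def telegraphDensity (v : ℝ) (mu : ℝ → ℝ) (x t : ℝ) : ℝ :=
  (Ioo (-(v * t)) (v * t)).indicator (fun x => Real.exp (-cumRate mu t) / (4 * v) *
    (altDensityReal mu ((v * t + x) / (2 * v)) ((v * t - x) / (2 * v))
      + altDensityReal mu ((v * t - x) / (2 * v)) ((v * t + x) / (2 * v)))) x

section Density

variable {mu : ℝ → ℝ} {v : ℝ}

theorem telegraphDensity_nonneg (hv : 0 < v) (x t : ℝ) : 0 ≤ telegraphDensity v mu x t := by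
  refine indicator_nonneg (fun x _ => mul_nonneg ?_ ?_) x
  · exact div_nonneg (Real.exp_pos _).le (by linarith)
  · exact add_nonneg (altDensityReal_nonneg _ _) (altDensityReal_nonneg _ _)

theorem IsRate.measurable_telegraphDensity (h : IsRate mu) (t : ℝ) :
    Measurable fun x => telegraphDensity v mu x t := by
  refine Measurable.indicator ?_ measurableSet_Ioo
  refine measurable_const.mul (Measurable.add ?_ ?_)
  · exact h.measurable_altDensityReal.comp
      (f := fun x => ((v * t + x) / (2 * v), (v * t - x) / (2 * v))) (by fun_prop)
  · exact h.measurable_altDensityReal.comp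
      (f := fun x => ((v * t - x) / (2 * v), (v * t + x) / (2 * v))) (by fun_prop)

theorem lintegral_Ioo_neg (F : ℝ → ℝ≥0∞) (r : ℝ) :
    ∫⁻ x in Ioo (-r) r, F (-x) = ∫⁻ x in Ioo (-r) r, F x := by
  have h := (Measure.measurePreserving_neg (volume : Measure ℝ)).setLIntegral_comp_preimage_emb
    (MeasurableEquiv.neg ℝ).measurableEmbedding F (Ioo (-r) r)
  rw [← h]
  congr 2
  ext x
  simp only [mem_preimage, mem_Ioo]
  constructor <;> rintro ⟨h1, h2⟩ <;> constructor <;> linarith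

/-- The kernels carry neither the normalisation `e^{-Λ}` nor the probability `1/2` of each initial
velocity, whence the factor `2 e^Λ`, with `Λ` the integral of `mu`. -/
theorem IsRate.tsum_altIntegral_symmIndicator (h : IsRate mu) (hv : 0 < v) (t : ℝ) {A : Set ℝ}
    (hA : MeasurableSet A) :
    ∑' n, altIntegral (rateENN mu) n t (symmIndicator v A) =
      ENNReal.ofReal (2 * Real.exp (cumRate mu t)) *
        ∫⁻ x in A, ENNReal.ofReal (telegraphDensity v mu x t) := by
  have hH := measurable_altDensity h.measurable_rateENN
  let H : ℝ → ℝ≥0∞ := fun x => altDensity (rateENN mu) ((v * t + x) / (2 * v))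
    ((v * t - x) / (2 * v))
  have hHm : Measurable H := hH.comp
    (f := fun x => ((v * t + x) / (2 * v), (v * t - x) / (2 * v))) (by fun_prop)
  let I : ℝ → ℝ≥0∞ := A.indicator fun _ => 1
  have hI : Measurable I := measurable_const.indicator hA
  have hm1 : Measurable fun x => I x * H x := hI.mul hHm
  have hm2 : Measurable fun x => I x * H (-x) := hI.mul (hHm.comp measurable_neg)
  have hm12 : Measurable fun x => I x * H x + I x * H (-x) := hm1.add hm2
  rw [tsum_altIntegral h.measurable_rateENN t (measurable_symmIndicator v hA)]
  have e1 : ∀ b, symmIndicator v A (t - 2 * b) * altDensity (rateENN mu) (t - b) b =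
      (fun x => I x * H x + I (-x) * H x) (v * (t - 2 * b)) := by
    intro b
    have h1 : (v * t + v * (t - 2 * b)) / (2 * v) = t - b := by field_simp; ring
    have h2 : (v * t - v * (t - 2 * b)) / (2 * v) = b := by field_simp; ring
    simp only [H, I, h1, h2, symmIndicator, neg_mul, add_mul]
  simp only [e1]
  rw [lintegral_Ioo_affine (fun x => I x * H x + I (-x) * H x) hv,
    lintegral_add_left hm1]
  -- The reflection `x ↦ -x` moves the symmetrization from the set to the density, exchanging the
  -- times spent in the two directions.
  have e2 : ∫⁻ x in Ioo (-(v * t)) (v * t), I (-x) * H x =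
      ∫⁻ x in Ioo (-(v * t)) (v * t), I x * H (-x) := by
    rw [← lintegral_Ioo_neg]
    simp only [neg_neg]
  rw [e2, ← lintegral_add_left hm1, ← lintegral_const_mul _ hm12,
    ← lintegral_const_mul _ (h.measurable_telegraphDensity t).ennreal_ofReal,
    ← lintegral_indicator measurableSet_Ioo, ← lintegral_indicator hA]
  refine lintegral_congr fun x => ?_
  by_cases hx : x ∈ Ioo (-(v * t)) (v * t)
  · have ha : 0 < (v * t + x) / (2 * v) := div_pos (by linarith [hx.1]) (by linarith)
    have hb : 0 < (v * t - x) / (2 * v) := div_pos (by linarith [hx.2]) (by linarith)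
    rw [indicator_of_mem hx]
    by_cases hxA : x ∈ A
    · rw [indicator_of_mem hxA, telegraphDensity, indicator_of_mem hx]
      simp only [I, H, indicator_of_mem hxA, one_mul, ← sub_eq_add_neg, sub_neg_eq_add]
      rw [← h.ofReal_altDensityReal ha.le hb, ← h.ofReal_altDensityReal hb.le ha,
        ← ENNReal.ofReal_add (altDensityReal_nonneg _ _) (altDensityReal_nonneg _ _),
        ← ENNReal.ofReal_mul (by positivity), ← ENNReal.ofReal_mul (by positivity)]
      congr 1
      have : Real.exp (cumRate mu t) * Real.exp (-cumRate mu t) = 1 := by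
        rw [← Real.exp_add]
        simp
      field_simp
      linear_combination (-4 * (altDensityReal mu ((v * t + x) / (2 * v)) ((v * t - x) / (2 * v)) +
        altDensityReal mu ((v * t - x) / (2 * v)) ((v * t + x) / (2 * v)))) * this
    · simp [I, indicator_of_notMem hxA]
  · have h0 : telegraphDensity v mu x t = 0 := indicator_of_notMem hx _
    rw [indicator_of_notMem hx]
    simp [indicator, h0]

theorem altIntegral_const_mul {g : ℝ → ℝ≥0∞} (hg : Measurable g) (k : ℝ≥0∞) (n : ℕ) (t : ℝ)
    {ψ : ℝ → ℝ≥0∞} (hψ : Measurable ψ) :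
    altIntegral (fun s => k * g s) n t ψ = k ^ (n + 1) * altIntegral g n t ψ := by
  simp only [altIntegral, altKernel_const_mul hg]
  rw [← lintegral_const_mul]
  · refine lintegral_congr fun b => ?_
    ring
  · exact (hψ.comp (f := fun b => t - 2 * b) (by fun_prop)).mul ((measurable_altKernel hg n).comp
      (f := fun b => (t - b, b)) (by fun_prop))

end Density

/-! ### Decomposition over discrete variables -/

section Fibers

variable {Ω : Type*}

theorem measure_eq_tsum_fiber [MeasurableSpace Ω] {P : Measure Ω} {ι : Type*} [Countable ι] [MeasurableSpace ι]
    [MeasurableSingletonClass ι] {f : Ω → ι} (hf : Measurable f) (S : Set Ω) :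
    P S = ∑' i, P (S ∩ {ω | f ω = i}) := by
  have hm : ∀ i, MeasurableSet {ω | f ω = i} := fun i => hf (MeasurableSet.singleton i)
  have e : (univ : Set Ω) = ⋃ i, {ω | f ω = i} := by
    ext ω
    simp
  calc P S = P.restrict S univ := by simp
    _ = ∑' i, P.restrict S {ω | f ω = i} := by
        rw [e]
        refine measure_iUnion (fun i j hij => ?_) hm
        refine disjoint_left.2 fun ω hi hj => hij ?_
        exact hi.symm.trans hj
    _ = ∑' i, P (S ∩ {ω | f ω = i}) := by
        congr 1
        funext i
        rw [Measure.restrict_apply (hm i), inter_comm]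

theorem measurable_comap_path (N : ℝ≥0 → Ω → ℕ) (r : ℝ≥0) :
    Measurable[MeasurableSpace.comap (fun ω t => N t ω) MeasurableSpace.pi] (N r) := by
  have h := comap_measurable (m := MeasurableSpace.pi) (fun ω (t : ℝ≥0) => N t ω)
  exact (measurable_pi_apply r).comp h

theorem measurable_comap_pathIntegral {N : ℝ≥0 → Ω → ℕ}
    (hr : ∀ ω t, ContinuousWithinAt (fun s => N s ω) (Ici t) t) (y : ℕ → ℝ) {t : ℝ}
    (ht : 0 ≤ t) :
    Measurable[MeasurableSpace.comap (fun ω t => N t ω) MeasurableSpace.pi]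
      (pathIntegral N y t) :=
  @measurable_pathIntegral Ω N (MeasurableSpace.comap (fun ω t => N t ω) MeasurableSpace.pi)
    hr y t ht fun r _ => measurable_comap_path N r

end Fibers

/-! ### The law of the telegraph process -/

section Telegraph

variable {Ω : Type*} [MeasurableSpace Ω] {P : Measure Ω} [IsProbabilityMeasure P]
  {mu : ℝ → ℝ} {v : ℝ}

/-- Conditioning on the number of jumps and on the initial velocity: paths without a jump give the
two atoms, and the rest sums to the telegraph density. -/
theorem IsTelegraphProcess.isAbsContComponent {T : ℝ → Ω → ℝ} (hT : IsTelegraphProcess v mu T P)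
    (hmu : IsRate mu) (hv : 0 < v) {t : ℝ} (ht : 0 < t) :
    IsAbsContComponent (T t) P fun x => telegraphDensity v mu x t := by
  obtain ⟨N, V₀, hN, hV, hV1, hV2, hind, hTN⟩ := hT
  refine ⟨hmu.measurable_telegraphDensity t, fun x => telegraphDensity_nonneg hv x t,
    ENNReal.ofReal (Real.exp (-cumRate mu t) / 2) • (Measure.dirac (v * t)
      + Measure.dirac (-v * t)),
    ((mutuallySingular_dirac _ _).add_left (mutuallySingular_dirac _ _)).smul _, ?_⟩
  intro A hA
  let W := pathIntegral N (fun n => (-1) ^ n) t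
  have hTW : ∀ ω, T t ω = V₀ ω * W ω := by
    intro ω
    rw [hTN t ht.le ω]
    exact intervalIntegral.integral_const_mul _ _
  have hW : Measurable W := hN.measurable_pathIntegral _ ht.le
  have hterm : ∀ w : ℝ, P {ω | V₀ ω = w} = 1 / 2 → ∀ n,
      P ({ω | V₀ ω = w} ∩ {ω | w * W ω ∈ A ∧ N t.toNNReal ω = n}) =
        1 / 2 * P {ω | w * W ω ∈ A ∧ N t.toNNReal ω = n} := by
    intro w hw n
    rw [IndepFun_iff_Indep, Indep_iff] at hind
    rw [← hw]
    refine hind _ _ ⟨{w}, MeasurableSet.singleton w, rfl⟩ ?_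
    have m1 := measurable_comap_pathIntegral hN.rightCont (fun n => (-1) ^ n) ht.le
    have m2 := measurable_comap_path N t.toNNReal
    exact MeasurableSet.inter (m1.const_mul w hA) (m2 (MeasurableSet.singleton n))
  have hfib : ∀ n, P ({ω | T t ω ∈ A} ∩ {ω | N t.toNNReal ω = n}) =
      1 / 2 * (P {ω | v * W ω ∈ A ∧ N t.toNNReal ω = n}
        + P {ω | -v * W ω ∈ A ∧ N t.toNNReal ω = n}) := by
    intro n
    have hm1 : MeasurableSet {ω | V₀ ω = v} := hV (MeasurableSet.singleton v)
    have hm2 : MeasurableSet {ω | V₀ ω = -v} := hV (MeasurableSet.singleton (-v))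
    have hdisj : Disjoint {ω | V₀ ω = v} {ω | V₀ ω = -v} := by
      refine disjoint_left.2 fun ω h1 h2 => ?_
      have h3 : v = -v := h1.symm.trans h2
      linarith
    have hfull : P ({ω | V₀ ω = v} ∪ {ω | V₀ ω = -v})ᶜ = 0 := by
      rw [prob_compl_eq_zero_iff (hm1.union hm2), measure_union hdisj hm2, hV1, hV2]
      exact ENNReal.add_halves 1
    have e := measure_inter_add_sdiff ({ω | T t ω ∈ A} ∩ {ω | N t.toNNReal ω = n})
      (hm1.union hm2) (μ := P)
    have h0 : P (({ω | T t ω ∈ A} ∩ {ω | N t.toNNReal ω = n}) \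
        ({ω | V₀ ω = v} ∪ {ω | V₀ ω = -v})) = 0 := measure_mono_null (fun ω hω => hω.2) hfull
    rw [h0, add_zero, inter_union_distrib_left,
      measure_union (hdisj.mono inter_subset_right inter_subset_right)] at e
    · rw [← e, mul_add, ← hterm v hV1 n, ← hterm (-v) hV2 n]
      congr 2
      · ext ω
        simp only [mem_inter_iff, mem_ofPred_eq, hTW]
        constructor
        · rintro ⟨⟨h1, h2⟩, h3⟩
          exact ⟨h3, by rwa [h3] at h1, h2⟩
        · rintro ⟨h3, h1, h2⟩
          exact ⟨⟨by rwa [h3], h2⟩, h3⟩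
      · ext ω
        simp only [mem_inter_iff, mem_ofPred_eq, hTW]
        constructor
        · rintro ⟨⟨h1, h2⟩, h3⟩
          exact ⟨h3, by rwa [h3] at h1, h2⟩
        · rintro ⟨h3, h1, h2⟩
          exact ⟨⟨by rwa [h3], h2⟩, h3⟩
    · refine MeasurableSet.inter (MeasurableSet.inter ?_ ?_) hm2
      · simp only [hTW]
        exact (hV.mul hW) hA
      · exact hN.measurable _ (MeasurableSet.singleton n)
  rw [measure_eq_tsum_fiber (hN.measurable t.toNNReal), tsum_eq_zero_add' ENNReal.summable]
  simp only [hfib]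
  have hhalf : (1 / 2 : ℝ≥0∞) = ENNReal.ofReal (1 / 2) := by
    rw [ENNReal.ofReal_div_of_pos two_pos]
    simp
  congr 1
  · rw [hN.measure_mul_alternating_zero hmu v ht, hN.measure_mul_alternating_zero hmu (-v) ht,
      ← mul_add, ← mul_assoc, hhalf, ← ENNReal.ofReal_mul (by norm_num)]
    simp only [Measure.smul_apply, Measure.add_apply, Measure.dirac_apply' _ hA, smul_eq_mul]
    congr 2
    ring
  · simp only [W, hN.measure_mul_alternating_add hmu v _ ht hA]
    rw [ENNReal.tsum_mul_left, ENNReal.tsum_mul_left, hmu.tsum_altIntegral_symmIndicator hv t hA,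
      ← mul_assoc, ← mul_assoc, hhalf, ← ENNReal.ofReal_mul (by norm_num),
      ← ENNReal.ofReal_mul (by positivity)]
    have : 1 / 2 * Real.exp (-cumRate mu t) * (2 * Real.exp (cumRate mu t)) = 1 := by
      have : Real.exp (-cumRate mu t) * Real.exp (cumRate mu t) = 1 := by
        rw [← Real.exp_add]
        simp
      linear_combination this
    rw [this, ENNReal.ofReal_one, one_mul]

end Telegraph

/-! ### Sequences of directions that stay on the horizontal axis -/

section Directions

/-- The extension of a finite sequence of directions by the direction right. -/
def extendDirections {n : ℕ} (k : Fin (n + 1) → Fin 4) (i : ℕ) : Fin 4 :=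
  if h : i < n + 1 then k ⟨i, h⟩ else 0

/-- The sequence `j, j + 2, j, …` of alternating directions. -/
def altDirections (n : ℕ) (j : Fin 4) (i : Fin (n + 1)) : Fin 4 :=
  if Even i.1 then j else j + 2

theorem dirY_eq_zero_iff {j : Fin 4} : dirY j = 0 ↔ j = 0 ∨ j = 2 := by
  fin_cases j <;> simp [dirY]

theorem abs_dirY_le (j : Fin 4) : |dirY j| ≤ 1 := by
  fin_cases j <;> simp [dirY]

theorem dirX_altDirections {n : ℕ} {j : Fin 4} (hj : j = 0 ∨ j = 2) (i : Fin (n + 1)) :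
    dirX (altDirections n j i) = dirX j * (-1) ^ i.1 := by
  rw [altDirections]
  split_ifs with h
  · rw [h.neg_one_pow, mul_one]
  · rw [(Nat.not_even_iff_odd.1 h).neg_one_pow]
    rcases hj with rfl | rfl <;> simp [dirX]

theorem dirY_altDirections {n : ℕ} {j : Fin 4} (hj : j = 0 ∨ j = 2) (i : Fin (n + 1)) :
    dirY (altDirections n j i) = 0 := by
  rw [altDirections, dirY_eq_zero_iff]
  split_ifs with h
  · exact hj
  · rcases hj with rfl | rfl <;> simp

theorem prod_reflectProb_altDirections (n : ℕ) (j : Fin 4) :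
    ∏ i : Fin n, reflectProb (altDirections n j i.castSucc) (altDirections n j i.succ) =
      (1 / 3) ^ n := by
  have h : ∀ i : Fin n, reflectProb (altDirections n j i.castSucc) (altDirections n j i.succ) =
      1 / 3 := by
    intro i
    rw [reflectProb, if_neg]
    simp only [altDirections, Fin.val_castSucc, Fin.val_succ, Nat.even_add_one]
    by_cases h : Even i.1 <;> simp only [h, if_true, if_false, not_true, not_false_eq_true] <;>
      (revert j; decide)
  rw [Finset.prod_congr rfl fun i _ => h i]
  simp

/-- Nonzero probability forbids repeating a direction, and only two directions are horizontal, so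
each one determines the next. -/
theorem eq_altDirections {n : ℕ} {k : Fin (n + 1) → Fin 4} (hY : ∀ i, dirY (k i) = 0)
    (hk : ∏ i : Fin n, reflectProb (k i.castSucc) (k i.succ) ≠ 0) :
    k = altDirections n 0 ∨ k = altDirections n 2 := by
  have hne : ∀ i : Fin n, k i.castSucc ≠ k i.succ := by
    intro i hi
    refine Finset.prod_ne_zero_iff.1 hk i (Finset.mem_univ i) ?_
    rw [reflectProb, if_pos hi]
  have key : k = altDirections n (k 0) := by
    funext i
    induction i using Fin.induction with
    | zero => simp [altDirections]
    | succ i ih =>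
      have h1 := hne i
      have h2 := dirY_eq_zero_iff.1 (hY i.succ)
      have h3 := dirY_eq_zero_iff.1 (hY 0)
      rw [ih] at h1
      simp only [altDirections, Fin.val_castSucc, Fin.val_succ, Nat.even_add_one] at h1 ⊢
      revert h1 h2 h3
      generalize k i.succ = a
      generalize k 0 = b
      by_cases hi : Even i.1 <;> simp only [hi, if_true, if_false, not_true, not_false_eq_true] <;>
        (revert a b; decide)
  rcases dirY_eq_zero_iff.1 (hY 0) with h | h
  · rw [h] at key
    exact Or.inl key
  · rw [h] at key
    exact Or.inr key

end Directions

section PathIntegral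

variable {Ω : Type*} {N : ℝ≥0 → Ω → ℕ}

theorem pathIntegral_congr (hm : ∀ ω, Monotone fun t => N t ω) {t : ℝ} (ht : 0 ≤ t) {ω : Ω}
    {n : ℕ} (hω : N t.toNNReal ω = n) {y y' : ℕ → ℝ} (hy : ∀ i ≤ n, y i = y' i) :
    pathIntegral N y t ω = pathIntegral N y' t ω := by
  refine intervalIntegral.integral_congr fun r hr => ?_
  rw [uIcc_of_le ht] at hr
  exact hy _ ((hm ω (Real.toNNReal_le_toNNReal hr.2)).trans_eq hω)

theorem pathIntegral_const_mul (v : ℝ) (y : ℕ → ℝ) (t : ℝ) (ω : Ω) :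
    pathIntegral N (fun i => v * y i) t ω = v * pathIntegral N y t ω :=
  intervalIntegral.integral_const_mul _ _

end PathIntegral

/-! ### The law of `X` on the event `Y = 0` -/

section Edge

variable {Ω : Type*} {N : ℝ≥0 → Ω → ℕ} {D : ℕ → Ω → Fin 4} {lam : ℝ → ℝ} {c : ℝ}

theorem integral_direction_eq_pathIntegral (hm : ∀ ω, Monotone fun t => N t ω) {t : ℝ}
    (ht : 0 ≤ t) {ω : Ω} {n : ℕ} (hω : N t.toNNReal ω = n) {k : Fin (n + 1) → Fin 4}
    (hk : ∀ i : Fin (n + 1), D i ω = k i) (dir : Fin 4 → ℝ) :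
    ∫ s in (0 : ℝ)..t, c * dir (D (N s.toNNReal ω) ω) =
      pathIntegral N (fun i => c * dir (extendDirections k i)) t ω := by
  refine (pathIntegral_congr hm ht hω (y := fun i => c * dir (D i ω)) fun i hi => ?_)
  have hi' : i < n + 1 := Nat.lt_succ_of_le hi
  simp only [extendDirections, dif_pos hi', ← hk]

variable [MeasurableSpace Ω] {P : Measure Ω}

/-- With `n` jumps the path depends only on the first `n + 1` directions. Once these are fixed, the
position is a functional of the Poisson process alone, and the probability factorises. -/
theorem measure_edge_inter_directions (hN : IsPoissonProcess N lam P)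
    (hD : IsReflectingChain D P) (hind : IndepFun (fun ω n => D n ω) (fun ω t => N t ω) P)
    {t : ℝ} (ht : 0 ≤ t) {A : Set ℝ} (hA : MeasurableSet A) (n : ℕ) (k : Fin (n + 1) → Fin 4) :
    P ({ω | (∫ s in (0 : ℝ)..t, c * dirX (D (N s.toNNReal ω) ω)) ∈ A ∧
        (∫ s in (0 : ℝ)..t, c * dirY (D (N s.toNNReal ω) ω)) = 0} ∩ {ω | N t.toNNReal ω = n} ∩
        {ω | (fun i : Fin (n + 1) => D i ω) = k}) =
      ENNReal.ofReal (1 / 4 * ∏ i : Fin n, reflectProb (k i.castSucc) (k i.succ)) *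
        P {ω | (pathIntegral N (fun i => c * dirX (extendDirections k i)) t ω ∈ A ∧
          pathIntegral N (fun i => c * dirY (extendDirections k i)) t ω = 0) ∧
          N t.toNNReal ω = n} := by
  rw [← hD.law n k]
  rw [IndepFun_iff_Indep, Indep_iff] at hind
  rw [← hind]
  · congr 1
    ext ω
    simp only [mem_inter_iff, mem_ofPred_eq, funext_iff]
    constructor
    · rintro ⟨⟨h, hn⟩, hk⟩
      rw [integral_direction_eq_pathIntegral hN.mono ht hn hk,
        integral_direction_eq_pathIntegral hN.mono ht hn hk] at h
      exact ⟨hk, h, hn⟩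
    · rintro ⟨hk, h, hn⟩
      rw [← integral_direction_eq_pathIntegral hN.mono ht hn hk,
        ← integral_direction_eq_pathIntegral hN.mono ht hn hk] at h
      exact ⟨⟨h, hn⟩, hk⟩
  · have hm : Measurable fun (d : ℕ → Fin 4) (i : Fin (n + 1)) => d i :=
      measurable_pi_lambda _ fun i => measurable_pi_apply (i : ℕ)
    refine ⟨_, hm (MeasurableSet.singleton k), ?_⟩
    ext ω
    simp [funext_iff]
  · have m1 := measurable_comap_pathIntegral hN.rightCont
      (fun i => c * dirX (extendDirections k i)) ht
    have m2 := measurable_comap_pathIntegral hN.rightCont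
      (fun i => c * dirY (extendDirections k i)) ht
    have m3 := measurable_comap_path N t.toNNReal
    exact ((m1 hA).inter (m2 (MeasurableSet.singleton 0))).inter (m3 (MeasurableSet.singleton n))

theorem measure_pathIntegral_altDirections (hm : ∀ ω, Monotone fun t => N t ω) {t : ℝ}
    (ht : 0 ≤ t) (A : Set ℝ) (n : ℕ) {j : Fin 4} (hj : j = 0 ∨ j = 2) :
    P {ω | (pathIntegral N (fun i => c * dirX (extendDirections (altDirections n j) i)) t ω ∈ A ∧
      pathIntegral N (fun i => c * dirY (extendDirections (altDirections n j) i)) t ω = 0) ∧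
      N t.toNNReal ω = n} =
    P {ω | dirX j * c * pathIntegral N (fun i => (-1) ^ i) t ω ∈ A ∧ N t.toNNReal ω = n} := by
  congr 1
  ext ω
  simp only [mem_ofPred_eq, and_congr_left_iff]
  intro hn
  have e1 : pathIntegral N (fun i => c * dirX (extendDirections (altDirections n j) i)) t ω =
      dirX j * c * pathIntegral N (fun i => (-1) ^ i) t ω := by
    rw [← pathIntegral_const_mul]
    refine pathIntegral_congr hm ht hn fun i hi => ?_
    have hi' : i < n + 1 := Nat.lt_succ_of_le hi
    simp only [extendDirections, dif_pos hi', dirX_altDirections hj]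
    ring
  have e2 : pathIntegral N (fun i => c * dirY (extendDirections (altDirections n j) i)) t ω =
      0 * t := by
    refine pathIntegral_eq_of_forall_eq hm ht hn fun i hi => ?_
    have hi' : i < n + 1 := Nat.lt_succ_of_le hi
    simp only [extendDirections, dif_pos hi', dirY_altDirections hj, mul_zero]
  rw [e1, e2]
  simp

variable [IsProbabilityMeasure P]

theorem measure_edge_inter_count (hc : 0 < c) (hlam : IsRate lam) (hN : IsPoissonProcess N lam P)
    (hD : IsReflectingChain D P) (hind : IndepFun (fun ω n => D n ω) (fun ω t => N t ω) P)
    {t : ℝ} (ht : 0 < t) {A : Set ℝ} (hA : MeasurableSet A) (n : ℕ) :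
    P ({ω | (∫ s in (0 : ℝ)..t, c * dirX (D (N s.toNNReal ω) ω)) ∈ A ∧
        (∫ s in (0 : ℝ)..t, c * dirY (D (N s.toNNReal ω) ω)) = 0} ∩ {ω | N t.toNNReal ω = n}) =
      ENNReal.ofReal (1 / 4 * (1 / 3) ^ n) *
        (P {ω | c * pathIntegral N (fun i => (-1) ^ i) t ω ∈ A ∧ N t.toNNReal ω = n} +
          P {ω | -c * pathIntegral N (fun i => (-1) ^ i) t ω ∈ A ∧ N t.toNNReal ω = n}) := by
  have hDm : Measurable fun ω => fun i : Fin (n + 1) => D i ω :=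
    measurable_pi_lambda _ fun i => hD.measurable i
  rw [measure_eq_tsum_fiber hDm, tsum_fintype]
  simp only [measure_edge_inter_directions hN hD hind ht.le hA]
  have hne : altDirections n 0 ≠ altDirections n 2 := by
    intro h
    have := congrFun h 0
    simp [altDirections] at this
  -- Only the two alternating sequences contribute: any other one has probability zero, or contains
  -- a vertical direction and then gives `Y = 0` probability zero.
  rw [Fintype.sum_eq_add _ _ hne]
  · rw [measure_pathIntegral_altDirections hN.mono ht.le A n (Or.inl rfl),
      measure_pathIntegral_altDirections hN.mono ht.le A n (Or.inr rfl),
      prod_reflectProb_altDirections, prod_reflectProb_altDirections, mul_add]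
    simp [dirX]
  · rintro k ⟨h0, h2⟩
    by_cases hY : ∀ i, dirY (k i) = 0
    · have hp : ∏ i : Fin n, reflectProb (k i.castSucc) (k i.succ) = 0 := by
        by_contra hp
        exact (eq_altDirections hY hp).elim h0 h2
      rw [hp]
      simp
    · push Not at hY
      obtain ⟨i, hi⟩ := hY
      have hz := hN.measure_pathIntegral_eq_zero hlam (C := c) (n := n)
        (y := fun i => c * dirY (extendDirections k i)) (fun m => ?_)
        ⟨i, Nat.lt_succ_iff.1 i.2, ?_⟩ ht
      · refine mul_eq_zero_of_right _ (measure_mono_null ?_ hz)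
        exact fun ω hω => ⟨hω.1.2, hω.2⟩
      · rw [abs_mul, abs_of_pos hc]
        exact mul_le_of_le_one_right hc.le (abs_dirY_le _)
      · simp only [extendDirections, dif_pos i.2]
        exact mul_ne_zero hc.ne' hi

theorem rateENN_div_three (lam : ℝ → ℝ) :
    rateENN (fun t => lam t / 3) = fun s => ENNReal.ofReal (1 / 3) * rateENN lam s := by
  funext s
  rw [rateENN, rateENN, ← ENNReal.ofReal_mul (by norm_num)]
  congr 1
  by_cases hs : s ∈ Ioi (0 : ℝ)
  · rw [indicator_of_mem hs, indicator_of_mem hs]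
    ring
  · rw [indicator_of_notMem hs, indicator_of_notMem hs, mul_zero]

theorem cumRate_div_three (lam : ℝ → ℝ) (t : ℝ) :
    cumRate (fun t => lam t / 3) t = cumRate lam t / 3 :=
  intervalIntegral.integral_div _ _

/-- Same kernel, different weights: initial probabilities `1/4` against `1/2`, normalisation
`e^{-Λ}` against `e^{-Λ/3}`. -/
theorem edgeComponent_eq_telegraphDensity (hc : 0 < c) (lam : ℝ → ℝ) {x t : ℝ}
    (hx : x ∈ Ioo (-(c * t)) (c * t)) :
    edgeComponent c 1 lam (x, t) =
      Real.exp (-(2 * cumRate lam t / 3)) / 2 * telegraphDensity c (fun t => lam t / 3) x t := by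
  rw [telegraphDensity, indicator_of_mem hx, edgeComponent, cumRate_div_three]
  have : Real.exp (-cumRate lam t) =
      Real.exp (-(2 * cumRate lam t / 3)) * Real.exp (-(cumRate lam t / 3)) := by
    rw [← Real.exp_add]
    congr 1
    ring
  simp only [this, one_mul]
  field_simp
  ring

theorem measure_edge (hc : 0 < c) (hlam : IsRate lam) (hN : IsPoissonProcess N lam P)
    (hD : IsReflectingChain D P) (hind : IndepFun (fun ω n => D n ω) (fun ω t => N t ω) P)
    {t : ℝ} (ht : 0 < t) {A : Set ℝ} (hA : MeasurableSet A)
    (hAt : A ⊆ Ioo (-(c * t)) (c * t)) :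
    P {ω | (∫ s in (0 : ℝ)..t, c * dirX (D (N s.toNNReal ω) ω)) ∈ A ∧
        (∫ s in (0 : ℝ)..t, c * dirY (D (N s.toNNReal ω) ω)) = 0} =
      ∫⁻ x in A, ENNReal.ofReal (edgeComponent c 1 lam (x, t)) := by
  have h3 := hlam.div_three
  -- Horizontal paths without a jump end at `±ct`, outside `A`, so the term without jumps vanishes.
  have hA1 : c * t ∉ A := fun h => lt_irrefl _ (hAt h).2
  have hA2 : -c * t ∉ A := fun h => lt_irrefl _ ((hAt h).1.trans_eq (neg_mul c t))
  -- One factor `1/3` for each of the `n + 1` jumps: the transition probabilities become a change of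
  -- rate.
  have hterm : ∀ n : ℕ, ENNReal.ofReal (1 / 4 * (1 / 3) ^ (n + 1)) *
      (ENNReal.ofReal (Real.exp (-cumRate lam t)) *
        altIntegral (rateENN lam) n t (symmIndicator c A)) =
      ENNReal.ofReal (1 / 4 * Real.exp (-cumRate lam t)) *
        altIntegral (rateENN fun t => lam t / 3) n t (symmIndicator c A) := by
    intro n
    rw [rateENN_div_three, altIntegral_const_mul hlam.measurable_rateENN _ _ _
      (measurable_symmIndicator c hA), ← mul_assoc, ← mul_assoc,
      ← ENNReal.ofReal_pow (by norm_num), ← ENNReal.ofReal_mul (by positivity),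
      ← ENNReal.ofReal_mul (by positivity)]
    congr 2
    ring
  rw [measure_eq_tsum_fiber (hN.measurable t.toNNReal), tsum_eq_zero_add' ENNReal.summable]
  simp only [measure_edge_inter_count hc hlam hN hD hind ht hA]
  rw [hN.measure_mul_alternating_zero hlam c ht, hN.measure_mul_alternating_zero hlam (-c) ht,
    indicator_of_notMem hA1, indicator_of_notMem hA2, mul_zero, add_zero, mul_zero, zero_add]
  simp only [hN.measure_mul_alternating_add hlam c _ ht hA, hterm]
  rw [ENNReal.tsum_mul_left, h3.tsum_altIntegral_symmIndicator hc t hA, ← mul_assoc,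
    ← ENNReal.ofReal_mul (by positivity), ← lintegral_const_mul _
      (h3.measurable_telegraphDensity t).ennreal_ofReal]
  refine setLIntegral_congr_fun hA fun x hx => ?_
  rw [edgeComponent_eq_telegraphDensity hc lam (hAt hx), ← ENNReal.ofReal_mul (by positivity),
    cumRate_div_three]
  congr 2
  have : Real.exp (-(2 * cumRate lam t / 3)) =
      Real.exp (-cumRate lam t) * Real.exp (cumRate lam t / 3) := by
    rw [← Real.exp_add]
    congr 1
    ring
  rw [this]
  ring

end Edge

/-! ### Total mass, scaling and assembly -/

section Mass

variable {mu lam : ℝ → ℝ} {v c : ℝ}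

/-- On the whole line the symmetrized indicator is the constant `2`, so the known total mass of the
kernels applies. -/
theorem IsRate.lintegral_telegraphDensity (h : IsRate mu) (hv : 0 < v) {t : ℝ} (ht : 0 < t) :
    ∫⁻ x, ENNReal.ofReal (telegraphDensity v mu x t) =
      ENNReal.ofReal (1 - Real.exp (-cumRate mu t)) := by
  have h1 := h.tsum_altIntegral_symmIndicator hv t MeasurableSet.univ
  rw [tsum_altIntegral h.measurable_rateENN t (measurable_symmIndicator v MeasurableSet.univ)] at h1
  simp only [symmIndicator, indicator_univ, Measure.restrict_univ] at h1
  have hm : Measurable fun b => altDensity (rateENN mu) (t - b) b :=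
    (measurable_altDensity h.measurable_rateENN).comp (f := fun b => (t - b, b)) (by fun_prop)
  rw [lintegral_const_mul _ hm, h.lintegral_altDensity ht.le] at h1
  have h2 : ENNReal.ofReal (Real.exp (-cumRate mu t) / 2) *
      ENNReal.ofReal (2 * Real.exp (cumRate mu t)) = 1 := by
    rw [← ENNReal.ofReal_mul (by positivity), div_mul_eq_mul_div, mul_left_comm, ← Real.exp_add]
    simp
  rw [← one_mul (∫⁻ x, _), ← h2, mul_assoc, ← h1, one_add_one_eq_two,
    show (2 : ℝ≥0∞) = ENNReal.ofReal 2 by simp, ← ENNReal.ofReal_mul (by norm_num),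
    ← ENNReal.ofReal_mul (by positivity)]
  congr 1
  have h3 : Real.exp (-cumRate mu t) * Real.exp (cumRate mu t) = 1 := by
    rw [← Real.exp_add]
    simp
  linear_combination h3

theorem IsRate.integrable_telegraphDensity (h : IsRate mu) (hv : 0 < v) {t : ℝ} (ht : 0 < t) :
    Integrable fun x => telegraphDensity v mu x t := by
  refine ⟨(h.measurable_telegraphDensity t).aestronglyMeasurable, ?_⟩
  rw [hasFiniteIntegral_iff_ofReal (ae_of_all _ fun x => telegraphDensity_nonneg hv x t),
    h.lintegral_telegraphDensity hv ht]
  exact ENNReal.ofReal_lt_top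

theorem IsRate.integral_telegraphDensity (h : IsRate mu) (hv : 0 < v) {t : ℝ} (ht : 0 < t) :
    ∫ x in Ioo (-(v * t)) (v * t), telegraphDensity v mu x t = 1 - Real.exp (-cumRate mu t) := by
  rw [setIntegral_eq_integral_of_forall_compl_eq_zero
      fun x hx => by rw [telegraphDensity, indicator_of_notMem hx],
    integral_eq_lintegral_of_nonneg_ae (ae_of_all _ fun x => telegraphDensity_nonneg hv x t)
      (h.measurable_telegraphDensity t).aestronglyMeasurable, h.lintegral_telegraphDensity hv ht,
    ENNReal.toReal_ofReal]
  have := h.cumRate_nonneg ht.le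
  have : Real.exp (-cumRate mu t) ≤ 1 := Real.exp_le_one_iff.2 (by linarith)
  linarith

theorem integrableOn_edgeComponent (hc : 0 < c) (hlam : IsRate lam) {t : ℝ} (ht : 0 < t) :
    IntegrableOn (fun x => edgeComponent c 1 lam (x, t)) (Ioo (-(c * t)) (c * t)) := by
  refine IntegrableOn.congr_fun
    ((hlam.div_three.integrable_telegraphDensity hc ht).const_mul
      (Real.exp (-(2 * cumRate lam t / 3)) / 2)).integrableOn (fun x hx => ?_) measurableSet_Ioo
  exact (edgeComponent_eq_telegraphDensity hc lam hx).symm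

theorem integral_edgeComponent (hc : 0 < c) (hlam : IsRate lam) {t : ℝ} (ht : 0 < t) :
    ∫ x in Ioo (-(c * t)) (c * t), edgeComponent c 1 lam (x, t) =
      1 / 2 * (Real.exp (-(2 * cumRate lam t / 3)) - Real.exp (-cumRate lam t)) := by
  rw [setIntegral_congr_fun measurableSet_Ioo fun x hx =>
      edgeComponent_eq_telegraphDensity hc lam hx, integral_const_mul,
    hlam.div_three.integral_telegraphDensity hc ht, cumRate_div_three]
  have : Real.exp (-cumRate lam t) =
      Real.exp (-(2 * cumRate lam t / 3)) * Real.exp (-(cumRate lam t / 3)) := by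
    rw [← Real.exp_add]
    congr 1
    ring
  rw [this]
  ring

theorem solvesEdgeProblem_edgeComponent (hc : 0 < c) (hlam : IsRate lam) :
    SolvesEdgeProblem c lam fun x t => edgeComponent c 1 lam (x, t) where
  contDiffOn := contDiffOn_edgeComponent hc 1 hlam one_le_two
    hlam.div_three.contDiffOn_altDensityReal
  weak := (solvesFirstOrderSystem_edgeComponent hc hlam).weak hc hlam
  classical h2 := by
    have hd := hlam.div_three.contDiffOn_two_altDensityReal (h2.div_const 3)
    exact (solvesFirstOrderSystem_edgeComponent hc hlam).classical hc hlam
      (contDiffOn_edgeComponent hc 1 hlam le_rfl hd)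
      (contDiffOn_edgeComponent hc (-1) hlam le_rfl hd)
  nonneg x t _ := edgeComponent_nonneg hc (x, t)
  integrable _ ht := integrableOn_edgeComponent hc hlam ht
  mass _ ht := integral_edgeComponent hc hlam ht

/-- Halving velocity and position together leaves the times spent in the two directions unchanged
but doubles the density, which turns the factor `1/2` into `1/4`. -/
theorem edgeComponent_eq_telegraphDensity_half (hc : 0 < c) (lam : ℝ → ℝ) {x t : ℝ}
    (hx : |x| < c * t) :
    edgeComponent c 1 lam (x, t) = Real.exp (-(2 * cumRate lam t / 3)) / 4 *
      telegraphDensity (c / 2) (fun t => lam t / 3) (x / 2) t := by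
  have hx1 : x ∈ Ioo (-(c * t)) (c * t) := abs_lt.1 hx
  have hx2 : x / 2 ∈ Ioo (-(c / 2 * t)) (c / 2 * t) :=
    ⟨by linarith [hx1.1], by linarith [hx1.2]⟩
  rw [edgeComponent_eq_telegraphDensity hc lam hx1, telegraphDensity, telegraphDensity,
    indicator_of_mem hx1, indicator_of_mem hx2]
  have e1 : (c / 2 * t + x / 2) / (2 * (c / 2)) = (c * t + x) / (2 * c) := by
    field_simp
  have e2 : (c / 2 * t - x / 2) / (2 * (c / 2)) = (c * t - x) / (2 * c) := by
    field_simp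
  rw [e1, e2]
  field_simp
  ring

end Mass

end

theorem mainTheorem9 {Ω : Type*} [MeasurableSpace Ω] (P : Measure Ω) [IsProbabilityMeasure P]
    (c : ℝ) (hc : 0 < c) (lam : ℝ → ℝ) (hlam : IsRate lam)
    (X Y : ℝ → Ω → ℝ) (hXY : IsReflectingMotion c lam X Y P) :
    ∃ f pbar : ℝ → ℝ → ℝ,
      -- `f(x,t) dx = P{X(t) ∈ dx, Y(t) = 0}` for `|x| < ct`
      (∀ t, 0 < t → ∀ A : Set ℝ, MeasurableSet A → A ⊆ Ioo (-(c * t)) (c * t) →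
        P {ω | X t ω ∈ A ∧ Y t ω = 0} = ∫⁻ x in A, ENNReal.ofReal (f x t)) ∧
      SolvesEdgeProblem c lam f ∧
      -- `pbar` is the absolutely continuous component of every telegraph process with velocity
      -- `c/2` and rate function `λ/3`
      (∀ (Ω' : Type*) [MeasurableSpace Ω'] (P' : Measure Ω') [IsProbabilityMeasure P']
        (T : ℝ → Ω' → ℝ), IsTelegraphProcess (c / 2) (fun t => lam t / 3) T P' →
        ∀ t, 0 < t → IsAbsContComponent (T t) P' (fun x => pbar x t)) ∧
      (∀ x t, |x| < c * t →
        f x t = Real.exp (-(2 * cumRate lam t / 3)) / 4 * pbar (x / 2) t) := by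
  obtain ⟨N, D, hN, hD, hind, hX, hY⟩ := hXY
  refine ⟨fun x t => edgeComponent c 1 lam (x, t),
    telegraphDensity (c / 2) fun t => lam t / 3, ?_, solvesEdgeProblem_edgeComponent hc hlam, ?_,
    fun x t hx => edgeComponent_eq_telegraphDensity_half hc lam hx⟩
  · intro t ht A hA hAt
    simp only [hX t ht.le, hY t ht.le]
    exact measure_edge hc hlam hN hD hind ht hA hAt
  · intro Ω' _ P' _ T hT t ht
    exact hT.isAbsContComponent hlam.div_three (half_pos hc) ht
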